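/- **Setting.** Let $H$ be a real separable Hilbert space, $\rho$ a Borel probability measure on $H\times\mathbb R$ with marginal $\rho_X$ on $H$ and conditional measures $\rho(\cdot|x)$. Assume that the support of $\rho_X$ is compact and that $\langle x,x'\rangle_H\le\kappa^2$ for almost all $x,x'$, where $\kappa\ge 1$. Write $\|\cdot\|_\rho$ for the norm of $L^2(\rho_X)$, let $I_K:H\to L^2(\rho_X)$, $I_K\omega=\langle\omega,\cdot\rangle_H$, and set $T=I_K^*I_K$ and $L_K=I_KI_K^*$. Let $f_\rho(x)=\int y\,d\rho(y|x)$ be the regression function and let $f_H$ be its orthogonal projection in $L^2(\rho_X)$ onto the closure of the range of $I_K$. Functions of compact self-adjoint operators are understood by spectral calculus ($g(L)=\sum_i g(\sigma_i)\,\psi_i\otimes\psi_i$ for an orthonormal eigenbasis); $L_K^{-a}$ with $a>0$ acts on the closure of the range of $L_K$, and $L_K^0$ is the identity. **Assumptions.** Let $\tau\ge1$, $0\le\zeta\le\tau$, $0\le\gamma\le1$, $c_\gamma,M,Q,E,F_\tau>0$, $B,R\ge0$ and $0\le a\le\min(\tfrac12,\zeta)$. 1. For $\rho_X$-almost every $x$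 and all integers $l\ge2$: $\int|y|^l\,d\rho(y|x)\le\tfrac12\,l!\,M^{l-2}Q^2$. 2. $\int_H (f_H(x)-f_\rho(x))^2\,x\otimes x\,d\rho_X(x)\preceq B^2T$, and $f_H=\phi(L_K)g_0$ for some $g_0\in L^2(\rho_X)$ with $\|g_0\|_\rho\le R$, where $\phi(u)=\kappa^{-2(\zeta-1)_+}u^\zeta$. 3. $\operatorname{tr}\big(T(T+\lambda I)^{-1}\big)\le c_\gamma\lambda^{-\gamma}$ for all $\lambda>0$. 4. $\{G_\lambda:[0,\kappa^2]\to[0,\infty)\mid\lambda\in\Lambda\}$, $\Lambda\subset(0,\infty)$, is a family of filter functions with qualification $\tau$: for all $\lambda\in\Lambda$ and $u\in(0,\kappa^2]$, $|u^\alpha G_\lambda(u)|\lambda^{1-\alpha}\le E$ for $\alpha\in[0,1]$ and $|1-G_\lambda(u)u|\,u^\alpha\lambda^{-\alpha}\le F_\tau$ for $\alpha\in[0,\tau]$. **Estimator.** From an i.i.d. sample $(x_i,y_i)_{i=1}^n$, $n\ge1$, drawn from $\rho$, put $T_{\mathbf x}=\frac1n\sum_i\langle\cdot,x_i\rangle_H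 x_i$, $\hat\omega_\lambda=G_\lambda(T_{\mathbf x})\,\frac1n\sum_i y_ix_i$ and $\hat f_\lambda=I_K\hat\omega_\lambda$. **Corollary 4.2.** There is a constant $C>0$ depending only on $\kappa,c_\gamma,\gamma,\zeta,\tau,B,M,Q,R,E,F_\tau,a$ and $\|T\|$ such that, for every $n\ge1$ for which $\lambda=n^{-1/\max(1,2\zeta+\gamma)}$ belongs to $\Lambda$ and every $\delta\in(0,1)$, with probability at least $1-\delta$ the function $\hat f_\lambda-f_H$ lies in the domain of $L_K^{-a}$ and $$\|L_K^{-a}(\hat f_\lambda-f_H)\|_\rho\le C\begin{cases} n^{-\frac{\zeta-a}{2\zeta+\gamma}}\,\log^{2-a}\frac6\delta & \text{if } 2\zeta+\gamma>1,\\[2pt] n^{-(\zeta-a)}\,\log\frac6\delta\,\big(\log\frac6\delta+\log n^\gamma\big)^{1-a} & \text{if } 2\zeta+\gamma\le1.\end{cases}$$ -/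

import Mathlib

open MeasureTheory ProbabilityTheory
open scoped ENNReal

noncomputable section

namespace SpectralAlg

/-! ### Spectral calculus of compact self-adjoint operators -/

section Spectral

variable {V : Type*} [NormedAddCommGroup V] [InnerProductSpace ℝ V] [CompleteSpace V]

/-- The orthogonal projection of `x` onto the eigenspace `ker (L - s)`; it is `0` if `s` is not an
eigenvalue of `L`. -/
def eigenProj (L : V →L[ℝ] V) (s : ℝ) (x : V) : V :=
  (L - s • ContinuousLinearMap.id ℝ V).ker.starProjection x

/-- `x` lies in the domain of `g(L)`, for a compact self-adjoint operator `L`: the orthogonal series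
`∑_s g(s) P_s x` over the eigenvalues `s` of `L` converges, where `P_s` is the orthogonal projection
onto the eigenspace of `s`. -/
def InSpecDomain (L : V →L[ℝ] V) (g : ℝ → ℝ) (x : V) : Prop :=
  Summable fun s : ℝ => g s • eigenProj L s x

/-- Spectral calculus of a compact self-adjoint operator `L`: `g(L) x = ∑_s g(s) P_s x`, the sum
over the eigenvalues `s` of `L` (all other `s` contribute `0`). Equivalently,
`g(L) = ∑_i g(σ_i) ψ_i ⊗ ψ_i` for an orthonormal basis of eigenvectors `ψ_i` with eigenvalues
`σ_i`. The value is meaningful for `x` in the domain `InSpecDomain L g` of `g(L)`. -/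
def specApply (L : V →L[ℝ] V) (g : ℝ → ℝ) (x : V) : V :=
  ∑' s : ℝ, g s • eigenProj L s x

/-- The trace `∑_i ⟨e_i, A e_i⟩` of a positive operator, over an orthonormal basis of the Hilbert
space (for positive operators the sum does not depend on the basis). -/
def posTrace (A : V →L[ℝ] V) : ℝ≥0∞ :=
  ∑' e : (exists_hilbertBasis ℝ V).choose, ENNReal.ofReal (inner ℝ (e : V) (A (e : V)))

/-- The effective dimension `tr (T (T + λ)⁻¹)` of a positive operator `T`, for `λ > 0`. -/
def effDim (T : V →L[ℝ] V) (lam : ℝ) : ℝ≥0∞ :=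
  posTrace (T ∘L Ring.inverse (T + lam • ContinuousLinearMap.id ℝ V))

end Spectral

/-! ### The operators of the learning problem -/

section Operators

variable {H : Type*} [NormedAddCommGroup H] [InnerProductSpace ℝ H] [MeasurableSpace H]

open Classical in
/-- The class in `L²(μ)` of a square integrable function (and `0` for any other function). -/
def toL2 {F : Type*} [NormedAddCommGroup F] (μ : Measure H) (f : H → F) : Lp F 2 μ :=
  if h : MemLp f 2 μ then h.toLp f else 0

/-- The map `I : H → L²(μ)`, `ω ↦ ⟨ω, ·⟩`, for a measure `μ` with `∫ ‖x‖² dμ < ∞`. -/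
def incl (μ : Measure H) : H →L[ℝ] Lp ℝ 2 μ :=
  LinearMap.mkContinuous
    { toFun := fun ω => (innerSL ℝ ω).compLp (toL2 μ fun x : H => x)
      map_add' := fun v w => by
        rw [map_add, ContinuousLinearMap.add_compLp]
      map_smul' := fun c v => by
        rw [map_smulₛₗ, ContinuousLinearMap.smul_compLp]; rfl }
    ‖toL2 μ fun x : H => x‖
    (fun v => by
      refine (ContinuousLinearMap.norm_compLp_le _ _).trans ?_
      rw [innerSL_apply_norm, mul_comm])

/-- `I ω` is indeed the class of the function `x ↦ ⟨ω, x⟩`. -/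
theorem incl_ae (μ : Measure H) (h : MemLp (fun x : H => x) 2 μ) (ω : H) :
    (incl μ ω : H → ℝ) =ᵐ[μ] fun x => inner ℝ ω x := by
  have h1 : (incl μ ω : H → ℝ) =ᵐ[μ] fun x => innerSL ℝ ω ((toL2 μ fun x : H => x : Lp H 2 μ) x) :=
    ContinuousLinearMap.coeFn_compLp' (innerSL ℝ ω) (toL2 μ fun x : H => x)
  have h2 : (toL2 μ fun x : H => x : Lp H 2 μ) =ᵐ[μ] fun x => x := by
    rw [toL2, dif_pos h]; exact h.coeFn_toLp
  filter_upwards [h1, h2] with x hx1 hx2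
  rw [hx1, hx2, innerSL_apply_apply]

variable [CompleteSpace H]

/-- The covariance operator `T = I* I` on `H`. -/
def covOp (μ : Measure H) : H →L[ℝ] H :=
  ContinuousLinearMap.adjoint (incl μ) ∘L incl μ

/-- The integral operator `L = I I*` on `L²(μ)`. -/
def intOp (μ : Measure H) : Lp ℝ 2 μ →L[ℝ] Lp ℝ 2 μ :=
  incl μ ∘L ContinuousLinearMap.adjoint (incl μ)

/-- The regression function `f_ρ(x) = ∫ y dρ(y | x)`. -/
def regFun (ρ : Measure (H × ℝ)) [IsFiniteMeasure ρ] (x : H) : ℝ :=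
  ∫ y, y ∂(ρ.condKernel x)

/-- The target function `f_H`: the orthogonal projection in `L²(ρ_X)` of the regression function
onto the closure of the hypothesis space `{⟨ω, ·⟩ : ω ∈ H}`. -/
def target (ρ : Measure (H × ℝ)) [IsFiniteMeasure ρ] : Lp ℝ 2 ρ.fst :=
  (incl ρ.fst).range.topologicalClosure.starProjection (toL2 ρ.fst (regFun ρ))

/-- The empirical covariance operator `T_x = (1/n) ∑ ⟨·, x_i⟩ x_i`. -/
def empCov {n : ℕ} (z : Fin n → H × ℝ) : H →L[ℝ] H :=
  (n : ℝ)⁻¹ • ∑ i, InnerProductSpace.rankOne ℝ (z i).1 (z i).1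

/-- The vector `S_x* y = (1/n) ∑ y_i x_i`. -/
def empVec {n : ℕ} (z : Fin n → H × ℝ) : H :=
  (n : ℝ)⁻¹ • ∑ i, (z i).2 • (z i).1

/-- The estimator `ω̂ = g(T_x) S_x* y` of the spectral algorithm with filter `g`. -/
def estVec {n : ℕ} (g : ℝ → ℝ) (z : Fin n → H × ℝ) : H :=
  specApply (empCov z) g (empVec z)

/-- The estimated function `f̂ = I ω̂`, in `L²(ρ_X)`. -/
def estFun (ρ : Measure (H × ℝ)) {n : ℕ} (g : ℝ → ℝ) (z : Fin n → H × ℝ) : Lp ℝ 2 ρ.fst :=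
  incl ρ.fst (estVec g z)

end Operators

/-! ### Assumptions -/

/-- `{g_λ : [0, κ²] → [0, ∞) | λ ∈ Λ}` is a family of filter functions with qualification `τ` and
constants `E`, `F`. -/
structure IsFilterFamily (κ τ E F : ℝ) (Λ : Set ℝ) (g : ℝ → ℝ → ℝ) : Prop where
  pos : ∀ lam ∈ Λ, 0 < lam
  nonneg : ∀ lam ∈ Λ, ∀ u ∈ Set.Icc 0 (κ ^ 2), 0 ≤ g lam u
  bound : ∀ α ∈ Set.Icc (0 : ℝ) 1, ∀ lam ∈ Λ, ∀ u ∈ Set.Ioc 0 (κ ^ 2),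
    |u ^ α * g lam u| * lam ^ (1 - α) ≤ E
  residual : ∀ α ∈ Set.Icc (0 : ℝ) τ, ∀ lam ∈ Λ, ∀ u ∈ Set.Ioc 0 (κ ^ 2),
    |1 - g lam u * u| * u ^ α * lam ^ (-α) ≤ F

/-- The Hölder index function `φ(u) = κ^{-2(ζ-1)_+} u^ζ`. -/
def holder (κ ζ : ℝ) (u : ℝ) : ℝ :=
  κ ^ (-2 * max (ζ - 1) 0) * u ^ ζ

section Assumptions

variable {H : Type*} [NormedAddCommGroup H] [InnerProductSpace ℝ H] [MeasurableSpace H]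

/-- The standing assumptions on the marginal: compact support and `⟨x, x'⟩ ≤ κ²` almost
everywhere. -/
def BoundedInput (κ : ℝ) (μ : Measure H) : Prop :=
  IsCompact μ.support ∧ ∀ᵐ x ∂μ, ∀ᵐ x' ∂μ, inner ℝ x x' ≤ κ ^ 2

/-- The moment condition `∫ |y|^l dρ(y | x) ≤ (1/2) l! M^{l-2} Q²` for all `l ≥ 2`, almost surely
in `x`. -/
def MomentCondition (M Q : ℝ) (ρ : Measure (H × ℝ)) [IsFiniteMeasure ρ] : Prop :=
  ∀ᵐ x ∂ρ.fst, ∀ l : ℕ, 2 ≤ l →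
    ∫⁻ y, ENNReal.ofReal (|y| ^ l) ∂(ρ.condKernel x)
      ≤ ENNReal.ofReal (1 / 2 * (l.factorial : ℝ) * M ^ (l - 2) * Q ^ 2)

variable [CompleteSpace H]

/-- The condition `∫ (f_H(x) - f_ρ(x))² x ⊗ x dρ_X(x) ⪯ B² T` (Loewner order). -/
def ApproxCondition (B : ℝ) (ρ : Measure (H × ℝ)) [IsFiniteMeasure ρ] : Prop :=
  ∫ x, ((target ρ : H → ℝ) x - regFun ρ x) ^ 2 • InnerProductSpace.rankOne ℝ x x ∂ρ.fst
    ≤ B ^ 2 • covOp ρ.fst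

/-- The source condition `f_H = φ(L) g₀` with `‖g₀‖ ≤ R`. -/
def SourceCondition (φ : ℝ → ℝ) (R : ℝ) (ρ : Measure (H × ℝ)) [IsFiniteMeasure ρ] : Prop :=
  ∃ g₀ : Lp ℝ 2 ρ.fst, ‖g₀‖ ≤ R ∧ InSpecDomain (intOp ρ.fst) φ g₀ ∧
    target ρ = specApply (intOp ρ.fst) φ g₀

/-- The capacity condition `tr (T (T + λ)⁻¹) ≤ c λ^{-γ}` for all `λ > 0`. -/
def CapacityCondition (c γ : ℝ) (μ : Measure H) : Prop :=
  ∀ lam : ℝ, 0 < lam → effDim (covOp μ) lam ≤ ENNReal.ofReal (c * lam ^ (-γ))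

end Assumptions

/-- The regularization parameter `λ = n^{-1 / max(1, 2ζ+γ)}`. -/
def regParam (ζ γ : ℝ) (n : ℕ) : ℝ :=
  (n : ℝ) ^ (-(1 / max 1 (2 * ζ + γ)))

/-- The rate, without the constant. -/
def rate (ζ γ a : ℝ) (n : ℕ) (δ : ℝ) : ℝ :=
  if 1 < 2 * ζ + γ then
    (n : ℝ) ^ (-((ζ - a) / (2 * ζ + γ))) * Real.log (6 / δ) ^ (2 - a)
  else
    (n : ℝ) ^ (-(ζ - a)) * Real.log (6 / δ) *
      (Real.log (6 / δ) + Real.log ((n : ℝ) ^ γ)) ^ (1 - a)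

end SpectralAlg

end

/-!
Write `X` for the empirical covariance `T_x`, `b = (1/n) ∑ y_i x_i` for the data vector, `G` for the
filter and `K(s) = 1 - G(s) s` for its residual. The target is truncated spectrally: `w` is the
element of `H` with `I w = 1_{L ≥ λ} f_H` (`cutTarget`), so that `‖I w - f_H‖ ≤ λ^ζ R`. The error in
`H` then splits as `G(X) b - w = G(X) (b - X w) - K(X) w` (`estVec_sub_eq`), and the norm of
`L^{-a} I v` interpolates between `‖T^{1/2} v‖` and `‖v‖`, hence is at most `λ^{-a}` times
`‖(T + λ)^{1/2} v‖`. Everything is therefore reduced to `(X + λ)^{1/2} v`, at the cost of a form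
comparison `T + λ ≤ Δ (X + λ)`.

For a fixed sample (`norm_specApply_estVec_sub_le`) the variance part needs the noise `b - X w` in
the norm dual to `(T + λ)^{1/2}`. In the bias part `w = (T + λ)^{ζ - 1/2} w'`, with `w'` bounded, and
the power of `T` has to be replaced by one of `X`. For `ζ ≤ 1/2` no power is needed, for
`1/2 ≤ ζ ≤ 1` the concave power is dominated by an affine function of the form, and for `ζ > 1` the
function `s ↦ (s + λ)^{ζ - 1/2}` is Lipschitz on the spectrum, so that the Hilbert–Schmidt norm of
`X - T` bounds the difference.

The noise and the Hilbert–Schmidt deviation are controlled by a Bernstein inequality for means in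
Hilbert space (`BernsteinMoments.measure_mean_le`), proved with the supermartingale `cosh ‖∑ X_i‖`.
In `measure_input_noise_le` the function `⟨w, ·⟩` is compared with the regression function, which is
bounded by `Q`; the misfit `f_H - f_ρ` enters through the operator inequality with the constant `B`.

The form comparison (`measure_not_inner_covOp_le`) holds at any level `λ ≥ 32 r κ² / n` outside an
event of probability of order `N 2^{-r}`, where `N` bounds the effective dimension. It rests on two
tail bounds for `S = ∑ ξ_i ⊗ ξ_i`, for the smallest eigenvalue when `ξ` is isotropic
(`measure_exists_inner_sampleOp_lt`) and for the largest one
(`measure_exists_le_inner_sampleOp`). Both are moment estimates for the traces of powers of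
`(m + S)^{-1}` and `m + S`. By exchangeability a trace such as `∑ k, ⟨ξ_k, A^q ξ_k⟩` has the mean of
one term; there `ξ_k` is decoupled from the rest of the sum by a rank-one update, which costs only a
factor `2` because `k ↦ ⟨ξ, A^k ξ⟩` is log-convex. This gives recursions in the exponent, and
neither matrix exponentials nor trace inequalities are used.

For `λ = n^{-1 / max(1, 2ζ + γ)}` one has `n λ^s ≥ 1` for all `s ≤ max(1, 2ζ + γ)`, which bounds all
noise terms by `λ^ζ log(6/δ)` (`noise_le`). The number `r` is of the order `log(6/δ) + log n^γ`. If
`2ζ + γ > 1`, then `n λ` is a positive power of `n`, the logarithm of `n` is absorbed, and `Δ` is of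
the order `log(6/δ)`; otherwise `λ = 1/n`, and `Δ` keeps the factor `log(6/δ) + log n^γ`.
-/


noncomputable section

namespace SpectralAlg

set_option linter.unusedSectionVars false


/-! ### Spectral calculus of compact positive operators -/

section SpectralCalculus

variable {V : Type*} [NormedAddCommGroup V] [InnerProductSpace ℝ V] [CompleteSpace V]

/-- A compact, symmetric and positive operator on a real Hilbert space. -/
structure IsCompactPos (L : V →L[ℝ] V) : Prop where
  compact : IsCompactOperator L
  symm : ∀ x y, inner ℝ (L x) y = inner ℝ x (L y)
  nonneg : ∀ x, 0 ≤ inner ℝ x (L x)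

/-- The function `g` is bounded on the eigenvalues of `L`. -/
def BddSpec (L : V →L[ℝ] V) (g : ℝ → ℝ) : Prop :=
  ∃ C : ℝ, 0 ≤ C ∧ ∀ s x, eigenProj L s x ≠ 0 → |g s| ≤ C

theorem eigenProj_add (L : V →L[ℝ] V) (s : ℝ) (x y : V) :
    eigenProj L s (x + y) = eigenProj L s x + eigenProj L s y := by
  simp [eigenProj]

theorem eigenProj_sub (L : V →L[ℝ] V) (s : ℝ) (x y : V) :
    eigenProj L s (x - y) = eigenProj L s x - eigenProj L s y := by
  simp [eigenProj]

theorem eigenProj_smul (L : V →L[ℝ] V) (s c : ℝ) (x : V) :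
    eigenProj L s (c • x) = c • eigenProj L s x := by
  simp [eigenProj]

theorem mem_ker_iff (L : V →L[ℝ] V) (s : ℝ) (x : V) :
    x ∈ (L - s • ContinuousLinearMap.id ℝ V).ker ↔ L x = s • x := by
  rw [LinearMap.mem_ker]; simp [sub_eq_zero]

theorem apply_eigenProj (L : V →L[ℝ] V) (s : ℝ) (x : V) :
    L (eigenProj L s x) = s • eigenProj L s x := by
  have h := Submodule.starProjection_apply_mem
    ((L - s • ContinuousLinearMap.id ℝ V).ker) x
  exact (mem_ker_iff L s _).1 h

theorem eigenProj_of_apply_eq {L : V →L[ℝ] V} {s : ℝ} {x : V} (h : L x = s • x) :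
    eigenProj L s x = x :=
  Submodule.starProjection_eq_self_iff.2 ((mem_ker_iff L s x).2 h)

theorem eigenProj_eigenProj (L : V →L[ℝ] V) (s : ℝ) (x : V) :
    eigenProj L s (eigenProj L s x) = eigenProj L s x :=
  eigenProj_of_apply_eq (apply_eigenProj L s x)

theorem inner_eigenProj_left (L : V →L[ℝ] V) (s : ℝ) (x y : V) :
    inner ℝ (eigenProj L s x) y = inner ℝ x (eigenProj L s y) :=
  Submodule.inner_starProjection_left_eq_right _ x y

/-- An eigenvector whose difference to `x` is orthogonal to the eigenspace is the projection. -/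
theorem eigenProj_eq_of {L : V →L[ℝ] V} {s : ℝ} {x u : V} (hu : L u = s • u)
    (h : ∀ w, L w = s • w → inner ℝ (x - u) w = 0) : eigenProj L s x = u :=
  Submodule.eq_starProjection_of_mem_of_inner_eq_zero ((mem_ker_iff L s u).2 hu)
    fun w hw => h w ((mem_ker_iff L s w).1 hw)

theorem inner_eigenProj_self (L : V →L[ℝ] V) (s : ℝ) (x : V) :
    inner ℝ (eigenProj L s x) x = ‖eigenProj L s x‖ ^ 2 := by
  rw [← real_inner_self_eq_norm_sq, inner_eigenProj_left L s x (eigenProj L s x),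
    eigenProj_eigenProj, real_inner_comm]

theorem IsCompactPos.inner_eigenvectors {L : V →L[ℝ] V} (hL : IsCompactPos L) {s t : ℝ}
    (hst : s ≠ t) {x y : V} (hx : L x = s • x) (hy : L y = t • y) : inner ℝ x y = 0 := by
  have h := hL.symm x y
  rw [hx, hy, real_inner_smul_left, real_inner_smul_right] at h
  have : (s - t) * inner ℝ x y = 0 := by linarith
  rcases mul_eq_zero.1 this with h | h
  · exact absurd (sub_eq_zero.1 h) hst
  · exact h

theorem IsCompactPos.eigenProj_eigenvector {L : V →L[ℝ] V} (hL : IsCompactPos L) {s t : ℝ}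
    (hst : s ≠ t) {y : V} (hy : L y = t • y) : eigenProj L s y = 0 := by
  refine eigenProj_eq_of (by simp) fun w hw => ?_
  rw [sub_zero]
  exact hL.inner_eigenvectors hst.symm hy hw

theorem IsCompactPos.orthogonalFamily {L : V →L[ℝ] V} (hL : IsCompactPos L) :
    OrthogonalFamily ℝ (fun s : ℝ => (L - s • ContinuousLinearMap.id ℝ V).ker)
      fun s => ((L - s • ContinuousLinearMap.id ℝ V).ker).subtypeₗᵢ := by
  intro s t hst x y
  exact hL.inner_eigenvectors hst ((mem_ker_iff L s x).1 x.2) ((mem_ker_iff L t y).1 y.2)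

theorem IsCompactPos.summable_iff {L : V →L[ℝ] V} (hL : IsCompactPos L) (f : ℝ → V)
    (hf : ∀ s, L (f s) = s • f s) : Summable f ↔ Summable fun s => ‖f s‖ ^ 2 :=
  hL.orthogonalFamily.summable_iff_norm_sq_summable
    fun s => ⟨f s, (mem_ker_iff L s (f s)).2 (hf s)⟩

theorem IsCompactPos.summable_norm_sq {L : V →L[ℝ] V} (hL : IsCompactPos L) (x : V) :
    Summable fun s => ‖eigenProj L s x‖ ^ 2 := by
  refine summable_of_sum_le (c := ‖x‖ ^ 2) (fun s => sq_nonneg _) fun F => ?_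
  have h1 : ‖∑ s ∈ F, eigenProj L s x‖ ^ 2 = ∑ s ∈ F, ‖eigenProj L s x‖ ^ 2 :=
    hL.orthogonalFamily.norm_sum
      (fun s => ⟨eigenProj L s x, (mem_ker_iff L s _).2 (apply_eigenProj L s x)⟩) F
  have h2 : inner ℝ (∑ s ∈ F, eigenProj L s x) x = ∑ s ∈ F, ‖eigenProj L s x‖ ^ 2 := by
    rw [sum_inner]
    exact Finset.sum_congr rfl fun s _ => inner_eigenProj_self L s x
  have h3 := real_inner_le_norm (∑ s ∈ F, eigenProj L s x) x
  rw [h2, ← h1] at h3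
  rw [← h1]
  have h4 : ‖∑ s ∈ F, eigenProj L s x‖ ≤ ‖x‖ := by
    rcases eq_or_lt_of_le (norm_nonneg (∑ s ∈ F, eigenProj L s x)) with h | h
    · rw [← h]; exact norm_nonneg _
    · rw [sq] at h3; exact le_of_mul_le_mul_left h3 h
  gcongr

theorem IsCompactPos.summable_eigenProj {L : V →L[ℝ] V} (hL : IsCompactPos L) (x : V) :
    Summable fun s => eigenProj L s x :=
  (hL.summable_iff _ fun s => apply_eigenProj L s x).2 (hL.summable_norm_sq x)

/-- The projection of an orthogonal series of eigenvectors picks one term. -/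
theorem IsCompactPos.eigenProj_tsum {L : V →L[ℝ] V} (hL : IsCompactPos L) {f : ℝ → V}
    (hf : ∀ s, L (f s) = s • f s) (hs : Summable f) (t : ℝ) :
    eigenProj L t (∑' s, f s) = f t := by
  have h1 : eigenProj L t (∑' s, f s) = ∑' s, eigenProj L t (f s) :=
    ContinuousLinearMap.map_tsum ((L - t • ContinuousLinearMap.id ℝ V).ker.starProjection) hs
  rw [h1, tsum_eq_single t fun s hst => hL.eigenProj_eigenvector hst.symm (hf s)]
  exact eigenProj_of_apply_eq (hf t)

/-- Completeness of the eigenvectors of a compact positive operator. -/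
theorem IsCompactPos.hasSum_eigenProj {L : V →L[ℝ] V} (hL : IsCompactPos L) (x : V) :
    HasSum (fun s => eigenProj L s x) x := by
  have hs := hL.summable_eigenProj x
  have key : x - ∑' s, eigenProj L s x = 0 := by
    have hbot := ContinuousLinearMap.orthogonalComplement_iSup_eigenspaces_eq_bot hL.compact
      (fun x y => hL.symm x y)
    rw [← Submodule.mem_bot ℝ, ← hbot, Submodule.mem_orthogonal]
    intro u hu
    induction hu using Submodule.iSup_induction' with
    | mem t u hu =>
      have hu' : L u = t • u := by simpa using hu
      have hp : eigenProj L t (x - ∑' s, eigenProj L s x) = 0 := by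
        rw [eigenProj_sub, hL.eigenProj_tsum (fun s => apply_eigenProj L s x) hs, sub_self]
      rw [← eigenProj_of_apply_eq hu', inner_eigenProj_left, hp, inner_zero_right]
    | zero => simp
    | add u v _ _ hu hv => rw [inner_add_left, hu, hv, add_zero]
  have := hs.hasSum
  rwa [← sub_eq_zero.1 key] at this

theorem IsCompactPos.ext {L : V →L[ℝ] V} (hL : IsCompactPos L) {x y : V}
    (h : ∀ s, eigenProj L s x = eigenProj L s y) : x = y := by
  refine (hL.hasSum_eigenProj x).unique ?_
  simp_rw [h]
  exact hL.hasSum_eigenProj y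

theorem IsCompactPos.hasSum_inner {L : V →L[ℝ] V} (hL : IsCompactPos L) (x y : V) :
    HasSum (fun s => inner ℝ (eigenProj L s x) (eigenProj L s y)) (inner ℝ x y) := by
  have h := (hL.hasSum_eigenProj x).mapL (innerSL ℝ y)
  simp only [innerSL_apply_apply] at h
  rw [real_inner_comm]
  refine h.congr_fun fun s => ?_
  rw [← inner_eigenProj_left, eigenProj_eigenProj, real_inner_comm]

theorem IsCompactPos.hasSum_norm_sq {L : V →L[ℝ] V} (hL : IsCompactPos L) (x : V) :
    HasSum (fun s => ‖eigenProj L s x‖ ^ 2) (‖x‖ ^ 2) := by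
  simpa only [real_inner_self_eq_norm_sq] using hL.hasSum_inner x x

theorem IsCompactPos.eigenProj_apply {L : V →L[ℝ] V} (hL : IsCompactPos L) (s : ℝ) (x : V) :
    eigenProj L s (L x) = s • eigenProj L s x := by
  refine eigenProj_eq_of ?_ fun w hw => ?_
  · rw [map_smul, apply_eigenProj]
  · rw [inner_sub_left, real_inner_smul_left, hL.symm, hw, real_inner_smul_right,
      inner_eigenProj_left, eigenProj_of_apply_eq hw, sub_self]

theorem IsCompactPos.hasSum_inner_apply {L : V →L[ℝ] V} (hL : IsCompactPos L) (x : V) :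
    HasSum (fun s => s * ‖eigenProj L s x‖ ^ 2) (inner ℝ x (L x)) := by
  have h := hL.hasSum_inner x (L x)
  convert h using 2 with s
  rw [hL.eigenProj_apply, real_inner_smul_right, real_inner_self_eq_norm_sq]

theorem IsCompactPos.eigenProj_eq_zero_of_neg {L : V →L[ℝ] V} (hL : IsCompactPos L) {s : ℝ}
    (hs : s < 0) (x : V) : eigenProj L s x = 0 := by
  by_contra h
  have h1 := hL.nonneg (eigenProj L s x)
  rw [apply_eigenProj, real_inner_smul_right, real_inner_self_eq_norm_sq] at h1
  have : 0 < ‖eigenProj L s x‖ ^ 2 := by positivity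
  nlinarith

theorem eigenProj_eq_zero_of_gt {L : V →L[ℝ] V} {C : ℝ}
    (hC : ∀ x, inner ℝ x (L x) ≤ C * ‖x‖ ^ 2) {s : ℝ} (hs : C < s) (x : V) :
    eigenProj L s x = 0 := by
  by_contra h
  have h1 := hC (eigenProj L s x)
  rw [apply_eigenProj, real_inner_smul_right, real_inner_self_eq_norm_sq] at h1
  have : 0 < ‖eigenProj L s x‖ ^ 2 := by positivity
  nlinarith

theorem IsCompactPos.nonneg_of_ne {L : V →L[ℝ] V} (hL : IsCompactPos L) {s : ℝ} {x : V}
    (h : eigenProj L s x ≠ 0) : 0 ≤ s := by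
  by_contra hs
  exact h (hL.eigenProj_eq_zero_of_neg (not_le.1 hs) x)

/-- Bounds on the spectrum only have to be checked on `[0, ∞)`. -/
theorem IsCompactPos.bddSpec {L : V →L[ℝ] V} (hL : IsCompactPos L) {g : ℝ → ℝ} {C : ℝ}
    (hC : 0 ≤ C) (h : ∀ s, 0 ≤ s → |g s| ≤ C) : BddSpec L g :=
  ⟨C, hC, fun s _ hs => h s (hL.nonneg_of_ne hs)⟩

/-- Scalar inequalities between weights only have to be checked on `[0, ∞)`. -/
theorem IsCompactPos.mul_norm_sq_le {L : V →L[ℝ] V} (hL : IsCompactPos L) {f g : ℝ → ℝ}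
    (h : ∀ s, 0 ≤ s → f s ≤ g s) (s : ℝ) (x : V) :
    f s * ‖eigenProj L s x‖ ^ 2 ≤ g s * ‖eigenProj L s x‖ ^ 2 := by
  by_cases hx : eigenProj L s x = 0
  · simp [hx]
  · exact mul_le_mul_of_nonneg_right (h s (hL.nonneg_of_ne hx)) (sq_nonneg _)

theorem IsCompactPos.inSpecDomain_iff {L : V →L[ℝ] V} (hL : IsCompactPos L) (g : ℝ → ℝ) (x : V) :
    InSpecDomain L g x ↔ Summable fun s => g s ^ 2 * ‖eigenProj L s x‖ ^ 2 := by
  rw [InSpecDomain, hL.summable_iff]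
  · simp_rw [norm_smul, mul_pow, Real.norm_eq_abs, sq_abs]
  · intro s
    rw [map_smul, apply_eigenProj, smul_comm]

theorem IsCompactPos.eigenProj_specApply {L : V →L[ℝ] V} (hL : IsCompactPos L) {g : ℝ → ℝ} {x : V}
    (h : InSpecDomain L g x) (t : ℝ) : eigenProj L t (specApply L g x) = g t • eigenProj L t x :=
  hL.eigenProj_tsum (fun s => by rw [map_smul, apply_eigenProj, smul_comm]) h t

theorem IsCompactPos.hasSum_norm_sq_specApply {L : V →L[ℝ] V} (hL : IsCompactPos L) {g : ℝ → ℝ}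
    {x : V} (h : InSpecDomain L g x) :
    HasSum (fun s => g s ^ 2 * ‖eigenProj L s x‖ ^ 2) (‖specApply L g x‖ ^ 2) := by
  have := hL.hasSum_norm_sq (specApply L g x)
  simpa only [hL.eigenProj_specApply h, norm_smul, mul_pow, Real.norm_eq_abs, sq_abs] using this

theorem InSpecDomain.add {L : V →L[ℝ] V} {g : ℝ → ℝ} {x y : V}
    (hx : InSpecDomain L g x) (hy : InSpecDomain L g y) : InSpecDomain L g (x + y) := by
  have := Summable.add hx hy
  simpa only [InSpecDomain, eigenProj_add, smul_add] using this

theorem specApply_add {L : V →L[ℝ] V} {g : ℝ → ℝ} {x y : V}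
    (hx : InSpecDomain L g x) (hy : InSpecDomain L g y) :
    specApply L g (x + y) = specApply L g x + specApply L g y := by
  have := Summable.tsum_add hx hy
  simpa only [specApply, eigenProj_add, smul_add] using this

theorem IsCompactPos.inSpecDomain {L : V →L[ℝ] V} (hL : IsCompactPos L) {g : ℝ → ℝ}
    (hg : BddSpec L g) (x : V) : InSpecDomain L g x := by
  obtain ⟨C, hC, hg⟩ := hg
  rw [hL.inSpecDomain_iff]
  refine Summable.of_nonneg_of_le (fun s => by positivity) (fun s => ?_)
    ((hL.summable_norm_sq x).mul_left (C ^ 2))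
  by_cases hx : eigenProj L s x = 0
  · simp [hx]
  · have := hg s x hx
    rw [← sq_abs]
    gcongr

open Classical in
/-- The bounded operator `g(L)`, for `g` bounded on the eigenvalues of the compact positive
operator `L` (and `0` for any other `L` and `g`). -/
def specOp (L : V →L[ℝ] V) (g : ℝ → ℝ) : V →L[ℝ] V :=
  if h : IsCompactPos L ∧ BddSpec L g then
    LinearMap.mkContinuous
      { toFun := specApply L g
        map_add' := fun x y => specApply_add (h.1.inSpecDomain h.2 x) (h.1.inSpecDomain h.2 y)
        map_smul' := fun c x => by
          refine h.1.ext fun s => ?_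
          rw [h.1.eigenProj_specApply (h.1.inSpecDomain h.2 _), RingHom.id_apply, eigenProj_smul,
            eigenProj_smul, h.1.eigenProj_specApply (h.1.inSpecDomain h.2 _), smul_comm] }
      h.2.choose
      (fun x => by
        have hC := h.2.choose_spec
        refine abs_le_of_sq_le_sq' ?_ (mul_nonneg hC.1 (norm_nonneg x)) |>.2
        rw [mul_pow]
        refine hasSum_le (fun s => ?_)
          (h.1.hasSum_norm_sq_specApply (h.1.inSpecDomain h.2 x))
          ((h.1.hasSum_norm_sq x).mul_left (h.2.choose ^ 2))
        by_cases hx : eigenProj L s x = 0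
        · simp [hx]
        · have := hC.2 s x hx
          rw [← sq_abs (g s)]
          gcongr)
  else 0

theorem IsCompactPos.specOp_apply {L : V →L[ℝ] V} (hL : IsCompactPos L) {g : ℝ → ℝ}
    (hg : BddSpec L g) (x : V) : specOp L g x = specApply L g x := by
  rw [specOp, dif_pos ⟨hL, hg⟩]; rfl

theorem IsCompactPos.eigenProj_specOp {L : V →L[ℝ] V} (hL : IsCompactPos L) {g : ℝ → ℝ}
    (hg : BddSpec L g) (s : ℝ) (x : V) :
    eigenProj L s (specOp L g x) = g s • eigenProj L s x := by
  rw [hL.specOp_apply hg, hL.eigenProj_specApply (hL.inSpecDomain hg x)]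

theorem IsCompactPos.hasSum_norm_sq_specOp {L : V →L[ℝ] V} (hL : IsCompactPos L) {g : ℝ → ℝ}
    (hg : BddSpec L g) (x : V) :
    HasSum (fun s => g s ^ 2 * ‖eigenProj L s x‖ ^ 2) (‖specOp L g x‖ ^ 2) := by
  rw [hL.specOp_apply hg]
  exact hL.hasSum_norm_sq_specApply (hL.inSpecDomain hg x)

theorem IsCompactPos.specOp_symm {L : V →L[ℝ] V} (hL : IsCompactPos L) {g : ℝ → ℝ}
    (hg : BddSpec L g) (x y : V) :
    inner ℝ (specOp L g x) y = inner ℝ x (specOp L g y) := by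
  refine (hL.hasSum_inner _ _).unique ?_
  have := hL.hasSum_inner x (specOp L g y)
  simpa only [hL.eigenProj_specOp hg, real_inner_smul_left, real_inner_smul_right] using this

theorem IsCompactPos.specOp_comp {L : V →L[ℝ] V} (hL : IsCompactPos L) {g h k : ℝ → ℝ}
    (hg : BddSpec L g) (hh : BddSpec L h) (hk : BddSpec L k) (hgh : ∀ s, 0 ≤ s → g s * h s = k s)
    (x : V) : specOp L g (specOp L h x) = specOp L k x := by
  refine hL.ext fun s => ?_
  rw [hL.eigenProj_specOp hg, hL.eigenProj_specOp hh, hL.eigenProj_specOp hk, smul_smul]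
  by_cases hx : eigenProj L s x = 0
  · simp [hx]
  · rw [hgh s (hL.nonneg_of_ne hx)]

/-- Comparison of weighted sums of squares, the form in which all scalar estimates are used. -/
theorem IsCompactPos.norm_sq_specOp_le {L : V →L[ℝ] V} (hL : IsCompactPos L) {g : ℝ → ℝ}
    (hg : BddSpec L g) {α β : ℝ} (h : ∀ s, 0 ≤ s → g s ^ 2 ≤ α * s + β) (x : V) :
    ‖specOp L g x‖ ^ 2 ≤ α * inner ℝ x (L x) + β * ‖x‖ ^ 2 := by
  refine hasSum_le (fun s => ?_) (hL.hasSum_norm_sq_specOp hg x)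
    (((hL.hasSum_inner_apply x).mul_left α).add ((hL.hasSum_norm_sq x).mul_left β))
  have := hL.mul_norm_sq_le h s x
  linarith

theorem IsCompactPos.norm_specOp_le {L : V →L[ℝ] V} (hL : IsCompactPos L) {g : ℝ → ℝ}
    (hg : BddSpec L g) {C : ℝ} (hC : 0 ≤ C) (h : ∀ s, 0 ≤ s → |g s| ≤ C) (x : V) :
    ‖specOp L g x‖ ≤ C * ‖x‖ := by
  refine abs_le_of_sq_le_sq' ?_ (by positivity) |>.2
  have := hL.norm_sq_specOp_le hg (α := 0) (β := C ^ 2)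
    (fun s hs => by rw [zero_mul, zero_add, ← sq_abs]; gcongr; exact h s hs) x
  rw [mul_pow]; linarith

end SpectralCalculus

/-! ### The inclusion of the hypothesis space and its covariance operators -/

section Inclusion

variable {H : Type*} [NormedAddCommGroup H] [InnerProductSpace ℝ H] [CompleteSpace H]
  [TopologicalSpace.SeparableSpace H] [MeasurableSpace H] [BorelSpace H]
  {μ : Measure H} [IsProbabilityMeasure μ] {κ : ℝ}

/-- Almost every input has norm at most `κ`: a point of the support with `‖x‖² > κ²` would have a
neighbourhood, of positive measure, on which all inner products exceed `κ²`. -/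
theorem BoundedInput.norm_le (hκ : 0 ≤ κ) (h : BoundedInput κ μ) : ∀ᵐ x ∂μ, ‖x‖ ≤ κ := by
  have : SecondCountableTopology H := UniformSpace.secondCountable_of_separable H
  filter_upwards [Measure.support_mem_ae (μ := μ)] with x hx
  by_contra hxk
  have hlt : κ ^ 2 < inner ℝ x x := by
    rw [real_inner_self_eq_norm_sq]
    gcongr
    exact not_le.1 hxk
  have hcont : ContinuousAt (fun p : H × H => (inner ℝ p.1 p.2 : ℝ)) (x, x) := by fun_prop
  have hev := hcont.eventually (lt_mem_nhds hlt)
  rw [nhds_prod_eq, Filter.Eventually, Filter.mem_prod_same_iff] at hev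
  obtain ⟨U, hU, hev⟩ := hev
  have hpos : μ U ≠ 0 := ((Measure.mem_support_iff_forall x).1 hx U hU).ne'
  have h1 := frequently_ae_mem_iff.2 hpos
  obtain ⟨y, hyU, hy⟩ := (h1.and_eventually h.2).exists
  obtain ⟨z, hzU, hz⟩ := (h1.and_eventually hy).exists
  exact absurd hz (not_le.2 (hev (Set.mk_mem_prod hyU hzU)))

theorem memLp_id (hb : ∀ᵐ x ∂μ, ‖x‖ ≤ κ) (p : ℝ≥0∞) : MemLp (fun x : H => x) p μ := by
  have : SecondCountableTopology H := UniformSpace.secondCountable_of_separable H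
  exact MemLp.of_bound continuous_id.aestronglyMeasurable κ hb

theorem aestronglyMeasurable_of_continuous {F : Type*} [TopologicalSpace F]
    [TopologicalSpace.PseudoMetrizableSpace F] {f : H → F} (hf : Continuous f) :
    AEStronglyMeasurable f μ := by
  have : SecondCountableTopology H := UniformSpace.secondCountable_of_separable H
  exact hf.aestronglyMeasurable

theorem integrable_inner_mul_inner (hb : ∀ᵐ x ∂μ, ‖x‖ ≤ κ) (v w : H) :
    Integrable (fun x => (inner ℝ v x : ℝ) * inner ℝ w x) μ := by
  refine Integrable.of_bound (aestronglyMeasurable_of_continuous (by fun_prop))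
    (‖v‖ * κ * (‖w‖ * κ)) ?_
  filter_upwards [hb] with x hx
  rw [norm_mul]
  have h1 := (norm_inner_le_norm (𝕜 := ℝ) v x).trans
    (mul_le_mul_of_nonneg_left hx (norm_nonneg v))
  have h2 := (norm_inner_le_norm (𝕜 := ℝ) w x).trans
    (mul_le_mul_of_nonneg_left hx (norm_nonneg w))
  exact mul_le_mul h1 h2 (norm_nonneg _) ((norm_nonneg _).trans h1)

theorem inner_incl (hb : ∀ᵐ x ∂μ, ‖x‖ ≤ κ) (v : H) (f : Lp ℝ 2 μ) :
    inner ℝ (incl μ v) f = ∫ x, inner ℝ v x * f x ∂μ := by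
  rw [L2.inner_def]
  refine integral_congr_ae ?_
  filter_upwards [incl_ae μ (memLp_id hb 2) v] with x hx
  rw [hx]; simp [mul_comm]

theorem inner_covOp (hb : ∀ᵐ x ∂μ, ‖x‖ ≤ κ) (v w : H) :
    inner ℝ v (covOp μ w) = ∫ x, inner ℝ v x * inner ℝ w x ∂μ := by
  rw [covOp, ContinuousLinearMap.comp_apply, ContinuousLinearMap.adjoint_inner_right,
    inner_incl hb]
  refine integral_congr_ae ?_
  filter_upwards [incl_ae μ (memLp_id hb 2) w] with x hx
  rw [hx]

theorem norm_incl_sq (v : H) : ‖incl μ v‖ ^ 2 = inner ℝ v (covOp μ v) := by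
  rw [covOp, ContinuousLinearMap.comp_apply, ContinuousLinearMap.adjoint_inner_right,
    real_inner_self_eq_norm_sq]

theorem norm_adjoint_incl_sq (f : Lp ℝ 2 μ) :
    ‖ContinuousLinearMap.adjoint (incl μ) f‖ ^ 2 = inner ℝ f (intOp μ f) := by
  rw [intOp, ContinuousLinearMap.comp_apply, ← ContinuousLinearMap.adjoint_inner_left,
    real_inner_self_eq_norm_sq]

theorem inner_covOp_self_eq (hb : ∀ᵐ x ∂μ, ‖x‖ ≤ κ) (v : H) :
    inner ℝ v (covOp μ v) = ∫ x, (inner ℝ v x) ^ 2 ∂μ := by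
  rw [inner_covOp hb]; simp_rw [sq]

theorem integrable_inner_sq (hb : ∀ᵐ x ∂μ, ‖x‖ ≤ κ) (v : H) :
    Integrable (fun x => (inner ℝ v x : ℝ) ^ 2) μ := by
  simpa only [sq] using integrable_inner_mul_inner hb v v

theorem continuous_rankOne_self {V : Type*} [NormedAddCommGroup V] [InnerProductSpace ℝ V] :
    Continuous fun x : V => InnerProductSpace.rankOne ℝ x x :=
  (InnerProductSpace.rankOne ℝ).continuous.clm_apply continuous_id

theorem integrable_rankOne (hb : ∀ᵐ x ∂μ, ‖x‖ ≤ κ) :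
    Integrable (fun x : H => InnerProductSpace.rankOne ℝ x x) μ := by
  refine Integrable.of_bound (aestronglyMeasurable_of_continuous continuous_rankOne_self) (κ * κ) ?_
  filter_upwards [hb] with x hx
  rw [InnerProductSpace.norm_rankOne]
  exact mul_le_mul hx hx (norm_nonneg x) ((norm_nonneg x).trans hx)

/-- The covariance operator as an operator-valued expectation. -/
theorem covOp_eq_integral (hb : ∀ᵐ x ∂μ, ‖x‖ ≤ κ) :
    covOp μ = ∫ x, InnerProductSpace.rankOne ℝ x x ∂μ := by
  ext w
  refine ext_inner_left ℝ fun v => ?_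
  rw [ContinuousLinearMap.integral_apply (integrable_rankOne hb),
    ← integral_inner ((integrable_rankOne hb).apply_continuousLinearMap w), inner_covOp hb]
  refine integral_congr_ae (Filter.Eventually.of_forall fun x => ?_)
  simp only [InnerProductSpace.rankOne_apply, real_inner_smul_right]
  rw [real_inner_comm x w, mul_comm]

theorem isCompactOperator_rankOne {V W : Type*} [NormedAddCommGroup V] [InnerProductSpace ℝ V]
    [NormedAddCommGroup W] [InnerProductSpace ℝ W] (x : V) (y : W) :
    IsCompactOperator (InnerProductSpace.rankOne ℝ x y) := by
  rw [InnerProductSpace.rankOne_def']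
  exact IsCompactOperator.comp_clm (f := ContinuousLinearMap.toSpanSingleton ℝ x)
    (isCompactOperator_of_locallyCompactSpace_rng _) _

/-- The covariance operator is compact, as an average of operators of rank one. -/
theorem isCompactPos_covOp (hb : ∀ᵐ x ∂μ, ‖x‖ ≤ κ) : IsCompactPos (covOp μ) where
  compact := by
    rw [covOp_eq_integral hb]
    refine Convex.integral_mem (s := {A : H →L[ℝ] H | IsCompactOperator A}) ?_
      isClosed_setOfPred_isCompactOperator
      (Filter.Eventually.of_forall fun x => isCompactOperator_rankOne x x) (integrable_rankOne hb)
    exact (compactOperator (RingHom.id ℝ) H H).convex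
  symm x y := by
    rw [covOp, ContinuousLinearMap.comp_apply, ContinuousLinearMap.comp_apply,
      ContinuousLinearMap.adjoint_inner_right, ContinuousLinearMap.adjoint_inner_left]
  nonneg x := by rw [← norm_incl_sq]; positivity

/-- The inclusion is compact: it is approximated by its restriction to the eigenvectors of the
covariance operator with eigenvalue at least `ε`. -/
theorem isCompactOperator_incl (hb : ∀ᵐ x ∂μ, ‖x‖ ≤ κ) : IsCompactOperator (incl μ) := by
  have hT := isCompactPos_covOp hb
  let f : ℕ → ℝ → ℝ := fun k s => if 1 / ((k : ℝ) + 1) ≤ s then s⁻¹ else 0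
  have hf : ∀ k, BddSpec (covOp μ) (f k) := fun k =>
    hT.bddSpec (C := (k : ℝ) + 1) (by positivity) fun s hs => by
      simp only [f]
      split_ifs with h
      · rw [abs_of_nonneg (inv_nonneg.2 hs)]
        refine inv_le_of_inv_le₀ (by positivity) ?_
        rwa [one_div] at h
      · rw [abs_zero]; positivity
  refine isCompactOperator_of_tendsto (l := Filter.atTop)
    (F := fun k => incl μ ∘L (specOp (covOp μ) (f k) ∘L covOp μ)) ?_
    (Filter.Eventually.of_forall fun k =>
      (hT.compact.clm_comp (specOp (covOp μ) (f k))).clm_comp (incl μ))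
  rw [tendsto_iff_norm_sub_tendsto_zero]
  have hlim : Filter.Tendsto (fun k : ℕ => √(1 / ((k : ℝ) + 1))) Filter.atTop (nhds 0) := by
    rw [← Real.sqrt_zero]
    exact (Real.continuous_sqrt.tendsto 0).comp tendsto_one_div_add_atTop_nhds_zero_nat
  refine squeeze_zero (fun k => norm_nonneg _) (fun k => ?_) hlim
  refine ContinuousLinearMap.opNorm_le_bound _ (Real.sqrt_nonneg _) fun v => ?_
  have hv : (incl μ ∘L (specOp (covOp μ) (f k) ∘L covOp μ) - incl μ) v
      = incl μ (specOp (covOp μ) (f k) (covOp μ v) - v) := by simp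
  rw [hv]
  refine abs_le_of_sq_le_sq' ?_ (by positivity) |>.2
  rw [norm_incl_sq, mul_pow, Real.sq_sqrt (by positivity)]
  refine hasSum_le (fun s => ?_) (hT.hasSum_inner_apply _) ((hT.hasSum_norm_sq v).mul_left _)
  rw [eigenProj_sub, hT.eigenProj_specOp (hf k), hT.eigenProj_apply, smul_smul]
  by_cases hx : eigenProj (covOp μ) s v = 0
  · simp [hx]
  have hs := hT.nonneg_of_ne hx
  simp only [f]
  split_ifs with h
  · have hs0 : s ≠ 0 := by
      rintro rfl
      have : (0 : ℝ) < 1 / ((k : ℝ) + 1) := by positivity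
      linarith
    rw [inv_mul_cancel₀ hs0, one_smul, sub_self, norm_zero]
    simp only [ne_eq, OfNat.ofNat_ne_zero, not_false_eq_true, zero_pow, mul_zero]
    positivity
  · rw [zero_mul, zero_smul, zero_sub, norm_neg]
    have := not_le.1 h
    gcongr

theorem isCompactPos_intOp (hb : ∀ᵐ x ∂μ, ‖x‖ ≤ κ) : IsCompactPos (intOp μ) where
  compact := (isCompactOperator_incl hb).comp_clm _
  symm x y := by
    rw [intOp, ContinuousLinearMap.comp_apply, ContinuousLinearMap.comp_apply,
      ← ContinuousLinearMap.adjoint_inner_right, ContinuousLinearMap.adjoint_inner_left]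
  nonneg x := by rw [← norm_adjoint_incl_sq]; positivity

theorem intOp_incl (v : H) : intOp μ (incl μ v) = incl μ (covOp μ v) := rfl

theorem covOp_adjoint_incl (f : Lp ℝ 2 μ) :
    covOp μ (ContinuousLinearMap.adjoint (incl μ) f)
      = ContinuousLinearMap.adjoint (incl μ) (intOp μ f) := rfl

/-- The inclusion intertwines the eigenprojections of the covariance and integral operators. -/
theorem eigenProj_incl (s : ℝ) (v : H) :
    eigenProj (intOp μ) s (incl μ v) = incl μ (eigenProj (covOp μ) s v) := by
  refine eigenProj_eq_of ?_ fun w hw => ?_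
  · rw [intOp_incl, apply_eigenProj, map_smul]
  · rw [← map_sub, ← ContinuousLinearMap.adjoint_inner_right]
    have h : covOp μ (ContinuousLinearMap.adjoint (incl μ) w)
        = s • ContinuousLinearMap.adjoint (incl μ) w := by
      rw [covOp_adjoint_incl, hw, map_smul]
    rw [← eigenProj_of_apply_eq h, ← inner_eigenProj_left, eigenProj_sub, eigenProj_eigenProj,
      sub_self, inner_zero_left]

theorem eigenProj_adjoint_incl (s : ℝ) (f : Lp ℝ 2 μ) :
    eigenProj (covOp μ) s (ContinuousLinearMap.adjoint (incl μ) f)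
      = ContinuousLinearMap.adjoint (incl μ) (eigenProj (intOp μ) s f) := by
  refine ext_inner_left ℝ fun v => ?_
  rw [← inner_eigenProj_left, ContinuousLinearMap.adjoint_inner_right,
    ContinuousLinearMap.adjoint_inner_right, ← eigenProj_incl, inner_eigenProj_left]

theorem norm_sq_incl_eigenProj (s : ℝ) (v : H) :
    ‖incl μ (eigenProj (covOp μ) s v)‖ ^ 2 = s * ‖eigenProj (covOp μ) s v‖ ^ 2 := by
  rw [norm_incl_sq, apply_eigenProj, real_inner_smul_right, real_inner_self_eq_norm_sq]

theorem norm_sq_adjoint_incl_eigenProj (s : ℝ) (f : Lp ℝ 2 μ) :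
    ‖ContinuousLinearMap.adjoint (incl μ) (eigenProj (intOp μ) s f)‖ ^ 2
      = s * ‖eigenProj (intOp μ) s f‖ ^ 2 := by
  rw [norm_adjoint_incl_sq, apply_eigenProj, real_inner_smul_right, real_inner_self_eq_norm_sq]

end Inclusion

/-! ### The effective dimension as an expectation -/

section EffectiveDimension

variable {H : Type*} [NormedAddCommGroup H] [InnerProductSpace ℝ H] [CompleteSpace H]

theorem countable_of_orthonormal [TopologicalSpace.SeparableSpace H] {ι : Type*} {e : ι → H}
    (he : Orthonormal ℝ e) : Countable ι := by
  refine Pairwise.countable_of_isOpen_disjoint (s := fun i => Metric.ball (e i) (1 / 2)) ?_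
    (fun i => Metric.isOpen_ball) fun i => ⟨e i, Metric.mem_ball_self (by norm_num)⟩
  intro i j hij
  refine Metric.ball_disjoint_ball ?_
  have h : ‖e i - e j‖ ^ 2 = 2 := by
    rw [norm_sub_sq_real, he.1 i, he.1 j, he.2 hij]; norm_num
  rw [dist_eq_norm]
  nlinarith [norm_nonneg (e i - e j)]

/-- The weight of the regularized inverse square root `(T + λ)^{-1/2}`. -/
def invSqrtWeight (lam s : ℝ) : ℝ := (√(s + lam))⁻¹

theorem invSqrtWeight_sq {lam s : ℝ} (hlam : 0 < lam) (hs : 0 ≤ s) :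
    invSqrtWeight lam s ^ 2 = (s + lam)⁻¹ := by
  rw [invSqrtWeight, inv_pow, Real.sq_sqrt (by positivity)]

theorem IsCompactPos.bddSpec_invSqrt {T : H →L[ℝ] H} (hT : IsCompactPos T) {lam : ℝ}
    (hlam : 0 < lam) : BddSpec T (invSqrtWeight lam) := by
  refine hT.bddSpec (C := (√lam)⁻¹) (by positivity) fun s hs => ?_
  rw [invSqrtWeight, abs_of_nonneg (by positivity)]
  gcongr
  linarith

theorem IsCompactPos.bddSpec_inv {T : H →L[ℝ] H} (hT : IsCompactPos T) {lam : ℝ}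
    (hlam : 0 < lam) : BddSpec T (fun s => (s + lam)⁻¹) := by
  refine hT.bddSpec (C := lam⁻¹) (by positivity) fun s hs => ?_
  rw [abs_of_nonneg (by positivity)]
  gcongr
  linarith

theorem IsCompactPos.inverse_eq {T : H →L[ℝ] H} (hT : IsCompactPos T) {lam : ℝ}
    (hlam : 0 < lam) : Ring.inverse (T + lam • ContinuousLinearMap.id ℝ H)
      = specOp T (fun s => (s + lam)⁻¹) := by
  have hb := hT.bddSpec_inv hlam
  have h1 : ∀ x, (T + lam • ContinuousLinearMap.id ℝ H) (specOp T (fun s => (s + lam)⁻¹) x)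
      = x := by
    intro x
    refine hT.ext fun s => ?_
    rw [add_apply, eigenProj_add, hT.eigenProj_apply]
    change _ + eigenProj T s (lam • specOp T (fun s => (s + lam)⁻¹) x) = _
    rw [eigenProj_smul, hT.eigenProj_specOp hb, ← add_smul, smul_smul]
    by_cases hx : eigenProj T s x = 0
    · simp [hx]
    · have hs := hT.nonneg_of_ne hx
      rw [mul_inv_cancel₀ (by positivity), one_smul]
  have h2 : ∀ x, specOp T (fun s => (s + lam)⁻¹) ((T + lam • ContinuousLinearMap.id ℝ H) x)
      = x := by
    intro x
    refine hT.ext fun s => ?_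
    rw [hT.eigenProj_specOp hb, add_apply, eigenProj_add, hT.eigenProj_apply]
    change _ • (_ + eigenProj T s (lam • x)) = _
    rw [eigenProj_smul, ← add_smul, smul_smul]
    by_cases hx : eigenProj T s x = 0
    · simp [hx]
    · have hs := hT.nonneg_of_ne hx
      rw [inv_mul_cancel₀ (by positivity), one_smul]
  exact Ring.inverse_unit ⟨T + lam • ContinuousLinearMap.id ℝ H, specOp T (fun s => (s + lam)⁻¹),
    ContinuousLinearMap.ext h1, ContinuousLinearMap.ext h2⟩

variable [TopologicalSpace.SeparableSpace H] [MeasurableSpace H] [BorelSpace H]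
  {μ : Measure H} [IsProbabilityMeasure μ] {κ : ℝ}

/-- If `S` is a covariance operator of `μ` in the weak sense, weighted by `w`, then the expected
squared norm of `A x` is the sum of `⟨A e, S A e⟩` over a Hilbert basis. -/
theorem lintegral_norm_sq_eq_tsum {ι : Type*} (e : HilbertBasis ι ℝ H) {A : H →L[ℝ] H}
    (hA : ∀ x y, inner ℝ (A x) y = inner ℝ x (A y)) {w : H → ℝ} (hw : AEMeasurable w μ)
    (hw0 : ∀ x, 0 ≤ w x) :
    ∫⁻ x, ENNReal.ofReal (w x * ‖A x‖ ^ 2) ∂μ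
      = ∑' i, ∫⁻ x, ENNReal.ofReal (w x * (inner ℝ (A (e i)) x) ^ 2) ∂μ := by
  have : Countable ι := countable_of_orthonormal e.orthonormal
  rw [← lintegral_tsum]
  · refine lintegral_congr fun x => ?_
    have h := e.hasSum_inner_mul_inner (A x) (A x)
    rw [real_inner_self_eq_norm_sq] at h
    have h' : HasSum (fun i => w x * inner ℝ (A (e i)) x ^ 2) (w x * ‖A x‖ ^ 2) := by
      refine HasSum.mul_left _ (h.congr_fun fun i => ?_)
      rw [hA (e i) x, real_inner_comm (e i) (A x), sq]
    rw [← h'.tsum_eq, ENNReal.ofReal_tsum_of_nonneg (fun i => by have := hw0 x; positivity)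
      h'.summable]
  · intro i
    have : Measurable fun x : H => (inner ℝ (A (e i)) x : ℝ) := by
      have : SecondCountableTopology H := UniformSpace.secondCountable_of_separable H
      fun_prop
    fun_prop

/-- The effective dimension is `E ‖(T + λ)^{-1/2} x‖²`; the same with a weight `w` if the weighted
covariance is dominated by `b T`. -/
theorem lintegral_weighted_norm_sq_le (hb : ∀ᵐ x ∂μ, ‖x‖ ≤ κ) {lam : ℝ} (hlam : 0 < lam)
    {w : H → ℝ} (hw : AEMeasurable w μ) (hw0 : ∀ x, 0 ≤ w x) {b : ℝ} (hb0 : 0 ≤ b)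
    (hwT : ∀ v, ∫⁻ x, ENNReal.ofReal (w x * (inner ℝ v x) ^ 2) ∂μ
      ≤ ENNReal.ofReal (b * inner ℝ v (covOp μ v))) :
    ∫⁻ x, ENNReal.ofReal (w x * ‖specOp (covOp μ) (invSqrtWeight lam) x‖ ^ 2) ∂μ
      ≤ ENNReal.ofReal b * effDim (covOp μ) lam := by
  have hT := isCompactPos_covOp hb
  have hg := hT.bddSpec_invSqrt hlam
  set A := specOp (covOp μ) (invSqrtWeight lam) with hA
  obtain ⟨e, he⟩ := (exists_hilbertBasis ℝ H).choose_spec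
  rw [lintegral_norm_sq_eq_tsum e (hT.specOp_symm hg) hw hw0, effDim, posTrace,
    ← ENNReal.tsum_mul_left]
  refine ENNReal.tsum_le_tsum fun i => ?_
  refine (hwT (A (e i))).trans ?_
  rw [← ENNReal.ofReal_mul hb0, hT.inverse_eq hlam]
  refine ENNReal.ofReal_le_ofReal (mul_le_mul_of_nonneg_left (le_of_eq ?_) hb0)
  have hei : ((i : H)) = e i := by rw [he]
  rw [hei, ContinuousLinearMap.comp_apply, hA, hT.specOp_symm hg]
  congr 1
  refine hT.ext fun s => ?_
  rw [hT.eigenProj_specOp hg, hT.eigenProj_apply, hT.eigenProj_specOp hg, hT.eigenProj_apply,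
    hT.eigenProj_specOp (hT.bddSpec_inv hlam), smul_smul, smul_smul, smul_smul]
  by_cases hx : eigenProj (covOp μ) s (e i) = 0
  · simp [hx]
  · rw [← invSqrtWeight_sq hlam (hT.nonneg_of_ne hx)]
    congr 1; ring

end EffectiveDimension

/-! ### The regression function and the target -/

section Target

variable {H : Type*} [NormedAddCommGroup H] [InnerProductSpace ℝ H] [CompleteSpace H]
  [TopologicalSpace.SeparableSpace H] [MeasurableSpace H] [BorelSpace H]
  {ρ : Measure (H × ℝ)} [IsProbabilityMeasure ρ] {κ M Q : ℝ}

theorem ae_lintegral_sq_le (hm : MomentCondition M Q ρ) :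
    ∀ᵐ x ∂ρ.fst, ∫⁻ y, ENNReal.ofReal (y ^ 2) ∂(ρ.condKernel x) ≤ ENNReal.ofReal (Q ^ 2) := by
  filter_upwards [hm] with x hx
  have := hx 2 le_rfl
  simpa using this

theorem ae_memLp_condKernel (hm : MomentCondition M Q ρ) :
    ∀ᵐ x ∂ρ.fst, MemLp (fun y : ℝ => y) 2 (ρ.condKernel x) := by
  filter_upwards [ae_lintegral_sq_le hm] with x hx
  refine (memLp_two_iff_integrable_sq (f := fun y : ℝ => y)
    measurable_id.aestronglyMeasurable).2 ?_
  refine ⟨(measurable_id.pow_const 2).aestronglyMeasurable, ?_⟩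
  rw [hasFiniteIntegral_iff_ofReal (Filter.Eventually.of_forall fun y => sq_nonneg y)]
  exact hx.trans_lt ENNReal.ofReal_lt_top

/-- Jensen's inequality: the regression function is bounded by `Q`. -/
theorem ae_abs_regFun_le (hQ : 0 ≤ Q) (hm : MomentCondition M Q ρ) :
    ∀ᵐ x ∂ρ.fst, |regFun ρ x| ≤ Q := by
  filter_upwards [ae_lintegral_sq_le hm, ae_memLp_condKernel hm] with x hx hx2
  have hvar := variance_nonneg (fun y : ℝ => y) (ρ.condKernel x)
  rw [variance_eq_sub hx2] at hvar
  have h1 : ∫ y, y ^ 2 ∂(ρ.condKernel x) ≤ Q ^ 2 := by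
    rw [integral_eq_lintegral_of_nonneg_ae (Filter.Eventually.of_forall fun y => sq_nonneg y)
      (measurable_id.pow_const 2).aestronglyMeasurable]
    exact ENNReal.toReal_le_of_le_ofReal (sq_nonneg Q) hx
  have h2 : (∫ y, ((fun y : ℝ => y) ^ 2) y ∂(ρ.condKernel x)) = ∫ y, y ^ 2 ∂(ρ.condKernel x) := rfl
  rw [h2] at hvar
  refine abs_le_of_sq_le_sq ?_ hQ
  change (∫ y, y ∂(ρ.condKernel x)) ^ 2 ≤ Q ^ 2
  linarith

theorem stronglyMeasurable_regFun : StronglyMeasurable (regFun ρ) :=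
  stronglyMeasurable_id.integral_kernel

theorem memLp_regFun (hQ : 0 ≤ Q) (hm : MomentCondition M Q ρ) :
    MemLp (regFun ρ) 2 ρ.fst :=
  MemLp.of_bound stronglyMeasurable_regFun.aestronglyMeasurable Q (by
    simpa only [Real.norm_eq_abs] using ae_abs_regFun_le hQ hm)

/-- Moments of the output, weighted by a function of the input. -/
theorem lintegral_mul_pow_le (hm : MomentCondition M Q ρ) {f : H → ℝ≥0∞} (hf : Measurable f)
    {l : ℕ} (hl : 2 ≤ l) :
    ∫⁻ z, f z.1 * ENNReal.ofReal (|z.2| ^ l) ∂ρ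
      ≤ ENNReal.ofReal (1 / 2 * (l.factorial : ℝ) * M ^ (l - 2) * Q ^ 2) * ∫⁻ x, f x ∂ρ.fst := by
  rw [← Measure.lintegral_condKernel (by fun_prop), ← lintegral_const_mul _ hf]
  refine lintegral_mono_ae ?_
  filter_upwards [hm] with x hx
  rw [lintegral_const_mul _ (by fun_prop), mul_comm]
  gcongr
  exact hx l hl

theorem integrable_snd_sq (hm : MomentCondition M Q ρ) :
    Integrable (fun z : H × ℝ => z.2 ^ 2) ρ := by
  refine ⟨(measurable_snd.pow_const 2).aestronglyMeasurable, ?_⟩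
  rw [hasFiniteIntegral_iff_ofReal (Filter.Eventually.of_forall fun y => sq_nonneg _)]
  have := lintegral_mul_pow_le hm (f := fun _ => 1) measurable_const le_rfl
  simp only [one_mul, sq_abs, lintegral_const, measure_univ, mul_one] at this
  exact this.trans_lt ENNReal.ofReal_lt_top

theorem memLp_snd (hm : MomentCondition M Q ρ) : MemLp (fun z : H × ℝ => z.2) 2 ρ :=
  (memLp_two_iff_integrable_sq measurable_snd.aestronglyMeasurable).2 (integrable_snd_sq hm)

theorem ae_norm_fst_le (hb : ∀ᵐ x ∂ρ.fst, ‖x‖ ≤ κ) : ∀ᵐ z ∂ρ, ‖z.1‖ ≤ κ :=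
  ae_of_ae_map measurable_fst.aemeasurable hb

theorem integrable_snd_smul_fst (hb : ∀ᵐ x ∂ρ.fst, ‖x‖ ≤ κ) (hm : MomentCondition M Q ρ) :
    Integrable (fun z : H × ℝ => z.2 • z.1) ρ := by
  have : SecondCountableTopology H := UniformSpace.secondCountable_of_separable H
  have h1 : Integrable (fun z : H × ℝ => z.2) ρ := (memLp_snd hm).integrable (by norm_num)
  refine (h1.norm.mul_const κ).mono' (by fun_prop) ?_
  filter_upwards [ae_norm_fst_le hb] with z hz
  rw [norm_smul]
  gcongr

theorem inner_incl_target (hb : ∀ᵐ x ∂ρ.fst, ‖x‖ ≤ κ) (hQ : 0 ≤ Q)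
    (hm : MomentCondition M Q ρ) (v : H) :
    inner ℝ (incl ρ.fst v) (target ρ) = ∫ x, inner ℝ v x * regFun ρ x ∂ρ.fst := by
  have h1 : inner ℝ (incl ρ.fst v) (target ρ)
      = inner ℝ (incl ρ.fst v) (toL2 ρ.fst (regFun ρ)) := by
    rw [target, ← Submodule.inner_starProjection_left_eq_right]
    congr 1
    refine Submodule.starProjection_eq_self_iff.2 ?_
    exact Submodule.le_topologicalClosure _ (LinearMap.mem_range_self _ v)
  rw [h1, inner_incl hb]
  have h2 : (toL2 ρ.fst (regFun ρ) : H → ℝ) =ᵐ[ρ.fst] regFun ρ := by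
    rw [toL2, dif_pos (memLp_regFun hQ hm)]
    exact MemLp.coeFn_toLp _
  refine integral_congr_ae ?_
  filter_upwards [h2] with x hx
  rw [hx]

/-- The normal equation: `E[y x] = I* f_H`. -/
theorem integral_snd_smul_fst (hb : ∀ᵐ x ∂ρ.fst, ‖x‖ ≤ κ) (hQ : 0 ≤ Q)
    (hm : MomentCondition M Q ρ) :
    ∫ z, z.2 • z.1 ∂ρ = ContinuousLinearMap.adjoint (incl ρ.fst) (target ρ) := by
  refine ext_inner_left ℝ fun v => ?_
  have hint := integrable_snd_smul_fst hb hm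
  rw [← integral_inner hint, ContinuousLinearMap.adjoint_inner_right, inner_incl_target hb hQ hm,
    ← Measure.integral_condKernel (hint.const_inner v)]
  refine integral_congr_ae (Filter.Eventually.of_forall fun x => ?_)
  simp only [real_inner_smul_right]
  rw [integral_mul_const, mul_comm]
  rfl

/-- The approximation condition, tested on vectors. -/
theorem lintegral_approx_le {B : ℝ} (hb : ∀ᵐ x ∂ρ.fst, ‖x‖ ≤ κ) (hQ : 0 ≤ Q)
    (hm : MomentCondition M Q ρ) (hB : ApproxCondition B ρ) (v : H) :
    ∫⁻ x, ENNReal.ofReal (((target ρ : H → ℝ) x - regFun ρ x) ^ 2 * (inner ℝ v x) ^ 2) ∂ρ.fst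
      ≤ ENNReal.ofReal (B ^ 2 * inner ℝ v (covOp ρ.fst v)) := by
  have hd : MemLp (fun x => (target ρ : H → ℝ) x - regFun ρ x) 2 ρ.fst :=
    (Lp.memLp (target ρ)).sub (memLp_regFun hQ hm)
  have hd2 := hd.integrable_sq
  have hint : Integrable (fun x => ((target ρ : H → ℝ) x - regFun ρ x) ^ 2 •
      InnerProductSpace.rankOne ℝ x x) ρ.fst := by
    refine (hd2.mul_const (κ * κ)).mono' (hd2.aestronglyMeasurable.smul
      (aestronglyMeasurable_of_continuous continuous_rankOne_self)) ?_
    filter_upwards [hb] with x hx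
    rw [norm_smul, InnerProductSpace.norm_rankOne, Real.norm_of_nonneg (sq_nonneg _)]
    exact mul_le_mul_of_nonneg_left
      (mul_le_mul hx hx (norm_nonneg x) ((norm_nonneg x).trans hx)) (sq_nonneg _)
  have h1 : inner ℝ v ((∫ x, ((target ρ : H → ℝ) x - regFun ρ x) ^ 2 •
      InnerProductSpace.rankOne ℝ x x ∂ρ.fst) v)
      = ∫ x, ((target ρ : H → ℝ) x - regFun ρ x) ^ 2 * (inner ℝ v x) ^ 2 ∂ρ.fst := by
    rw [ContinuousLinearMap.integral_apply hint,
      ← integral_inner (hint.apply_continuousLinearMap v)]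
    refine integral_congr_ae (Filter.Eventually.of_forall fun x => ?_)
    simp only [smul_apply, InnerProductSpace.rankOne_apply,
      real_inner_smul_right]
    rw [real_inner_comm x v, sq (inner ℝ x v : ℝ)]
  have h2 := ((ContinuousLinearMap.le_def _ _).1 hB).inner_nonneg_right v
  rw [sub_apply, inner_sub_right, h1, smul_apply, real_inner_smul_right] at h2
  have hint2 := hint.apply_continuousLinearMap v
  have hint3 : Integrable (fun x => ((target ρ : H → ℝ) x - regFun ρ x) ^ 2 * (inner ℝ v x) ^ 2)
      ρ.fst := by
    refine (hint2.const_inner v).congr (Filter.Eventually.of_forall fun x => ?_)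
    simp only [smul_apply, InnerProductSpace.rankOne_apply, real_inner_smul_right]
    rw [real_inner_comm x v, sq (inner ℝ x v : ℝ)]
  rw [← ofReal_integral_eq_lintegral_ofReal hint3
    (Filter.Eventually.of_forall fun x => by positivity)]
  exact ENNReal.ofReal_le_ofReal (by linarith)

theorem lintegral_inner_sq {μ : Measure H} [IsProbabilityMeasure μ] (hb : ∀ᵐ x ∂μ, ‖x‖ ≤ κ)
    (v : H) : ∫⁻ x, ENNReal.ofReal ((inner ℝ v x) ^ 2) ∂μ
      = ENNReal.ofReal (inner ℝ v (covOp μ v)) := by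
  rw [inner_covOp_self_eq hb, ofReal_integral_eq_lintegral_ofReal (integrable_inner_sq hb v)
    (Filter.Eventually.of_forall fun x => sq_nonneg _)]

theorem lintegral_norm_sq_le_effDim {μ : Measure H} [IsProbabilityMeasure μ]
    (hb : ∀ᵐ x ∂μ, ‖x‖ ≤ κ) {lam : ℝ} (hlam : 0 < lam) :
    ∫⁻ x, ENNReal.ofReal (‖specOp (covOp μ) (invSqrtWeight lam) x‖ ^ 2) ∂μ
      ≤ effDim (covOp μ) lam := by
  have := lintegral_weighted_norm_sq_le hb hlam (w := fun _ => 1) aemeasurable_const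
    (fun _ => zero_le_one) zero_le_one (fun v => by simp [lintegral_inner_sq hb v])
  simpa using this

theorem norm_invSqrt_le {μ : Measure H} [IsProbabilityMeasure μ]
    (hb : ∀ᵐ x ∂μ, ‖x‖ ≤ κ) {lam : ℝ} (hlam : 0 < lam) (x : H) :
    ‖specOp (covOp μ) (invSqrtWeight lam) x‖ ≤ (√lam)⁻¹ * ‖x‖ := by
  refine (isCompactPos_covOp hb).norm_specOp_le ((isCompactPos_covOp hb).bddSpec_invSqrt hlam)
    (by positivity) (fun s hs => ?_) x
  rw [invSqrtWeight, abs_of_nonneg (by positivity)]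
  gcongr
  linarith

/-- Second moment of `⟨ω, x⟩ (T + λ)^{-1/2} x`: the function `⟨ω, ·⟩` is split into the bounded
regression function, the misfit `f_H - f_ρ`, and the approximation error `I ω - f_H`. -/
theorem lintegral_inner_sq_mul_le {B N D : ℝ} (hb : ∀ᵐ x ∂ρ.fst, ‖x‖ ≤ κ) (hQ : 0 ≤ Q)
    (hm : MomentCondition M Q ρ) (hB : ApproxCondition B ρ) {lam : ℝ} (hlam : 0 < lam)
    (hN0 : 0 ≤ N) (hN : effDim (covOp ρ.fst) lam ≤ ENNReal.ofReal N) (w : H)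
    (hD : ‖incl ρ.fst w - target ρ‖ ≤ D) :
    ∫⁻ x, ENNReal.ofReal ((inner ℝ w x) ^ 2 *
        ‖specOp (covOp ρ.fst) (invSqrtWeight lam) x‖ ^ 2) ∂ρ.fst
      ≤ ENNReal.ofReal (3 * ((Q ^ 2 + B ^ 2) * N + κ ^ 2 / lam * D ^ 2)) := by
  set A := specOp (covOp ρ.fst) (invSqrtWeight lam) with hA
  set μ := ρ.fst with hμ
  set d : H → ℝ := fun x => (target ρ : H → ℝ) x - regFun ρ x with hd
  set e : Lp ℝ 2 μ := incl μ w - target ρ with he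
  have hSC : SecondCountableTopology H := UniformSpace.secondCountable_of_separable H
  have hdm : AEMeasurable d μ :=
    (Lp.aestronglyMeasurable _).aemeasurable.sub stronglyMeasurable_regFun.measurable.aemeasurable
  have hem : AEMeasurable (e : H → ℝ) μ := (Lp.aestronglyMeasurable _).aemeasurable
  have hAm : Measurable fun x => ‖A x‖ ^ 2 := by fun_prop
  have h1 : ∫⁻ x, ENNReal.ofReal (Q ^ 2 * ‖A x‖ ^ 2) ∂μ ≤ ENNReal.ofReal (Q ^ 2 * N) := by
    simp_rw [ENNReal.ofReal_mul (sq_nonneg Q)]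
    rw [lintegral_const_mul _ (by fun_prop)]
    gcongr
    exact (lintegral_norm_sq_le_effDim hb hlam).trans hN
  have h2 : ∫⁻ x, ENNReal.ofReal (d x ^ 2 * ‖A x‖ ^ 2) ∂μ ≤ ENNReal.ofReal (B ^ 2 * N) := by
    refine (lintegral_weighted_norm_sq_le hb hlam (hdm.pow_const 2) (fun x => sq_nonneg _)
      (sq_nonneg B) (lintegral_approx_le hb hQ hm hB)).trans ?_
    rw [ENNReal.ofReal_mul (sq_nonneg B)]
    gcongr
  have h3 : ∫⁻ x, ENNReal.ofReal ((e : H → ℝ) x ^ 2 * (κ ^ 2 / lam)) ∂μ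
      ≤ ENNReal.ofReal (κ ^ 2 / lam * D ^ 2) := by
    rw [← ofReal_integral_eq_lintegral_ofReal ((Lp.memLp e).integrable_sq.mul_const _)
      (Filter.Eventually.of_forall fun x => by positivity), integral_mul_const, mul_comm]
    refine ENNReal.ofReal_le_ofReal (mul_le_mul_of_nonneg_left ?_ (by positivity))
    have : ‖e‖ ^ 2 = ∫ x, (e : H → ℝ) x ^ 2 ∂μ := by
      rw [← real_inner_self_eq_norm_sq, L2.inner_def]
      simp [sq]
    rw [← this]
    gcongr
  have hpt : ∀ᵐ x ∂μ, ENNReal.ofReal ((inner ℝ w x) ^ 2 * ‖A x‖ ^ 2)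
      ≤ 3 * (ENNReal.ofReal (Q ^ 2 * ‖A x‖ ^ 2) + ENNReal.ofReal (d x ^ 2 * ‖A x‖ ^ 2)
        + ENNReal.ofReal ((e : H → ℝ) x ^ 2 * (κ ^ 2 / lam))) := by
    filter_upwards [incl_ae μ (memLp_id hb 2) w, Lp.coeFn_sub (incl μ w) (target ρ), hb,
      ae_abs_regFun_le hQ hm] with x hx1 hx2 hx3 hx4
    rw [← ENNReal.ofReal_add (by positivity) (by positivity),
      ← ENNReal.ofReal_add (by positivity) (by positivity),
      show (3 : ℝ≥0∞) = ENNReal.ofReal 3 by norm_num, ← ENNReal.ofReal_mul (by norm_num)]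
    refine ENNReal.ofReal_le_ofReal ?_
    have hsplit : (inner ℝ w x : ℝ) = regFun ρ x + d x + (e : H → ℝ) x := by
      rw [he, hx2, Pi.sub_apply, hx1, hd]; ring
    have hAx : ‖A x‖ ^ 2 ≤ κ ^ 2 / lam := by
      have h := (norm_invSqrt_le hb hlam x).trans
        (mul_le_mul_of_nonneg_left hx3 (by positivity))
      calc ‖A x‖ ^ 2 ≤ ((√lam)⁻¹ * κ) ^ 2 := by gcongr
        _ = κ ^ 2 / lam := by rw [mul_pow, inv_pow, Real.sq_sqrt hlam.le]; ring
    have hreg : regFun ρ x ^ 2 ≤ Q ^ 2 := sq_le_sq' (abs_le.1 hx4).1 (abs_le.1 hx4).2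
    have hsq : (inner ℝ w x : ℝ) ^ 2 ≤ 3 * (Q ^ 2 + d x ^ 2 + (e : H → ℝ) x ^ 2) := by
      rw [hsplit]
      nlinarith [sq_nonneg (regFun ρ x - d x), sq_nonneg (regFun ρ x - (e : H → ℝ) x),
        sq_nonneg (d x - (e : H → ℝ) x)]
    calc (inner ℝ w x : ℝ) ^ 2 * ‖A x‖ ^ 2
        ≤ 3 * (Q ^ 2 + d x ^ 2 + (e : H → ℝ) x ^ 2) * ‖A x‖ ^ 2 := by gcongr
      _ = 3 * (Q ^ 2 * ‖A x‖ ^ 2 + d x ^ 2 * ‖A x‖ ^ 2 + (e : H → ℝ) x ^ 2 * ‖A x‖ ^ 2) := by ring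
      _ ≤ _ := by gcongr
  refine (lintegral_mono_ae hpt).trans ?_
  rw [lintegral_const_mul' _ _ (by norm_num), lintegral_add_left' (by fun_prop),
    lintegral_add_left' (by fun_prop), show (3 : ℝ≥0∞) = ENNReal.ofReal 3 by norm_num,
    ENNReal.ofReal_mul (by norm_num), add_mul, ENNReal.ofReal_add (by positivity) (by positivity),
    ENNReal.ofReal_add (by positivity) (by positivity)]
  gcongr

end Target

/-! ### A Bernstein inequality in Hilbert space -/

section ProductMeasure

theorem lintegral_pi_succ {Ω : Type*} [MeasurableSpace Ω] (ν : Measure Ω) [SigmaFinite ν]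
    {n : ℕ} {F : (Fin (n + 1) → Ω) → ℝ≥0∞} (hF : Measurable F) :
    ∫⁻ z, F z ∂(Measure.pi fun _ : Fin (n + 1) => ν)
      = ∫⁻ x, ∫⁻ z, F (Fin.cons x z) ∂(Measure.pi fun _ : Fin n => ν) ∂ν := by
  have h := (measurePreserving_piFinSuccAbove (fun _ : Fin (n + 1) => ν) 0).symm
  rw [← h.lintegral_comp hF, lintegral_prod]
  · refine lintegral_congr fun x => lintegral_congr fun z => ?_
    congr 1
    exact Fin.insertNth_zero' x z
  · exact (hF.comp (MeasurableEquiv.measurable _)).aemeasurable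

end ProductMeasure

section Cosh

/-- Convexity of `cosh ∘ √`. -/
theorem cosh_le_of_sq_eq {a b r t : ℝ} (ht0 : 0 ≤ t) (ht1 : t ≤ 1)
    (hr : r ^ 2 = t * a ^ 2 + (1 - t) * b ^ 2) :
    Real.cosh r ≤ t * Real.cosh a + (1 - t) * Real.cosh b := by
  refine hasSum_le (fun n => ?_) (Real.hasSum_cosh r)
    (((Real.hasSum_cosh a).mul_left t).add ((Real.hasSum_cosh b).mul_left (1 - t)))
  have h := (convexOn_pow (𝕜 := ℝ) n).2 (Set.mem_Ici.2 (sq_nonneg a)) (Set.mem_Ici.2 (sq_nonneg b))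
    ht0 (sub_nonneg.2 ht1) (by ring)
  simp only [smul_eq_mul] at h
  rw [pow_mul, hr, pow_mul a, pow_mul b, ← mul_div_assoc, ← mul_div_assoc, ← add_div]
  gcongr

variable {E : Type*} [NormedAddCommGroup E] [InnerProductSpace ℝ E]

/-- A second order Taylor bound for `cosh ‖·‖`. The left side is convex in `⟨s, x⟩`, and the right
side affine, so that only the collinear cases `⟨s, x⟩ = ± ‖s‖ ‖x‖` matter. -/
theorem cosh_norm_add_le (s x : E) :
    Real.cosh ‖s + x‖ ≤ Real.cosh ‖s‖ + inner ℝ ((Real.sinh ‖s‖ / ‖s‖) • s) x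
      + Real.cosh ‖s‖ * (Real.exp ‖x‖ - 1 - ‖x‖) := by
  have hexp : Real.exp ‖x‖ = Real.cosh ‖x‖ + Real.sinh ‖x‖ := (Real.cosh_add_sinh _).symm
  have hsinh : ‖x‖ ≤ Real.sinh ‖x‖ := Real.self_le_sinh_iff.2 (norm_nonneg x)
  rcases eq_or_ne s 0 with rfl | hs
  · simp only [zero_add, norm_zero, Real.cosh_zero, smul_zero, inner_zero_left]
    linarith
  rcases eq_or_ne x 0 with rfl | hx
  · simp
  have hs' : 0 < ‖s‖ := norm_pos_iff.2 hs
  have hx' : 0 < ‖x‖ := norm_pos_iff.2 hx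
  set r := ‖s‖
  set u := ‖x‖
  set c : ℝ := inner ℝ s x / (r * u) with hc
  have hin : inner ℝ s x = c * (r * u) := by rw [hc]; field_simp
  have habs : |c| ≤ 1 := by
    rw [hc, abs_div, abs_of_pos (mul_pos hs' hx')]
    exact div_le_one_of_le₀ (abs_real_inner_le_norm s x) (by positivity)
  obtain ⟨hc1, hc2⟩ := abs_le.1 habs
  -- `‖s + x‖²` is a convex combination of `(r + u)²` and `(r - u)²`
  have hkey : Real.cosh ‖s + x‖
      ≤ (1 + c) / 2 * Real.cosh (r + u) + (1 - (1 + c) / 2) * Real.cosh (r - u) := by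
    refine cosh_le_of_sq_eq (by linarith) (by linarith) ?_
    rw [norm_add_sq_real, hin]; ring
  rw [Real.cosh_add, Real.cosh_sub] at hkey
  rw [real_inner_smul_left, hin, hexp]
  have h1 : Real.sinh r / r * (c * (r * u)) = c * (Real.sinh r * u) := by field_simp
  have h2 : Real.sinh r ≤ Real.cosh r := Real.sinh_lt_cosh r |>.le
  have h3 : 0 ≤ Real.sinh r := Real.sinh_nonneg_iff.2 hs'.le
  have h4 : c * (Real.sinh r * (Real.sinh u - u)) ≤ Real.cosh r * (Real.sinh u - u) := by
    have : Real.sinh r * (Real.sinh u - u) ≤ Real.cosh r * (Real.sinh u - u) :=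
      mul_le_mul_of_nonneg_right h2 (by linarith)
    have h0 : 0 ≤ Real.sinh r * (Real.sinh u - u) := mul_nonneg h3 (by linarith)
    nlinarith
  rw [h1]
  linarith

end Cosh

section Bernstein

variable {E : Type*} [NormedAddCommGroup E] [InnerProductSpace ℝ E] [CompleteSpace E]
  {Ω : Type*} [MeasurableSpace Ω] {ν : Measure Ω} [IsProbabilityMeasure ν]

theorem measurable_cosh_norm {α : Type*} [MeasurableSpace α] {f : α → E}
    (hf : StronglyMeasurable f) : Measurable fun x => ENNReal.ofReal (Real.cosh ‖f x‖) :=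
  (Real.continuous_cosh.measurable.comp hf.norm.measurable).ennreal_ofReal

/-- One step of the exponential supermartingale `cosh ‖∑ X_i‖`. -/
theorem lintegral_cosh_norm_add_le {X : Ω → E} (hX : Integrable X ν) (h0 : ∫ z, X z ∂ν = 0)
    {p : ℝ} (hp : 0 ≤ p)
    (hψ : ∫⁻ z, ENNReal.ofReal (Real.exp ‖X z‖ - 1 - ‖X z‖) ∂ν ≤ ENNReal.ofReal p) (s : E) :
    ∫⁻ z, ENNReal.ofReal (Real.cosh ‖s + X z‖) ∂ν
      ≤ ENNReal.ofReal (Real.cosh ‖s‖) * ENNReal.ofReal (1 + p) := by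
  have hψ0 : ∀ z, 0 ≤ Real.exp ‖X z‖ - 1 - ‖X z‖ := fun z => by
    linarith [Real.add_one_le_exp ‖X z‖]
  have hψm : AEStronglyMeasurable (fun z => Real.exp ‖X z‖ - 1 - ‖X z‖) ν :=
    ((Real.continuous_exp.comp_aestronglyMeasurable hX.1.norm).sub
      aestronglyMeasurable_const).sub hX.1.norm
  have hψi : Integrable (fun z => Real.exp ‖X z‖ - 1 - ‖X z‖) ν := by
    refine ⟨hψm, ?_⟩
    rw [hasFiniteIntegral_iff_ofReal (Filter.Eventually.of_forall hψ0)]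
    exact hψ.trans_lt ENNReal.ofReal_lt_top
  have hψ' : ∫ z, (Real.exp ‖X z‖ - 1 - ‖X z‖) ∂ν ≤ p := by
    rw [integral_eq_lintegral_of_nonneg_ae (Filter.Eventually.of_forall hψ0) hψm]
    exact ENNReal.toReal_le_of_le_ofReal hp hψ
  set b := (Real.sinh ‖s‖ / ‖s‖) • s
  have hi : Integrable (fun z => Real.cosh ‖s‖ + inner ℝ b (X z)
      + Real.cosh ‖s‖ * (Real.exp ‖X z‖ - 1 - ‖X z‖)) ν :=
    ((integrable_const _).add (hX.const_inner b)).add (hψi.const_mul _)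
  have hpt := fun z => cosh_norm_add_le s (X z)
  have hc := Real.cosh_pos ‖s‖
  calc ∫⁻ z, ENNReal.ofReal (Real.cosh ‖s + X z‖) ∂ν
      ≤ ∫⁻ z, ENNReal.ofReal (Real.cosh ‖s‖ + inner ℝ b (X z)
        + Real.cosh ‖s‖ * (Real.exp ‖X z‖ - 1 - ‖X z‖)) ∂ν :=
        lintegral_mono fun z => ENNReal.ofReal_le_ofReal (hpt z)
    _ = ENNReal.ofReal (∫ z, (Real.cosh ‖s‖ + inner ℝ b (X z)
        + Real.cosh ‖s‖ * (Real.exp ‖X z‖ - 1 - ‖X z‖)) ∂ν) :=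
        (ofReal_integral_eq_lintegral_ofReal hi (Filter.Eventually.of_forall fun z =>
          (Real.cosh_pos _).le.trans (hpt z))).symm
    _ ≤ ENNReal.ofReal (Real.cosh ‖s‖ * (1 + p)) := by
        refine ENNReal.ofReal_le_ofReal ?_
        have h1 : Integrable (fun z => Real.cosh ‖s‖ + inner ℝ b (X z)) ν :=
          (integrable_const _).add (hX.const_inner b)
        rw [integral_add h1 (hψi.const_mul _),
          integral_add (integrable_const _) (hX.const_inner b), integral_inner hX, h0,
          inner_zero_right, integral_const_mul]
        simp only [integral_const, probReal_univ, smul_eq_mul, one_mul, add_zero]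
        nlinarith
    _ = _ := ENNReal.ofReal_mul hc.le

theorem lintegral_cosh_norm_sum_le {X : Ω → E} (hXm : StronglyMeasurable X)
    (hX : Integrable X ν) (h0 : ∫ z, X z ∂ν = 0) {p : ℝ} (hp : 0 ≤ p)
    (hψ : ∫⁻ z, ENNReal.ofReal (Real.exp ‖X z‖ - 1 - ‖X z‖) ∂ν ≤ ENNReal.ofReal p)
    (n : ℕ) (s : E) :
    ∫⁻ z, ENNReal.ofReal (Real.cosh ‖s + ∑ i, X (z i)‖) ∂(Measure.pi fun _ : Fin n => ν)
      ≤ ENNReal.ofReal (Real.cosh ‖s‖) * ENNReal.ofReal (1 + p) ^ n := by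
  induction n generalizing s with
  | zero => simp
  | succ n ih =>
    have hm : ∀ (k : ℕ) (s : E), StronglyMeasurable fun z : Fin k → Ω => s + ∑ i, X (z i) :=
      fun k s => stronglyMeasurable_const.add (Finset.stronglyMeasurable_fun_sum _ fun i _ =>
        hXm.comp_measurable (measurable_pi_apply i))
    rw [lintegral_pi_succ ν (measurable_cosh_norm (hm (n + 1) s))]
    calc ∫⁻ x, ∫⁻ z, ENNReal.ofReal (Real.cosh ‖s + ∑ i, X ((Fin.cons x z : Fin (n + 1) → Ω) i)‖)
            ∂(Measure.pi fun _ : Fin n => ν) ∂ν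
        ≤ ∫⁻ x, ENNReal.ofReal (Real.cosh ‖s + X x‖) * ENNReal.ofReal (1 + p) ^ n ∂ν := by
          refine lintegral_mono fun x => ?_
          simp only [Fin.sum_univ_succ, Fin.cons_zero, Fin.cons_succ, ← add_assoc]
          exact ih (s + X x)
      _ ≤ ENNReal.ofReal (Real.cosh ‖s‖) * ENNReal.ofReal (1 + p) * ENNReal.ofReal (1 + p) ^ n := by
          have hsX : StronglyMeasurable fun x => s + X x := stronglyMeasurable_const.add hXm
          rw [lintegral_mul_const _ (measurable_cosh_norm hsX)]
          gcongr
          exact lintegral_cosh_norm_add_le hX h0 hp hψ s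
      _ = _ := by rw [pow_succ']; ring

/-- The moment condition of Bernstein's inequality. -/
def BernsteinMoments (ν : Measure Ω) (ξ : Ω → E) (σ M : ℝ) : Prop :=
  ∀ l : ℕ, 2 ≤ l → ∫⁻ z, ENNReal.ofReal (‖ξ z‖ ^ l) ∂ν
    ≤ ENNReal.ofReal (1 / 2 * (l.factorial : ℝ) * σ ^ 2 * M ^ (l - 2))

theorem BernsteinMoments.integrable_pow {ξ : Ω → E} {σ M : ℝ} (h : BernsteinMoments ν ξ σ M)
    (hξ : StronglyMeasurable ξ) {l : ℕ} (hl : 2 ≤ l) : Integrable (fun z => ‖ξ z‖ ^ l) ν := by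
  refine ⟨(hξ.norm.measurable.pow_const l).aestronglyMeasurable, ?_⟩
  rw [hasFiniteIntegral_iff_ofReal (Filter.Eventually.of_forall fun z => by positivity)]
  exact (h l hl).trans_lt ENNReal.ofReal_lt_top

theorem BernsteinMoments.integrable {ξ : Ω → E} {σ M : ℝ} (h : BernsteinMoments ν ξ σ M)
    (hξ : StronglyMeasurable ξ) : Integrable ξ ν :=
  ((memLp_two_iff_integrable_sq_norm hξ.aestronglyMeasurable).2
    (h.integrable_pow hξ le_rfl)).integrable (by norm_num)

/-- Centring costs a factor `2^l` in the `l`-th moment. -/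
theorem BernsteinMoments.lintegral_sub_pow_le {ξ : Ω → E} {σ M : ℝ} (hM : 0 ≤ M)
    (h : BernsteinMoments ν ξ σ M) (hξ : StronglyMeasurable ξ) {l : ℕ} (hl : 2 ≤ l) :
    ∫⁻ z, ENNReal.ofReal (‖ξ z - ∫ y, ξ y ∂ν‖ ^ l) ∂ν
      ≤ ENNReal.ofReal (2 ^ l * (1 / 2 * (l.factorial : ℝ) * σ ^ 2 * M ^ (l - 2))) := by
  have hint := h.integrable hξ
  have hintl := h.integrable_pow hξ hl
  set K := 1 / 2 * (l.factorial : ℝ) * σ ^ 2 * M ^ (l - 2) with hK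
  have hK0 : 0 ≤ K := by positivity
  have h1 : ∫ z, ‖ξ z‖ ^ l ∂ν ≤ K := by
    rw [integral_eq_lintegral_of_nonneg_ae (Filter.Eventually.of_forall fun z => by positivity)
      hintl.1]
    exact ENNReal.toReal_le_of_le_ofReal hK0 (h l hl)
  have h2 : ‖∫ y, ξ y ∂ν‖ ^ l ≤ K := by
    refine le_trans ?_ h1
    calc ‖∫ y, ξ y ∂ν‖ ^ l ≤ (∫ y, ‖ξ y‖ ∂ν) ^ l := by
          gcongr; exact norm_integral_le_integral_norm _
      _ ≤ ∫ z, ‖ξ z‖ ^ l ∂ν :=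
          (convexOn_pow l).map_integral_le (continuousOn_pow l) isClosed_Ici
            (Filter.Eventually.of_forall fun z => Set.mem_Ici.2 (norm_nonneg _)) hint.norm hintl
  have hpt : ∀ z, ‖ξ z - ∫ y, ξ y ∂ν‖ ^ l ≤ 2 ^ (l - 1) * (‖ξ z‖ ^ l + K) := fun z =>
    calc ‖ξ z - ∫ y, ξ y ∂ν‖ ^ l ≤ (‖ξ z‖ + ‖∫ y, ξ y ∂ν‖) ^ l := by
          gcongr; exact norm_sub_le _ _
      _ ≤ 2 ^ (l - 1) * (‖ξ z‖ ^ l + ‖∫ y, ξ y ∂ν‖ ^ l) :=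
          add_pow_le (norm_nonneg _) (norm_nonneg _) l
      _ ≤ _ := by gcongr
  calc ∫⁻ z, ENNReal.ofReal (‖ξ z - ∫ y, ξ y ∂ν‖ ^ l) ∂ν
      ≤ ∫⁻ z, ENNReal.ofReal (2 ^ (l - 1) * (‖ξ z‖ ^ l + K)) ∂ν :=
        lintegral_mono fun z => ENNReal.ofReal_le_ofReal (hpt z)
    _ = ENNReal.ofReal (∫ z, 2 ^ (l - 1) * (‖ξ z‖ ^ l + K) ∂ν) :=
        (ofReal_integral_eq_lintegral_ofReal ((hintl.add (integrable_const K)).const_mul _)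
          (Filter.Eventually.of_forall fun z =>
            mul_nonneg (by positivity) (add_nonneg (by positivity) hK0))).symm
    _ ≤ _ := by
        refine ENNReal.ofReal_le_ofReal ?_
        rw [integral_const_mul, integral_add hintl (integrable_const K)]
        simp only [integral_const, probReal_univ, smul_eq_mul, one_mul]
        have : (2 : ℝ) ^ l = 2 ^ (l - 1) * 2 := by
          rw [← pow_succ]; congr 1; omega
        rw [this, mul_assoc]
        gcongr
        linarith

theorem hasSum_exp_sub (u : ℝ) :
    HasSum (fun k : ℕ => u ^ (k + 2) / ((k + 2).factorial : ℝ)) (Real.exp u - 1 - u) := by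
  have h : HasSum (fun n : ℕ => u ^ n / (n.factorial : ℝ)) (Real.exp u) := by
    rw [Real.exp_eq_exp_ℝ]; exact NormedSpace.expSeries_div_hasSum_exp u
  have h2 := (hasSum_nat_add_iff' 2).2 h
  simpa [Finset.sum_range_succ, sub_sub] using h2

/-- The exponential moment needed for the supermartingale, from the moment condition. -/
theorem BernsteinMoments.lintegral_exp_le {ξ : Ω → E} {σ M θ : ℝ} (hM : 0 ≤ M) (hθ : 0 ≤ θ)
    (hθM : 4 * θ * M ≤ 1) (h : BernsteinMoments ν ξ σ M) (hξ : StronglyMeasurable ξ) :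
    ∫⁻ z, ENNReal.ofReal (Real.exp ‖θ • (ξ z - ∫ y, ξ y ∂ν)‖ - 1 - ‖θ • (ξ z - ∫ y, ξ y ∂ν)‖) ∂ν
      ≤ ENNReal.ofReal (4 * θ ^ 2 * σ ^ 2) := by
  have hXm : StronglyMeasurable fun z => θ • (ξ z - ∫ y, ξ y ∂ν) :=
    (hξ.sub stronglyMeasurable_const).const_smul θ
  have h1 : ∀ z, ENNReal.ofReal (Real.exp ‖θ • (ξ z - ∫ y, ξ y ∂ν)‖ - 1
      - ‖θ • (ξ z - ∫ y, ξ y ∂ν)‖)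
      = ∑' k : ℕ, ENNReal.ofReal (‖θ • (ξ z - ∫ y, ξ y ∂ν)‖ ^ (k + 2) / ((k + 2).factorial : ℝ)) :=
    fun z => by
      have hs := hasSum_exp_sub ‖θ • (ξ z - ∫ y, ξ y ∂ν)‖
      rw [← hs.tsum_eq, ENNReal.ofReal_tsum_of_nonneg (fun k => by positivity) hs.summable]
  simp_rw [h1]
  rw [lintegral_tsum fun k => ((hXm.norm.measurable.pow_const _).div_const _).ennreal_ofReal.aemeasurable]
  have h2 : ∀ k : ℕ, ∫⁻ z, ENNReal.ofReal (‖θ • (ξ z - ∫ y, ξ y ∂ν)‖ ^ (k + 2)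
      / ((k + 2).factorial : ℝ)) ∂ν ≤ ENNReal.ofReal (2 * θ ^ 2 * σ ^ 2 * (1 / 2) ^ k) := by
    intro k
    have hf : (0 : ℝ) < ((k + 2).factorial : ℝ) := by positivity
    have h3 : ∀ z, ENNReal.ofReal (‖θ • (ξ z - ∫ y, ξ y ∂ν)‖ ^ (k + 2) / ((k + 2).factorial : ℝ))
        = ENNReal.ofReal (θ ^ (k + 2) / ((k + 2).factorial : ℝ))
          * ENNReal.ofReal (‖ξ z - ∫ y, ξ y ∂ν‖ ^ (k + 2)) := fun z => by
      rw [← ENNReal.ofReal_mul (by positivity), norm_smul, Real.norm_of_nonneg hθ]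
      congr 1; rw [mul_pow]; ring
    have hsub : StronglyMeasurable fun z => ξ z - ∫ y, ξ y ∂ν := hξ.sub stronglyMeasurable_const
    simp_rw [h3]
    rw [lintegral_const_mul _ (hsub.norm.measurable.pow_const _).ennreal_ofReal]
    refine (mul_le_mul_right (h.lintegral_sub_pow_le hM hξ (l := k + 2) (by omega)) _).trans ?_
    rw [← ENNReal.ofReal_mul (by positivity)]
    refine ENNReal.ofReal_le_ofReal ?_
    have h4 : θ ^ (k + 2) / ((k + 2).factorial : ℝ)
        * (2 ^ (k + 2) * (1 / 2 * ((k + 2).factorial : ℝ) * σ ^ 2 * M ^ (k + 2 - 2)))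
        = 2 * θ ^ 2 * σ ^ 2 * (2 * θ * M) ^ k := by
      rw [Nat.add_sub_cancel]
      field_simp
      ring
    rw [h4]
    gcongr
    linarith
  refine (ENNReal.tsum_le_tsum h2).trans ?_
  have hg : HasSum (fun k : ℕ => 2 * θ ^ 2 * σ ^ 2 * (1 / 2 : ℝ) ^ k) (2 * θ ^ 2 * σ ^ 2 * 2) :=
    hasSum_geometric_two.mul_left _
  rw [← ENNReal.ofReal_tsum_of_nonneg (fun k => by positivity) hg.summable, hg.tsum_eq]
  exact ENNReal.ofReal_le_ofReal (by linarith)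

/-- **Bernstein's inequality** for sample means in a Hilbert space. -/
theorem BernsteinMoments.measure_mean_le {ξ : Ω → E} {σ M η : ℝ} (hM : 0 < M) (hσ : 0 ≤ σ)
    (hη : 0 < η) (h : BernsteinMoments ν ξ σ M) (hξ : StronglyMeasurable ξ) {n : ℕ} (hn : 1 ≤ n) :
    (Measure.pi fun _ : Fin n => ν) {z | (4 * M / n + 2 * σ / √n) * (Real.log (2 / η) + 1)
      < ‖(n : ℝ)⁻¹ • ∑ i, ξ (z i) - ∫ y, ξ y ∂ν‖} ≤ ENNReal.ofReal η := by
  have hn0 : (0 : ℝ) < n := by exact_mod_cast hn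
  -- the scale `θ = 1 / D` makes the product of the exponential moments at most `e`
  set D := 4 * M + 2 * σ * √n with hD
  have hDpos : 0 < D := by positivity
  set θ := D⁻¹ with hθ
  have hθpos : 0 < θ := by positivity
  set m := ∫ y, ξ y ∂ν with hm
  have hint := h.integrable hξ
  have hXm : StronglyMeasurable fun z => θ • (ξ z - m) :=
    (hξ.sub stronglyMeasurable_const).const_smul θ
  have hXi : Integrable (fun z => θ • (ξ z - m)) ν := (hint.sub (integrable_const m)).smul θ
  have hX0 : ∫ z, θ • (ξ z - m) ∂ν = 0 := by
    rw [integral_smul, integral_sub hint (integrable_const m)]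
    simp [hm]
  have hθM : 4 * θ * M ≤ 1 := by
    have : 4 * M ≤ D := by rw [hD]; have : 0 ≤ σ * √n := by positivity
                           linarith
    rw [hθ]
    calc 4 * D⁻¹ * M = 4 * M / D := by ring
      _ ≤ 1 := div_le_one_of_le₀ this hDpos.le
  have hσn : 4 * θ ^ 2 * σ ^ 2 * n ≤ 1 := by
    have h1 : 2 * σ * √n ≤ D := by rw [hD]; linarith
    have h2 : (2 * σ * √n) ^ 2 ≤ D ^ 2 := by gcongr
    have h3 : (2 * σ * √n) ^ 2 = 4 * σ ^ 2 * n := by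
      rw [mul_pow, Real.sq_sqrt hn0.le]; ring
    rw [h3] at h2
    rw [hθ]
    calc 4 * D⁻¹ ^ 2 * σ ^ 2 * n = 4 * σ ^ 2 * n / D ^ 2 := by field_simp
      _ ≤ 1 := div_le_one_of_le₀ h2 (by positivity)
  have hcosh := lintegral_cosh_norm_sum_le hXm hXi hX0 (p := 4 * θ ^ 2 * σ ^ 2) (by positivity)
    (h.lintegral_exp_le hM.le hθpos.le hθM hξ) n 0
  simp only [zero_add, norm_zero, Real.cosh_zero, ENNReal.ofReal_one, one_mul] at hcosh
  have hexp : ENNReal.ofReal (1 + 4 * θ ^ 2 * σ ^ 2) ^ n ≤ ENNReal.ofReal (Real.exp 1) := by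
    rw [← ENNReal.ofReal_pow (by positivity)]
    refine ENNReal.ofReal_le_ofReal ?_
    calc (1 + 4 * θ ^ 2 * σ ^ 2) ^ n ≤ Real.exp (4 * θ ^ 2 * σ ^ 2) ^ n := by
          gcongr
          linarith [Real.add_one_le_exp (4 * θ ^ 2 * σ ^ 2)]
      _ = Real.exp (4 * θ ^ 2 * σ ^ 2 * n) := by rw [← Real.exp_nat_mul]; congr 1; ring
      _ ≤ Real.exp 1 := Real.exp_le_exp.2 hσn
  have hmarkov := mul_meas_ge_le_lintegral (μ := Measure.pi fun _ : Fin n => ν)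
    (measurable_cosh_norm (Finset.stronglyMeasurable_fun_sum Finset.univ fun i _ =>
      hXm.comp_measurable (measurable_pi_apply (X := fun _ : Fin n => Ω) i)))
    (ENNReal.ofReal (Real.exp 1 / η))
  have hsub : {z : Fin n → Ω | (4 * M / n + 2 * σ / √n) * (Real.log (2 / η) + 1)
      < ‖(n : ℝ)⁻¹ • ∑ i, ξ (z i) - m‖}
      ⊆ {z | ENNReal.ofReal (Real.exp 1 / η)
        ≤ ENNReal.ofReal (Real.cosh ‖∑ i, θ • (ξ (z i) - m)‖)} := by
    intro z hz
    simp only [Set.mem_ofPred_eq] at hz ⊢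
    refine ENNReal.ofReal_le_ofReal ?_
    have h1 : ‖∑ i, θ • (ξ (z i) - m)‖ = θ * (n * ‖(n : ℝ)⁻¹ • ∑ i, ξ (z i) - m‖) := by
      rw [← Finset.smul_sum, norm_smul, Real.norm_of_nonneg hθpos.le, Finset.sum_sub_distrib]
      congr 1
      rw [← Real.norm_of_nonneg hn0.le, ← norm_smul, smul_sub, Real.norm_of_nonneg hn0.le,
        smul_inv_smul₀ hn0.ne']
      simp [Nat.cast_smul_eq_nsmul]
    have h2 : Real.log (2 / η) + 1 ≤ ‖∑ i, θ • (ξ (z i) - m)‖ := by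
      rw [h1]
      have h3 : θ * (n * ((4 * M / n + 2 * σ / √n) * (Real.log (2 / η) + 1)))
          = Real.log (2 / η) + 1 := by
        have hsq : (n : ℝ) / √n = √n := Real.div_sqrt
        have : (n : ℝ) * (4 * M / n + 2 * σ / √n) = D := by
          rw [hD, mul_add, mul_div_cancel₀ _ hn0.ne']
          congr 1
          calc (n : ℝ) * (2 * σ / √n) = 2 * σ * (n / √n) := by ring
            _ = 2 * σ * √n := by rw [hsq]
        rw [← mul_assoc (n : ℝ), this, ← mul_assoc, hθ, inv_mul_cancel₀ hDpos.ne', one_mul]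
      rw [← h3]
      gcongr
    calc Real.exp 1 / η = Real.exp (Real.log (2 / η) + 1) / 2 := by
          rw [Real.exp_add, Real.exp_log (by positivity)]; field_simp
      _ ≤ Real.exp ‖∑ i, θ • (ξ (z i) - m)‖ / 2 := by gcongr
      _ ≤ Real.cosh ‖∑ i, θ • (ξ (z i) - m)‖ := by
          rw [Real.cosh_eq]
          linarith [Real.exp_pos (-‖∑ i, θ • (ξ (z i) - m)‖)]
  refine (measure_mono hsub).trans ?_
  have h5 := hmarkov.trans (hcosh.trans hexp)
  rw [mul_comm, ← ENNReal.le_div_iff_mul_le (Or.inl (by simp; positivity))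
    (Or.inl ENNReal.ofReal_ne_top), ← ENNReal.ofReal_div_of_pos (by positivity)] at h5
  refine h5.trans (ENNReal.ofReal_le_ofReal (le_of_eq ?_))
  field_simp

end Bernstein

/-! ### Powers of positive operators and rank-one updates -/

section LogConvex

variable {h : ℕ → ℝ}

/-- The ratios `h (k + 1) / h k` of a log-convex sequence increase. -/
theorem mul_le_mul_of_logConvex (h0 : ∀ k, 0 ≤ h k) (hc : ∀ k, h (k + 1) ^ 2 ≤ h k * h (k + 2))
    {i j : ℕ} (hij : i ≤ j) : h (i + 1) * h j ≤ h i * h (j + 1) := by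
  induction j, hij using Nat.le_induction with
  | base => rw [mul_comm]
  | succ j hij ih =>
    rcases (h0 j).eq_or_lt with hj | hj
    · have := hc j
      rw [← hj, zero_mul] at this
      rw [pow_eq_zero_iff two_ne_zero |>.1 (le_antisymm this (sq_nonneg _)), mul_zero]
      exact mul_nonneg (h0 _) (h0 _)
    · refine le_of_mul_le_mul_right ?_ hj
      calc h (i + 1) * h (j + 1) * h j = h (i + 1) * h j * h (j + 1) := by ring
        _ ≤ h i * h (j + 1) * h (j + 1) := by gcongr; exact h0 _
        _ = h i * h (j + 1) ^ 2 := by ring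
        _ ≤ h i * (h j * h (j + 2)) := by gcongr; exacts [h0 _, hc j]
        _ = h i * h (j + 2) * h j := by ring

theorem mul_le_zero_mul_of_logConvex (h0 : ∀ k, 0 ≤ h k)
    (hc : ∀ k, h (k + 1) ^ 2 ≤ h k * h (k + 2)) (i j : ℕ) : h i * h j ≤ h 0 * h (i + j) := by
  have key : ∀ i j, i ≤ j → h i * h j ≤ h 0 * h (i + j) := by
    intro i
    induction i with
    | zero => intro j _; rw [zero_add]
    | succ i ih =>
      intro j hij
      refine (mul_le_mul_of_logConvex h0 hc (by omega)).trans ((ih (j + 1) (by omega)).trans ?_)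
      rw [show i + (j + 1) = i + 1 + j by ring]
  rcases le_total i j with hij | hij
  · exact key i j hij
  · rw [mul_comm, add_comm]; exact key j i hij

theorem pow_le_of_logConvex (h0 : ∀ k, 0 ≤ h k) (hc : ∀ k, h (k + 1) ^ 2 ≤ h k * h (k + 2))
    (h1 : h 0 = 1) (k : ℕ) : h 1 ^ k ≤ h k := by
  induction k with
  | zero => simp [h1]
  | succ k ih =>
    have := mul_le_mul_of_logConvex h0 hc (Nat.zero_le k)
    rw [h1, one_mul, zero_add] at this
    rw [pow_succ']
    exact (mul_le_mul_of_nonneg_left ih (h0 1)).trans this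

end LogConvex

section Powers

variable {H : Type*} [NormedAddCommGroup H] [InnerProductSpace ℝ H]

theorem pow_succ_apply (A : H →L[ℝ] H) (k : ℕ) (v : H) : (A ^ (k + 1)) v = (A ^ k) (A v) := by
  rw [pow_succ]; rfl

theorem pow_succ_apply' (A : H →L[ℝ] H) (k : ℕ) (v : H) : (A ^ (k + 1)) v = A ((A ^ k) v) := by
  rw [pow_succ']; rfl

theorem inner_pow_left {A : H →L[ℝ] H} (hA : A.IsPositive) (k : ℕ) (x y : H) :
    inner ℝ ((A ^ k) x) y = inner ℝ x ((A ^ k) y) := by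
  induction k generalizing x with
  | zero => rfl
  | succ k ih => rw [pow_succ_apply, ih, hA.inner_left_eq_inner_right, pow_succ_apply']

theorem inner_pow_add {A : H →L[ℝ] H} (hA : A.IsPositive) (k : ℕ) (x y : H) :
    inner ℝ x ((A ^ (2 * k)) y) = inner ℝ ((A ^ k) x) ((A ^ k) y) := by
  rw [inner_pow_left hA, two_mul, pow_add]; rfl

theorem inner_pow_two_mul {A : H →L[ℝ] H} (hA : A.IsPositive) (k : ℕ) (x : H) :
    inner ℝ x ((A ^ (2 * k)) x) = ‖(A ^ k) x‖ ^ 2 := by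
  rw [inner_pow_add hA, real_inner_self_eq_norm_sq]

theorem inner_pow_two_mul_succ {A : H →L[ℝ] H} (hA : A.IsPositive) (k : ℕ) (x : H) :
    inner ℝ x ((A ^ (2 * k + 1)) x) = inner ℝ ((A ^ k) x) (A ((A ^ k) x)) := by
  rw [inner_pow_left hA, pow_succ_apply, two_mul, pow_add, ← pow_succ_apply', pow_succ_apply]; rfl

theorem isPositive_pow {A : H →L[ℝ] H} (hA : A.IsPositive) (k : ℕ) : (A ^ k).IsPositive := by
  refine (ContinuousLinearMap.isPositive_iff _).2 ⟨fun x y => inner_pow_left hA k x y, fun x => ?_⟩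
  rw [real_inner_comm]
  rcases Nat.even_or_odd' k with ⟨r, rfl | rfl⟩
  · rw [inner_pow_two_mul hA]; positivity
  · rw [inner_pow_two_mul_succ hA]; exact hA.inner_nonneg_right _

/-- The Cauchy–Schwarz inequality for the form of a positive operator. -/
theorem inner_sq_le_of_isPositive {W : H →L[ℝ] H} (hW : W.IsPositive) (x y : H) :
    inner ℝ x (W y) ^ 2 ≤ inner ℝ x (W x) * inner ℝ y (W y) := by
  have hsym : inner ℝ y (W x) = inner ℝ x (W y) := by
    rw [real_inner_comm, hW.inner_left_eq_inner_right]
  have h : ∀ t : ℝ, 0 ≤ inner ℝ y (W y) * (t * t) + 2 * inner ℝ x (W y) * t + inner ℝ x (W x) := by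
    intro t
    have := hW.inner_nonneg_right (x + t • y)
    simp only [map_add, map_smul, inner_add_left, inner_add_right, real_inner_smul_left,
      real_inner_smul_right, hsym] at this
    linarith
  have := discrim_le_zero h
  rw [discrim] at this
  linarith

theorem inner_pow_logConvex {A : H →L[ℝ] H} (hA : A.IsPositive) (x : H) (k : ℕ) :
    inner ℝ x ((A ^ (k + 1)) x) ^ 2 ≤ inner ℝ x ((A ^ k) x) * inner ℝ x ((A ^ (k + 2)) x) := by
  have := inner_sq_le_of_isPositive (isPositive_pow hA k) x (A x)
  rwa [← pow_succ_apply, hA.inner_left_eq_inner_right, ← pow_succ_apply'] at this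

theorem inner_pow_nonneg {A : H →L[ℝ] H} (hA : A.IsPositive) (x : H) (k : ℕ) :
    0 ≤ inner ℝ x ((A ^ k) x) := (isPositive_pow hA k).inner_nonneg_right x

/-- Telescoping for the powers of `A` and `Z` when `A - Z = ⟨ξ, Z ·⟩ A ξ`, as for
`A = M⁻¹`, `Z = (M + ξ ⊗ ξ)⁻¹`. -/
theorem inner_pow_sub_inner_pow {A Z : H →L[ℝ] H} {ξ : H}
    (h : ∀ v, A v = Z v + inner ℝ ξ (Z v) • A ξ) (q : ℕ) (v : H) :
    inner ℝ ξ ((A ^ q) v) = inner ℝ ξ ((Z ^ q) v)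
      + ∑ j ∈ Finset.range q, inner ℝ ξ ((A ^ (j + 1)) ξ) * inner ℝ ξ ((Z ^ (q - j)) v) := by
  induction q generalizing v with
  | zero => simp
  | succ q ih =>
    rw [pow_succ_apply, h, map_add, inner_add_right, ih, map_smul, real_inner_smul_right,
      ← pow_succ_apply, ← pow_succ_apply, Finset.sum_range_succ, add_assoc]
    congr 2
    · refine Finset.sum_congr rfl fun j hj => ?_
      have hj := Finset.mem_range.1 hj
      rw [← pow_succ_apply, show q + 1 - j = q - j + 1 by omega]
    · rw [Nat.add_sub_cancel_left, pow_one, mul_comm]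

/-- Decoupling for resolvents: with `A = M⁻¹` and `Z = (M + ξ ⊗ ξ)⁻¹`, removing `ξ` from the sum
costs at most a factor `2` in `⟨ξ, A^q ξ⟩`, if `q ⟨ξ, A ξ⟩ ≤ 1/2`. By log-convexity each of the `q`
terms of the telescoping sum is at most `⟨ξ, A ξ⟩ ⟨ξ, A^q ξ⟩`. -/
theorem inner_inv_pow_le_two_mul {A Z : H →L[ℝ] H} {ξ : H} (hA : A.IsPositive) (hZ : Z.IsPositive)
    (h : ∀ v, A v = Z v + inner ℝ ξ (Z v) • A ξ) {q : ℕ}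
    (hq : 2 * q * inner ℝ ξ (A ξ) ≤ 1) :
    inner ℝ ξ ((A ^ q) ξ) ≤ 2 * inner ℝ ξ ((Z ^ q) ξ) := by
  have hle : ∀ q, inner ℝ ξ ((Z ^ q) ξ) ≤ inner ℝ ξ ((A ^ q) ξ) := fun q => by
    rw [inner_pow_sub_inner_pow h q ξ]
    exact le_add_of_nonneg_right (Finset.sum_nonneg fun j _ =>
      mul_nonneg (inner_pow_nonneg hA ξ _) (inner_pow_nonneg hZ ξ _))
  have hsum : ∑ j ∈ Finset.range q, inner ℝ ξ ((A ^ (j + 1)) ξ) * inner ℝ ξ ((Z ^ (q - j)) ξ)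
      ≤ ∑ _j ∈ Finset.range q, inner ℝ ξ (A ξ) * inner ℝ ξ ((A ^ q) ξ) := by
    refine Finset.sum_le_sum fun j hj => ?_
    have hj := Finset.mem_range.1 hj
    refine (mul_le_mul_of_nonneg_left (hle _) (inner_pow_nonneg hA ξ _)).trans ?_
    have := mul_le_zero_mul_of_logConvex (h := fun k => inner ℝ ξ ((A ^ (k + 1)) ξ))
      (fun k => inner_pow_nonneg hA ξ _) (fun k => inner_pow_logConvex hA ξ _) j (q - j - 1)
    simp only [zero_add, pow_one] at this
    rwa [show q - j - 1 + 1 = q - j by omega, show j + (q - j - 1) + 1 = q by omega] at this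
  rw [Finset.sum_const, Finset.card_range, nsmul_eq_mul] at hsum
  have h1 := inner_pow_sub_inner_pow h q ξ
  have h2 := mul_le_mul_of_nonneg_right hq (inner_pow_nonneg hA ξ q)
  nlinarith

/-- Telescoping for the powers of `M + ξ ⊗ ξ` and of `M`. -/
theorem inner_pow_update {M M' : H →L[ℝ] H} {ξ : H} (h : ∀ v, M' v = M v + inner ℝ ξ v • ξ)
    (q : ℕ) (v : H) :
    inner ℝ ξ ((M' ^ q) v) = inner ℝ ξ ((M ^ q) v)
      + ∑ j ∈ Finset.range q, inner ℝ ξ ((M ^ j) ξ) * inner ℝ ξ ((M' ^ (q - 1 - j)) v) := by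
  induction q generalizing v with
  | zero => simp
  | succ q ih =>
    have hstep : inner ℝ ξ ((M ^ q) (M' v))
        = inner ℝ ξ ((M ^ (q + 1)) v) + inner ℝ ξ ((M ^ q) ξ) * inner ℝ ξ v := by
      rw [h, map_add, inner_add_right, map_smul, real_inner_smul_right, ← pow_succ_apply, mul_comm]
    rw [pow_succ_apply, ih, hstep, Finset.sum_range_succ]
    have hs : ∑ j ∈ Finset.range q, inner ℝ ξ ((M ^ j) ξ) * inner ℝ ξ ((M' ^ (q - 1 - j)) (M' v))
        = ∑ j ∈ Finset.range q, inner ℝ ξ ((M ^ j) ξ) * inner ℝ ξ ((M' ^ (q + 1 - 1 - j)) v) := by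
      refine Finset.sum_congr rfl fun j hj => ?_
      have hj := Finset.mem_range.1 hj
      rw [← pow_succ_apply, show q - 1 - j + 1 = q + 1 - 1 - j by omega]
    rw [hs, show q + 1 - 1 - q = 0 by omega, pow_zero, one_apply_eq_self]
    ring

/-- Decoupling for powers: adding `ξ ⊗ ξ` to `M ≥ m` costs at most a factor `2` in `⟨ξ, M^q ξ⟩`, if
`2 q ‖ξ‖² ≤ m`. -/
theorem inner_pow_update_le_two_mul {M M' : H →L[ℝ] H} {ξ : H} (hM : M.IsPositive)
    (hM' : M'.IsPositive) (h : ∀ v, M' v = M v + inner ℝ ξ v • ξ) {m K : ℝ} {q : ℕ}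
    (hmM : ∀ v, m * ‖v‖ ^ 2 ≤ inner ℝ v (M v)) (hK : ‖ξ‖ ^ 2 ≤ K) (hq : 2 * q * K ≤ m) :
    inner ℝ ξ ((M' ^ q) ξ) ≤ 2 * inner ℝ ξ ((M ^ q) ξ) := by
  rcases eq_or_ne ξ 0 with rfl | hξ
  · simp
  rcases q with _ | q
  · simp only [pow_zero, one_apply_eq_self]
    nlinarith [real_inner_self_nonneg (x := ξ)]
  set f : ℕ → ℝ := fun k => inner ℝ ξ ((M' ^ k) ξ) with hf
  have hf0 : f 0 = ‖ξ‖ ^ 2 := by simp [hf]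
  have hξ' : 0 < ‖ξ‖ ^ 2 := by positivity
  have hfn : ∀ k, 0 ≤ f k := inner_pow_nonneg hM' ξ
  have hfc : ∀ k, f (k + 1) ^ 2 ≤ f k * f (k + 2) := inner_pow_logConvex hM' ξ
  have hle : ∀ q, inner ℝ ξ ((M ^ q) ξ) ≤ f q := fun q => by
    simp only [hf]
    rw [inner_pow_update h q ξ]
    exact le_add_of_nonneg_right (Finset.sum_nonneg fun j _ =>
      mul_nonneg (inner_pow_nonneg hM ξ _) (inner_pow_nonneg hM' ξ _))
  have hf1 : m * f 0 ≤ f 1 := by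
    refine le_trans ?_ (hle 1)
    rw [hf0, pow_one]; exact hmM ξ
  have hgrow : m * f q ≤ f (q + 1) := by
    have h1 := mul_le_mul_of_logConvex hfn hfc (Nat.zero_le q)
    rw [zero_add] at h1
    have h2 := mul_le_mul_of_nonneg_right hf1 (hfn q)
    rw [hf0] at h1 h2
    nlinarith
  have hsum : ∑ j ∈ Finset.range (q + 1), inner ℝ ξ ((M ^ j) ξ) * f (q + 1 - 1 - j)
      ≤ ∑ _j ∈ Finset.range (q + 1), K * f q := by
    refine Finset.sum_le_sum fun j hj => ?_
    have hj := Finset.mem_range.1 hj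
    refine (mul_le_mul_of_nonneg_right (hle j) (hfn _)).trans ?_
    refine (mul_le_zero_mul_of_logConvex hfn hfc _ _).trans ?_
    rw [show j + (q + 1 - 1 - j) = q by omega, hf0]
    exact mul_le_mul_of_nonneg_right hK (hfn q)
  rw [Finset.sum_const, Finset.card_range, nsmul_eq_mul] at hsum
  have h1 := inner_pow_update h (q + 1) ξ
  have h2 := mul_le_mul_of_nonneg_right hq (hfn q)
  change f (q + 1) ≤ _
  change f (q + 1) = _ at h1
  linarith

end Powers

/-! ### Tail bounds for sums of rank-one operators -/

section SampleOp

variable {H : Type*} [NormedAddCommGroup H] [InnerProductSpace ℝ H]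

/-- The positive operator `∑ i, y_i ⊗ y_i`. -/
def sampleOp {n : ℕ} (y : Fin n → H) : H →L[ℝ] H :=
  ∑ i, InnerProductSpace.rankOne ℝ (y i) (y i)

/-- The regularized sum `m + ∑ i, y_i ⊗ y_i`. -/
def regOp (m : ℝ) {n : ℕ} (y : Fin n → H) : H →L[ℝ] H :=
  m • (1 : H →L[ℝ] H) + sampleOp y

theorem sampleOp_apply {n : ℕ} (y : Fin n → H) (v : H) :
    sampleOp y v = ∑ i, inner ℝ (y i) v • y i := by
  simp [sampleOp, sum_apply]

theorem regOp_apply (m : ℝ) {n : ℕ} (y : Fin n → H) (v : H) :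
    regOp m y v = m • v + sampleOp y v := rfl

theorem inner_sampleOp {n : ℕ} (y : Fin n → H) (u v : H) :
    inner ℝ u (sampleOp y v) = ∑ i, inner ℝ (y i) u * inner ℝ (y i) v := by
  rw [sampleOp_apply, inner_sum]
  refine Finset.sum_congr rfl fun i _ => ?_
  rw [real_inner_smul_right, real_inner_comm u, mul_comm]

theorem inner_sampleOp_self {n : ℕ} (y : Fin n → H) (v : H) :
    inner ℝ v (sampleOp y v) = ∑ i, inner ℝ (y i) v ^ 2 := by
  rw [inner_sampleOp]; exact Finset.sum_congr rfl fun i _ => (sq _).symm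

theorem isPositive_sampleOp {n : ℕ} (y : Fin n → H) : (sampleOp y).IsPositive :=
  ContinuousLinearMap.isPositive_sum _ fun i _ => InnerProductSpace.isPositive_rankOne_self (y i)

theorem isPositive_regOp {m : ℝ} (hm : 0 ≤ m) {n : ℕ} (y : Fin n → H) : (regOp m y).IsPositive :=
  (ContinuousLinearMap.isPositive_one.smul_of_nonneg hm).add (isPositive_sampleOp y)

theorem mul_norm_sq_le_regOp (m : ℝ) {n : ℕ} (y : Fin n → H) (v : H) :
    m * ‖v‖ ^ 2 ≤ inner ℝ v (regOp m y v) := by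
  rw [regOp_apply, inner_add_right, real_inner_smul_right, real_inner_self_eq_norm_sq]
  exact le_add_of_nonneg_right ((isPositive_sampleOp y).inner_nonneg_right v)

theorem regOp_cons (m : ℝ) {n : ℕ} (x : H) (y : Fin n → H) (v : H) :
    regOp m (Fin.cons x y : Fin (n + 1) → H) v = regOp m y v + inner ℝ x v • x := by
  simp only [regOp_apply, sampleOp_apply, Fin.sum_univ_succ, Fin.cons_zero, Fin.cons_succ]
  abel

theorem regOp_comp_equiv (m : ℝ) {n : ℕ} (y : Fin n → H) (σ : Equiv.Perm (Fin n)) :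
    regOp m (fun i => y (σ i)) = regOp m y := by
  simp only [regOp, sampleOp]
  rw [Equiv.sum_comp σ fun i => InnerProductSpace.rankOne ℝ (y i) (y i)]

theorem continuous_regOp (m : ℝ) (n : ℕ) : Continuous fun y : Fin n → H => regOp m y := by
  simp only [regOp, sampleOp]
  refine continuous_const.add (continuous_finsetSum _ fun i _ => ?_)
  have h : Continuous fun x : H => InnerProductSpace.rankOne ℝ x x := continuous_rankOne_self
  exact h.comp (continuous_apply i)

variable [CompleteSpace H]

theorem isUnit_regOp {m : ℝ} (hm : 0 < m) {n : ℕ} (y : Fin n → H) : IsUnit (regOp m y) := by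
  refine ContinuousLinearMap.isUnit_of_forall_le_norm_inner_map _ (c := ⟨m, hm.le⟩) hm fun v => ?_
  rw [real_inner_comm, Real.norm_eq_abs]
  refine le_trans ?_ (le_abs_self _)
  rw [mul_comm]
  exact mul_norm_sq_le_regOp m y v

/-- The resolvent `(m + ∑ i, y_i ⊗ y_i)⁻¹`. -/
def resOp (m : ℝ) {n : ℕ} (y : Fin n → H) : H →L[ℝ] H := Ring.inverse (regOp m y)

theorem regOp_resOp {m : ℝ} (hm : 0 < m) {n : ℕ} (y : Fin n → H) (v : H) :
    regOp m y (resOp m y v) = v :=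
  congrArg (fun A : H →L[ℝ] H => A v) (Ring.mul_inverse_cancel _ (isUnit_regOp hm y))

theorem resOp_regOp {m : ℝ} (hm : 0 < m) {n : ℕ} (y : Fin n → H) (v : H) :
    resOp m y (regOp m y v) = v :=
  congrArg (fun A : H →L[ℝ] H => A v) (Ring.inverse_mul_cancel _ (isUnit_regOp hm y))

theorem isPositive_resOp {m : ℝ} (hm : 0 < m) {n : ℕ} (y : Fin n → H) :
    (resOp m y).IsPositive := by
  have hM := isPositive_regOp hm.le y
  refine (ContinuousLinearMap.isPositive_iff _).2 ⟨fun u v => ?_, fun v => ?_⟩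
  · change inner ℝ (resOp m y u) v = inner ℝ u (resOp m y v)
    conv_lhs => rw [← regOp_resOp hm y v]
    rw [← hM.inner_left_eq_inner_right, regOp_resOp hm]
  · conv_rhs => rw [← regOp_resOp hm y v]
    rw [resOp_regOp hm]
    exact hM.inner_nonneg_right _

theorem inner_resOp_le {m : ℝ} (hm : 0 < m) {n : ℕ} (y : Fin n → H) (v : H) :
    m * inner ℝ v (resOp m y v) ≤ ‖v‖ ^ 2 := by
  set w := resOp m y v with hw
  have h1 : m * ‖w‖ ^ 2 ≤ inner ℝ w v := by
    have := mul_norm_sq_le_regOp m y w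
    rwa [hw, regOp_resOp hm] at this
  have h2 := real_inner_le_norm w v
  rw [real_inner_comm]
  have h3 : m * ‖w‖ ≤ ‖v‖ := by
    rcases (norm_nonneg w).eq_or_lt with h | h
    · rw [← h, mul_zero]; positivity
    · nlinarith
  nlinarith [norm_nonneg v, norm_nonneg w]

theorem continuous_resOp {m : ℝ} (hm : 0 < m) (n : ℕ) :
    Continuous fun y : Fin n → H => resOp m y := by
  refine continuous_iff_continuousAt.2 fun y => ?_
  obtain ⟨M, hM⟩ := isUnit_regOp hm y
  have := NormedRing.inverse_continuousAt M
  rw [hM] at this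
  exact ContinuousAt.comp (f := fun y : Fin n → H => regOp m y) this
    (continuous_regOp m n).continuousAt

theorem resOp_cons {m : ℝ} (hm : 0 < m) {n : ℕ} (x : H) (y : Fin n → H) (v : H) :
    resOp m y v = resOp m (Fin.cons x y : Fin (n + 1) → H) v
      + inner ℝ x (resOp m (Fin.cons x y : Fin (n + 1) → H) v) • resOp m y x := by
  have h := regOp_cons m x y (resOp m (Fin.cons x y : Fin (n + 1) → H) v)
  rw [regOp_resOp hm] at h
  conv_lhs => rw [h]
  rw [map_add, map_smul, resOp_regOp hm]

theorem sampleOp_eq_sub (m : ℝ) {n : ℕ} (y : Fin n → H) (v : H) :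
    sampleOp y v = regOp m y v - m • v := by rw [regOp_apply]; abel

end SampleOp

section Measurable

variable {H : Type*} [NormedAddCommGroup H] [InnerProductSpace ℝ H] [CompleteSpace H]
  [TopologicalSpace.SeparableSpace H] [MeasurableSpace H] [BorelSpace H]
  {Ω : Type*} [MeasurableSpace Ω]

theorem measurable_inner_pow {n : ℕ} {W : (Fin n → H) → H →L[ℝ] H} (hW : Continuous W) (q : ℕ)
    {α : Type*} [MeasurableSpace α] {u : α → H} {y : α → Fin n → H} (hu : Measurable u)
    (hy : Measurable y) :
    Measurable fun a => ENNReal.ofReal (inner ℝ (u a) ((W (y a) ^ q) (u a))) := by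
  have := UniformSpace.secondCountable_of_separable H
  have hc : Continuous fun p : H × (Fin n → H) => inner ℝ p.1 ((W p.2 ^ q) p.1) :=
    continuous_fst.inner (((hW.comp continuous_snd).pow q).clm_apply continuous_fst)
  exact (hc.measurable.comp (hu.prodMk hy)).ennreal_ofReal

/-- Product measures are invariant under permutations of the coordinates. -/
theorem lintegral_pi_perm (ν : Measure Ω) [SigmaFinite ν] {n : ℕ} (σ : Equiv.Perm (Fin n))
    {F : (Fin n → Ω) → ℝ≥0∞} (hF : Measurable F) :
    ∫⁻ z, F (fun i => z (σ i)) ∂(Measure.pi fun _ : Fin n => ν)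
      = ∫⁻ z, F z ∂(Measure.pi fun _ : Fin n => ν) := by
  have h := measurePreserving_piCongrLeft (fun _ : Fin n => ν) σ.symm
  rw [← h.lintegral_comp hF]
  refine lintegral_congr fun z => ?_
  congr 1
  funext i
  have := MeasurableEquiv.piCongrLeft_apply_apply (β := fun _ : Fin n => Ω) σ.symm z (σ i)
  rw [Equiv.symm_apply_apply] at this
  exact this.symm

/-- By exchangeability, the summands of a symmetric statistic have the same mean as the first. -/
theorem lintegral_sum_inner_pow (ν : Measure Ω) [IsProbabilityMeasure ν] {ξ : Ω → H}
    (hξ : Measurable ξ) {n : ℕ} {W : (Fin (n + 1) → H) → H →L[ℝ] H} (hW : Continuous W)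
    (hσ : ∀ (y : Fin (n + 1) → H) (σ : Equiv.Perm (Fin (n + 1))), W (fun i => y (σ i)) = W y)
    (q : ℕ) :
    ∫⁻ z, ∑ k, ENNReal.ofReal (inner ℝ (ξ (z k)) ((W (fun i => ξ (z i)) ^ q) (ξ (z k))))
        ∂(Measure.pi fun _ : Fin (n + 1) => ν)
      = ((n + 1 : ℕ) : ℝ≥0∞) * ∫⁻ x, ∫⁻ z, ENNReal.ofReal
          (inner ℝ (ξ x) ((W (Fin.cons (ξ x) fun i => ξ (z i)) ^ q) (ξ x)))
          ∂(Measure.pi fun _ : Fin n => ν) ∂ν := by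
  have hm : ∀ k : Fin (n + 1), Measurable fun z : Fin (n + 1) → Ω =>
      ENNReal.ofReal (inner ℝ (ξ (z k)) ((W (fun i => ξ (z i)) ^ q) (ξ (z k)))) := fun k =>
    measurable_inner_pow hW q (hξ.comp (measurable_pi_apply k))
      (measurable_pi_lambda _ fun i => hξ.comp (measurable_pi_apply i))
  rw [lintegral_finsetSum _ fun k _ => hm k]
  have h0 : ∀ k : Fin (n + 1), ∫⁻ z, ENNReal.ofReal
      (inner ℝ (ξ (z k)) ((W (fun i => ξ (z i)) ^ q) (ξ (z k)))) ∂(Measure.pi fun _ => ν)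
      = ∫⁻ z, ENNReal.ofReal
      (inner ℝ (ξ (z 0)) ((W (fun i => ξ (z i)) ^ q) (ξ (z 0)))) ∂(Measure.pi fun _ => ν) := by
    intro k
    rw [← lintegral_pi_perm ν (Equiv.swap 0 k) (hm 0)]
    refine lintegral_congr fun z => ?_
    have := hσ (fun i => ξ (z i)) (Equiv.swap 0 k)
    simp only [this, Equiv.swap_apply_left]
  rw [Finset.sum_congr rfl fun k _ => h0 k, Finset.sum_const, Finset.card_univ, Fintype.card_fin,
    nsmul_eq_mul, lintegral_pi_succ ν (hm 0)]
  congr 1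
  refine lintegral_congr fun x => lintegral_congr fun z => ?_
  have : (fun i => ξ ((Fin.cons x z : Fin (n + 1) → Ω) i))
      = (Fin.cons (ξ x) fun i => ξ (z i) : Fin (n + 1) → H) := by
    funext i
    refine Fin.cases ?_ (fun j => ?_) i <;> simp
  rw [this, Fin.cons_zero]

end Measurable

section Lower

variable {H : Type*} [NormedAddCommGroup H] [InnerProductSpace ℝ H] [CompleteSpace H]
  [TopologicalSpace.SeparableSpace H] [MeasurableSpace H] [BorelSpace H]
  {Ω : Type*} [MeasurableSpace Ω] {ν : Measure Ω} [IsProbabilityMeasure ν] {ξ : Ω → H}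

theorem integrable_inner_apply (hξ : Measurable ξ) {K : ℝ} (hK : ∀ x, ‖ξ x‖ ^ 2 ≤ K)
    (W : H →L[ℝ] H) : Integrable (fun x => inner ℝ (ξ x) (W (ξ x))) ν := by
  have := UniformSpace.secondCountable_of_separable H
  refine Integrable.of_bound (C := ‖W‖ * K) ?_ (ae_of_all _ fun x => ?_)
  · have hc : Continuous fun v : H => inner ℝ v (W v) := continuous_id.inner W.continuous
    exact (hc.measurable.comp hξ).aestronglyMeasurable
  · refine (norm_inner_le_norm _ _).trans ?_
    have := W.le_opNorm (ξ x)
    calc ‖ξ x‖ * ‖W (ξ x)‖ ≤ ‖ξ x‖ * (‖W‖ * ‖ξ x‖) := by gcongr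
      _ = ‖W‖ * ‖ξ x‖ ^ 2 := by ring
      _ ≤ ‖W‖ * K := by gcongr; exact hK x

theorem integrable_inner_mul_inner_of_bdd (hξ : Measurable ξ) {K : ℝ} (hK : ∀ x, ‖ξ x‖ ^ 2 ≤ K)
    (u v : H) : Integrable (fun x => inner ℝ (ξ x) u * inner ℝ (ξ x) v) ν := by
  refine (integrable_inner_apply hξ hK (InnerProductSpace.rankOne ℝ u v)).congr
    (ae_of_all _ fun x => ?_)
  simp only [InnerProductSpace.rankOne_apply, real_inner_smul_right]
  rw [real_inner_comm v, mul_comm]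

/-- The mean of `⟨ξ, (m + ∑ i, ξ_i ⊗ ξ_i)^{-q} ξ⟩`, for `ξ, ξ_1, …, ξ_n` independent and
identically distributed. -/
def resMoment (ν : Measure Ω) (ξ : Ω → H) (m : ℝ) (q n : ℕ) : ℝ≥0∞ :=
  ∫⁻ x, ∫⁻ z, ENNReal.ofReal (inner ℝ (ξ x) ((resOp m (fun i => ξ (z i)) ^ q) (ξ x)))
    ∂(Measure.pi fun _ : Fin n => ν) ∂ν

theorem resMoment_eq (hξ : Measurable ξ) {m : ℝ} (hm : 0 < m) (q n : ℕ) :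
    resMoment ν ξ m q n
      = ∫⁻ z, ∫⁻ x, ENNReal.ofReal (inner ℝ (ξ x) ((resOp m (fun i => ξ (z i)) ^ q) (ξ x)))
        ∂ν ∂(Measure.pi fun _ : Fin n => ν) := by
  refine lintegral_lintegral_swap (Measurable.aemeasurable ?_)
  exact measurable_inner_pow (continuous_resOp hm n) q (hξ.comp measurable_fst)
    (measurable_pi_lambda _ fun i => hξ.comp ((measurable_pi_apply i).comp measurable_snd))

/-- For an isotropic `ξ`, the sum of `⟨ξ_k, A^{q+1} ξ_k⟩` with `A = (m + S)⁻¹` is the trace of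
`S A^{q+1} ≤ A^q`, and the trace of `A^q` is the mean of `⟨ξ, A^q ξ⟩`. -/
theorem sum_inner_resOp_pow_le (hξ : Measurable ξ) {K : ℝ} (hK : ∀ x, ‖ξ x‖ ^ 2 ≤ K)
    {P : H →L[ℝ] H} (hiso : ∀ u v, ∫ x, inner ℝ (ξ x) u * inner ℝ (ξ x) v ∂ν = inner ℝ u (P v))
    (hP : ∀ x, P (ξ x) = ξ x) {m : ℝ} (hm : 0 < m) (q : ℕ) {n : ℕ} (z : Fin n → Ω) :
    ∑ k, ENNReal.ofReal (inner ℝ (ξ (z k)) ((resOp m (fun i => ξ (z i)) ^ (q + 1)) (ξ (z k))))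
      ≤ ∫⁻ x, ENNReal.ofReal (inner ℝ (ξ x) ((resOp m (fun i => ξ (z i)) ^ q) (ξ x))) ∂ν := by
  set y : Fin n → H := fun i => ξ (z i) with hy
  have hA := isPositive_resOp hm y
  rw [← ENNReal.ofReal_sum_of_nonneg fun k _ => inner_pow_nonneg hA _ _,
    ← ofReal_integral_eq_lintegral_ofReal (integrable_inner_apply hξ hK _)
      (ae_of_all _ fun x => inner_pow_nonneg hA _ _)]
  refine ENNReal.ofReal_le_ofReal ?_
  have hpt : ∀ x, inner ℝ (ξ x) ((resOp m y ^ q) (ξ x))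
      = m * inner ℝ (ξ x) ((resOp m y ^ (q + 1)) (ξ x))
        + ∑ k, inner ℝ (ξ x) ((resOp m y ^ (q + 1)) (y k)) * inner ℝ (ξ x) (y k) := by
    intro x
    have hx : (resOp m y ^ q) (ξ x) = (resOp m y ^ (q + 1)) (m • ξ x + sampleOp y (ξ x)) := by
      rw [pow_succ_apply, ← regOp_apply, resOp_regOp hm]
    rw [hx, map_add, map_smul, inner_add_right, real_inner_smul_right, sampleOp_apply, map_sum,
      inner_sum]
    congr 1
    refine Finset.sum_congr rfl fun k _ => ?_
    rw [map_smul, real_inner_smul_right, real_inner_comm (ξ x), mul_comm]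
  have hint : ∀ k, Integrable
      (fun x => inner ℝ (ξ x) ((resOp m y ^ (q + 1)) (y k)) * inner ℝ (ξ x) (y k)) ν := fun k =>
    integrable_inner_mul_inner_of_bdd hξ hK _ _
  have hint1 : Integrable (fun x => m * inner ℝ (ξ x) ((resOp m y ^ (q + 1)) (ξ x))) ν :=
    (integrable_inner_apply hξ hK _).const_mul m
  have hint2 : Integrable (fun x => ∑ k,
      inner ℝ (ξ x) ((resOp m y ^ (q + 1)) (y k)) * inner ℝ (ξ x) (y k)) ν :=
    integrable_finsetSum _ fun k _ => hint k
  rw [integral_congr_ae (ae_of_all _ hpt), integral_add hint1 hint2,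
    integral_finsetSum _ fun k _ => hint k]
  have h0 : 0 ≤ ∫ x, m * inner ℝ (ξ x) ((resOp m y ^ (q + 1)) (ξ x)) ∂ν :=
    integral_nonneg fun x => mul_nonneg hm.le (inner_pow_nonneg hA _ _)
  refine le_trans (le_of_eq ?_) (le_add_of_nonneg_left h0)
  refine Finset.sum_congr rfl fun k _ => ?_
  rw [hiso, show P (y k) = y k from hP _, real_inner_comm]

/-- A recursion which lowers the exponent and adds a sample point: `ξ` is decoupled from the
resolvent, then it is averaged with the other sample points, and the sum is a trace. -/
theorem succ_mul_resMoment_le (hξ : Measurable ξ) {K : ℝ} (hK : ∀ x, ‖ξ x‖ ^ 2 ≤ K)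
    {P : H →L[ℝ] H} (hiso : ∀ u v, ∫ x, inner ℝ (ξ x) u * inner ℝ (ξ x) v ∂ν = inner ℝ u (P v))
    (hP : ∀ x, P (ξ x) = ξ x) {m : ℝ} (hm : 0 < m) {q : ℕ} (hq : 2 * ((q + 1 : ℕ) : ℝ) * K ≤ m)
    (n : ℕ) : ((n + 1 : ℕ) : ℝ≥0∞) * resMoment ν ξ m (q + 1) n ≤ 2 * resMoment ν ξ m q (n + 1) := by
  have hpt : ∀ x (z : Fin n → Ω),
      ENNReal.ofReal (inner ℝ (ξ x) ((resOp m (fun i => ξ (z i)) ^ (q + 1)) (ξ x)))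
      ≤ 2 * ENNReal.ofReal (inner ℝ (ξ x)
        ((resOp m (Fin.cons (ξ x) fun i => ξ (z i) : Fin (n + 1) → H) ^ (q + 1)) (ξ x))) := by
    intro x z
    rw [← ENNReal.ofReal_ofNat 2, ← ENNReal.ofReal_mul zero_le_two]
    refine ENNReal.ofReal_le_ofReal (inner_inv_pow_le_two_mul (isPositive_resOp hm _)
      (isPositive_resOp hm _) (resOp_cons hm _ _) ?_)
    have h1 := inner_resOp_le hm (fun i => ξ (z i)) (ξ x)
    have h2 := hK x
    have h3 : (0 : ℝ) ≤ 2 * ((q + 1 : ℕ) : ℝ) := by positivity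
    have h4 := mul_le_mul_of_nonneg_left (h1.trans h2) h3
    refine le_of_mul_le_mul_left ?_ hm
    linarith
  calc ((n + 1 : ℕ) : ℝ≥0∞) * resMoment ν ξ m (q + 1) n
      ≤ ((n + 1 : ℕ) : ℝ≥0∞) * ∫⁻ x, ∫⁻ z, 2 * ENNReal.ofReal (inner ℝ (ξ x)
          ((resOp m (Fin.cons (ξ x) fun i => ξ (z i) : Fin (n + 1) → H) ^ (q + 1)) (ξ x)))
          ∂(Measure.pi fun _ : Fin n => ν) ∂ν := by
        gcongr
        exact lintegral_mono fun x => lintegral_mono fun z => hpt x z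
    _ = 2 * ∫⁻ z, ∑ k, ENNReal.ofReal
          (inner ℝ (ξ (z k)) ((resOp m (fun i => ξ (z i)) ^ (q + 1)) (ξ (z k))))
          ∂(Measure.pi fun _ : Fin (n + 1) => ν) := by
        rw [lintegral_sum_inner_pow ν hξ (continuous_resOp hm (n + 1))
          (fun y σ => by rw [resOp, regOp_comp_equiv, resOp])]
        simp_rw [lintegral_const_mul' 2 _ ENNReal.ofNat_ne_top]
        ring
    _ ≤ 2 * resMoment ν ξ m q (n + 1) := by
        rw [resMoment_eq hξ hm]
        gcongr with z
        exact sum_inner_resOp_pow_le hξ hK hiso hP hm q z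

theorem pow_mul_resMoment_le (hξ : Measurable ξ) {K : ℝ} (hK : ∀ x, ‖ξ x‖ ^ 2 ≤ K)
    {P : H →L[ℝ] H} (hiso : ∀ u v, ∫ x, inner ℝ (ξ x) u * inner ℝ (ξ x) v ∂ν = inner ℝ u (P v))
    (hP : ∀ x, P (ξ x) = ξ x) {m : ℝ} (hm : 0 < m) {q : ℕ} (hq : 2 * (q : ℝ) * K ≤ m) (n : ℕ) :
    (n : ℝ≥0∞) ^ q * resMoment ν ξ m q n ≤ 2 ^ q * ∫⁻ x, ENNReal.ofReal (‖ξ x‖ ^ 2) ∂ν := by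
  induction q generalizing n with
  | zero =>
    simp only [resMoment, pow_zero, one_mul, one_apply_eq_self, real_inner_self_eq_norm_sq,
      lintegral_const, measure_univ, mul_one, le_refl]
  | succ q ih =>
    obtain ⟨x0⟩ : Nonempty Ω := nonempty_of_isProbabilityMeasure ν
    have hK0 : 0 ≤ K := (sq_nonneg _).trans (hK x0)
    have hq' : 2 * (q : ℝ) * K ≤ m := by
      refine le_trans ?_ hq
      push_cast
      nlinarith
    calc (n : ℝ≥0∞) ^ (q + 1) * resMoment ν ξ m (q + 1) n
        ≤ ((n + 1 : ℕ) : ℝ≥0∞) ^ (q + 1) * resMoment ν ξ m (q + 1) n := by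
          gcongr; exact Nat.le_succ n
      _ = ((n + 1 : ℕ) : ℝ≥0∞) ^ q * (((n + 1 : ℕ) : ℝ≥0∞) * resMoment ν ξ m (q + 1) n) := by ring
      _ ≤ ((n + 1 : ℕ) : ℝ≥0∞) ^ q * (2 * resMoment ν ξ m q (n + 1)) := by
          exact mul_le_mul' le_rfl (succ_mul_resMoment_le hξ hK hiso hP hm hq n)
      _ = 2 * (((n + 1 : ℕ) : ℝ≥0∞) ^ q * resMoment ν ξ m q (n + 1)) := by ring
      _ ≤ 2 * (2 ^ q * ∫⁻ x, ENNReal.ofReal (‖ξ x‖ ^ 2) ∂ν) := mul_le_mul' le_rfl (ih hq' (n + 1))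
      _ = _ := by ring

/-- A small eigenvalue of the sum of rank-one operators makes the trace of `A^{2r}`
on the range of `P` large. -/
theorem le_lintegral_inner_resOp_pow (hξ : Measurable ξ) {K : ℝ} (hK : ∀ x, ‖ξ x‖ ^ 2 ≤ K)
    {P : H →L[ℝ] H} (hiso : ∀ u v, ∫ x, inner ℝ (ξ x) u * inner ℝ (ξ x) v ∂ν = inner ℝ u (P v))
    {m t : ℝ} (hm : 0 < m) {n : ℕ} (y : Fin n → H) {u : H} (hu : ‖u‖ = 1) (hPu : P u = u)
    (hS : inner ℝ u (sampleOp y u) ≤ t) (r : ℕ) :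
    ENNReal.ofReal (((m + t)⁻¹) ^ (2 * r))
      ≤ ∫⁻ x, ENNReal.ofReal (inner ℝ (ξ x) ((resOp m y ^ (2 * r)) (ξ x))) ∂ν := by
  have hA := isPositive_resOp hm y
  have hM := isPositive_regOp hm.le y
  rw [← ofReal_integral_eq_lintegral_ofReal (integrable_inner_apply hξ hK _)
      (ae_of_all _ fun x => inner_pow_nonneg hA _ _)]
  refine ENNReal.ofReal_le_ofReal ?_
  set w := (resOp m y ^ r) u with hw
  have hsym : ∀ u v : H, inner ℝ (P u) v = inner ℝ u (P v) := fun u v => by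
    rw [real_inner_comm, ← hiso, ← hiso]
    exact integral_congr_ae (ae_of_all _ fun x => mul_comm _ _)
  have hPpos : P.IsPositive := by
    refine (ContinuousLinearMap.isPositive_iff _).2 ⟨hsym, fun v => ?_⟩
    rw [hsym, ← hiso]
    exact integral_nonneg fun x => mul_self_nonneg _
  have hMu : inner ℝ u (regOp m y u) ≤ m + t := by
    rw [regOp_apply, inner_add_right, real_inner_smul_right, real_inner_self_eq_norm_sq, hu]
    linarith
  have hMu0 : m ≤ inner ℝ u (regOp m y u) := by simpa [hu] using mul_norm_sq_le_regOp m y u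
  -- Cauchy–Schwarz for the form of `A`, applied to `u` and `M u`
  have h1 : (m + t)⁻¹ ≤ inner ℝ u (resOp m y u) := by
    have := inner_sq_le_of_isPositive hA u (regOp m y u)
    rw [resOp_regOp hm, real_inner_self_eq_norm_sq, hu, hM.inner_left_eq_inner_right] at this
    rw [inv_le_iff_one_le_mul₀ (by linarith)]
    have h0 := hA.inner_nonneg_right u
    nlinarith
  have h2 : (m + t)⁻¹ ^ r ≤ inner ℝ u w := by
    refine (pow_le_pow_left₀ (by have := hm.trans_le (hMu0.trans hMu); positivity) h1 r).trans ?_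
    have := pow_le_of_logConvex (inner_pow_nonneg hA u) (inner_pow_logConvex hA u)
      (by simp [hu]) r
    rwa [pow_one] at this
  calc ((m + t)⁻¹) ^ (2 * r) = ((m + t)⁻¹ ^ r) ^ 2 := by ring
    _ ≤ inner ℝ u w ^ 2 := by
        have := hm.trans_le (hMu0.trans hMu)
        gcongr
    _ = inner ℝ u (P w) ^ 2 := by rw [← hsym, hPu]
    _ ≤ inner ℝ u (P u) * inner ℝ w (P w) := inner_sq_le_of_isPositive hPpos u w
    _ = ∫ x, inner ℝ (ξ x) w * inner ℝ (ξ x) w ∂ν := by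
        rw [hPu, real_inner_self_eq_norm_sq, hu, hiso]; ring
    _ ≤ ∫ x, inner ℝ (ξ x) ((resOp m y ^ (2 * r)) (ξ x)) ∂ν := by
        refine integral_mono (integrable_inner_mul_inner_of_bdd hξ hK w w)
          (integrable_inner_apply hξ hK _) fun x => ?_
        simp only
        rw [inner_pow_two_mul hA, hw, ← inner_pow_left hA, ← sq, ← sq_abs]
        gcongr
        refine (abs_real_inner_le_norm _ _).trans ?_
        rw [hu, mul_one]

/-- The smallest eigenvalue of a sum of rank-one operators: if `E ξ ⊗ ξ = P` is a projection and
`‖ξ‖² ≤ K`, then `∑ i, ξ_i ⊗ ξ_i ≥ n / 8` on the range of `P`, outside an event of probability at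
most `4^{-r} E‖ξ‖²`, as soon as `n ≥ 32 r K`. -/
theorem measure_exists_inner_sampleOp_lt (hξ : Measurable ξ) {K : ℝ} (hK : ∀ x, ‖ξ x‖ ^ 2 ≤ K)
    (hK0 : 0 < K) {P : H →L[ℝ] H}
    (hiso : ∀ u v, ∫ x, inner ℝ (ξ x) u * inner ℝ (ξ x) v ∂ν = inner ℝ u (P v))
    (hP : ∀ x, P (ξ x) = ξ x) {r n : ℕ} (hr : 1 ≤ r) (hn : 32 * r * K ≤ n) {V : ℝ}
    (hV : ∫⁻ x, ENNReal.ofReal (‖ξ x‖ ^ 2) ∂ν ≤ ENNReal.ofReal V) :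
    (Measure.pi fun _ : Fin n => ν) {z | ∃ u : H, ‖u‖ = 1 ∧ P u = u ∧
        inner ℝ u (sampleOp (fun i => ξ (z i)) u) < n / 8} ≤ ENNReal.ofReal (V * (1 / 4) ^ r) := by
  set m : ℝ := 4 * r * K with hmdef
  have hr0 : (0 : ℝ) < r := by exact_mod_cast hr
  have hm : 0 < m := by positivity
  have hn0 : (0 : ℝ) < n := lt_of_lt_of_le (by positivity) hn
  set s : ℝ := (m + n / 8)⁻¹ with hs
  have hs0 : 0 < s := by positivity
  have hsn : 4 / n ≤ s := by
    rw [hs, div_le_iff₀ hn0, inv_mul_eq_div, le_div_iff₀ (by positivity)]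
    linarith
  set F : (Fin n → Ω) → ℝ≥0∞ := fun z => ∫⁻ x, ENNReal.ofReal
    (inner ℝ (ξ x) ((resOp m (fun i => ξ (z i)) ^ (2 * r)) (ξ x))) ∂ν with hF
  have hFm : Measurable F := by
    refine Measurable.lintegral_prod_right' (f := fun p : (Fin n → Ω) × Ω => ENNReal.ofReal
      (inner ℝ (ξ p.2) ((resOp m (fun i => ξ (p.1 i)) ^ (2 * r)) (ξ p.2)))) ?_
    exact measurable_inner_pow (continuous_resOp hm n) _ (hξ.comp measurable_snd)
      (measurable_pi_lambda _ fun i => hξ.comp ((measurable_pi_apply i).comp measurable_fst))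
  have hsub : {z : Fin n → Ω | ∃ u : H, ‖u‖ = 1 ∧ P u = u ∧
        inner ℝ u (sampleOp (fun i => ξ (z i)) u) < n / 8}
      ⊆ {z | ENNReal.ofReal (s ^ (2 * r)) ≤ F z} := by
    rintro z ⟨u, hu, hPu, hS⟩
    exact le_lintegral_inner_resOp_pow hξ hK hiso hm _ hu hPu hS.le r
  -- Markov's inequality for the trace `F` of `A^{2r}`, with `n s ≥ 4` against the growth `2^{2r}`
  have hq : 2 * ((2 * r : ℕ) : ℝ) * K ≤ m := by rw [hmdef]; push_cast; linarith
  have hmom := pow_mul_resMoment_le hξ hK hiso hP hm hq n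
  rw [resMoment_eq hξ hm] at hmom
  change (n : ℝ≥0∞) ^ (2 * r) * ∫⁻ z, F z ∂(Measure.pi fun _ : Fin n => ν) ≤ _ at hmom
  have hmark := mul_meas_ge_le_lintegral (μ := Measure.pi fun _ : Fin n => ν) hFm
    (ENNReal.ofReal (s ^ (2 * r)))
  set p := (Measure.pi fun _ : Fin n => ν) {z | ENNReal.ofReal (s ^ (2 * r)) ≤ F z} with hp
  refine (measure_mono hsub).trans ?_
  change p ≤ _
  have h1 : ENNReal.ofReal (4 ^ (2 * r)) * p ≤ ENNReal.ofReal (2 ^ (2 * r) * V) := by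
    calc ENNReal.ofReal (4 ^ (2 * r)) * p
        ≤ ENNReal.ofReal (n ^ (2 * r) * s ^ (2 * r)) * p := by
          gcongr
          rw [← mul_pow]
          gcongr
          rwa [div_le_iff₀' hn0] at hsn
      _ = (n : ℝ≥0∞) ^ (2 * r) * (ENNReal.ofReal (s ^ (2 * r)) * p) := by
          rw [ENNReal.ofReal_mul (by positivity), ENNReal.ofReal_pow (Nat.cast_nonneg n),
            ENNReal.ofReal_natCast, mul_assoc]
      _ ≤ (n : ℝ≥0∞) ^ (2 * r) * ∫⁻ z, F z ∂(Measure.pi fun _ : Fin n => ν) := by gcongr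
      _ ≤ _ := hmom
      _ ≤ 2 ^ (2 * r) * ENNReal.ofReal V := by gcongr
      _ = _ := by
          rw [ENNReal.ofReal_mul (by positivity), ENNReal.ofReal_pow zero_le_two,
            ENNReal.ofReal_ofNat]
  have h4 : (0 : ℝ) < 4 ^ (2 * r) := by positivity
  rw [mul_comm, ← ENNReal.le_div_iff_mul_le (Or.inl (by simp)) (Or.inl (by simp)),
    ← ENNReal.ofReal_div_of_pos h4] at h1
  refine h1.trans (ENNReal.ofReal_le_ofReal (le_of_eq ?_))
  rw [pow_mul, pow_mul, mul_comm, mul_div_assoc, ← div_pow]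
  norm_num

end Lower

section Upper

variable {H : Type*} [NormedAddCommGroup H] [InnerProductSpace ℝ H] [CompleteSpace H]
  [TopologicalSpace.SeparableSpace H] [MeasurableSpace H] [BorelSpace H]
  {Ω : Type*} [MeasurableSpace Ω] {ν : Measure Ω} [IsProbabilityMeasure ν] {ξ : Ω → H}

/-- The mean of `⟨ξ, M^{2r} ξ⟩` with `M = m + ∑ i, ξ_i ⊗ ξ_i`, for `ξ, ξ_1, …, ξ_n` independent and
identically distributed. -/
def powMoment (ν : Measure Ω) (ξ : Ω → H) (m : ℝ) (r n : ℕ) : ℝ≥0∞ :=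
  ∫⁻ x, ∫⁻ z, ENNReal.ofReal (inner ℝ (ξ x) ((regOp m (fun i => ξ (z i)) ^ (2 * r)) (ξ x)))
    ∂(Measure.pi fun _ : Fin n => ν) ∂ν

/-- The mean of `∑ k, ⟨ξ_k, M^{2r} ξ_k⟩` with `M = m + ∑ i, ξ_i ⊗ ξ_i`. -/
def samplePowMoment (ν : Measure Ω) (ξ : Ω → H) (m : ℝ) (r n : ℕ) : ℝ≥0∞ :=
  ∫⁻ z, ∑ k, ENNReal.ofReal
    (inner ℝ (ξ (z k)) ((regOp m (fun i => ξ (z i)) ^ (2 * r)) (ξ (z k))))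
    ∂(Measure.pi fun _ : Fin n => ν)

theorem powMoment_eq (hξ : Measurable ξ) (m : ℝ) (r n : ℕ) :
    powMoment ν ξ m r n
      = ∫⁻ z, ∫⁻ x, ENNReal.ofReal (inner ℝ (ξ x) ((regOp m (fun i => ξ (z i)) ^ (2 * r)) (ξ x)))
        ∂ν ∂(Measure.pi fun _ : Fin n => ν) := by
  refine lintegral_lintegral_swap (Measurable.aemeasurable ?_)
  exact measurable_inner_pow (continuous_regOp m n) _ (hξ.comp measurable_fst)
    (measurable_pi_lambda _ fun i => hξ.comp ((measurable_pi_apply i).comp measurable_snd))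

/-- By exchangeability and decoupling, the trace of `S M^{2r}` is controlled by the mean for an
independent copy. -/
theorem samplePowMoment_succ_le (hξ : Measurable ξ) {K : ℝ} (hK : ∀ x, ‖ξ x‖ ^ 2 ≤ K) {m : ℝ}
    (hm : 0 ≤ m) {r : ℕ} (hr : 4 * r * K ≤ m) (n : ℕ) :
    samplePowMoment ν ξ m r (n + 1) ≤ 2 * ((n + 1 : ℕ) : ℝ≥0∞) * powMoment ν ξ m r n := by
  have hpt : ∀ x (z : Fin n → Ω),
      ENNReal.ofReal (inner ℝ (ξ x)
        ((regOp m (Fin.cons (ξ x) fun i => ξ (z i) : Fin (n + 1) → H) ^ (2 * r)) (ξ x)))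
      ≤ 2 * ENNReal.ofReal (inner ℝ (ξ x) ((regOp m (fun i => ξ (z i)) ^ (2 * r)) (ξ x))) := by
    intro x z
    rw [← ENNReal.ofReal_ofNat 2, ← ENNReal.ofReal_mul zero_le_two]
    refine ENNReal.ofReal_le_ofReal (inner_pow_update_le_two_mul (isPositive_regOp hm _)
      (isPositive_regOp hm _) (regOp_cons m _ _) (mul_norm_sq_le_regOp m _) (hK x) ?_)
    push_cast
    linarith
  rw [samplePowMoment, lintegral_sum_inner_pow ν hξ (continuous_regOp m (n + 1))
    (regOp_comp_equiv m), mul_comm 2 ((n + 1 : ℕ) : ℝ≥0∞), mul_assoc, powMoment]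
  refine mul_le_mul' le_rfl ?_
  rw [← lintegral_const_mul' 2 _ ENNReal.ofNat_ne_top]
  refine lintegral_mono fun x => ?_
  rw [← lintegral_const_mul' 2 _ ENNReal.ofNat_ne_top]
  exact lintegral_mono fun z => hpt x z

/-- From `M² - m² = S (S + 2m) ≤ S M² / m + m S`, where `M = m + S`. -/
theorem inner_regOp_pow_succ_le {m : ℝ} (hm : 0 < m) {n : ℕ} (y : Fin n → H) (r : ℕ) (v : H) :
    inner ℝ v ((regOp m y ^ (2 * (r + 1))) v)
      ≤ m ^ 2 * inner ℝ v ((regOp m y ^ (2 * r)) v)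
        + m⁻¹ * ∑ k, inner ℝ v ((regOp m y ^ (r + 1)) (y k)) ^ 2
        + m * ∑ k, inner ℝ v ((regOp m y ^ r) (y k)) ^ 2 := by
  have hM := isPositive_regOp hm.le y
  have hS := isPositive_sampleOp y
  have hsum : ∀ j : ℕ, ∑ k, inner ℝ v ((regOp m y ^ j) (y k)) ^ 2
      = inner ℝ ((regOp m y ^ j) v) (sampleOp y ((regOp m y ^ j) v)) := fun j => by
    rw [inner_sampleOp_self]
    refine Finset.sum_congr rfl fun k _ => ?_
    rw [← inner_pow_left hM, real_inner_comm]
  rw [hsum, hsum, inner_pow_two_mul hM, inner_pow_two_mul hM, pow_succ_apply']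
  set w := (regOp m y ^ r) v
  rw [regOp_apply]
  set s := sampleOp y w with hs
  have h1 : inner ℝ s (sampleOp y w) = ‖s‖ ^ 2 := by rw [← hs, real_inner_self_eq_norm_sq]
  have h2 : 0 ≤ inner ℝ s (sampleOp y s) := hS.inner_nonneg_right s
  have h3 : inner ℝ w (sampleOp y s) = ‖s‖ ^ 2 := by
    rw [← hS.inner_left_eq_inner_right, ← hs, real_inner_self_eq_norm_sq]
  have h4 : 0 ≤ inner ℝ w s := hS.inner_nonneg_right w
  rw [norm_add_sq_real, norm_smul, map_add, map_smul, inner_add_left, inner_add_right,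
    inner_add_right, real_inner_smul_left, real_inner_smul_right, real_inner_smul_right,
    real_inner_smul_left, real_inner_smul_left, h1, h3, ← hs, mul_pow, Real.norm_eq_abs, sq_abs]
  have h5 : m⁻¹ * (m * (m * inner ℝ w s) + m * ‖s‖ ^ 2 + (m * ‖s‖ ^ 2 + inner ℝ s (sampleOp y s)))
      = m * inner ℝ w s + 2 * ‖s‖ ^ 2 + m⁻¹ * inner ℝ s (sampleOp y s) := by
    field_simp
    ring
  have h6 : 0 ≤ m⁻¹ * inner ℝ s (sampleOp y s) := by positivity
  nlinarith [sq_nonneg ‖s‖]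

theorem powMoment_succ_le (hξ : Measurable ξ) {μ : ℝ} (hμ : 0 ≤ μ)
    (hmom : ∀ v, ∫⁻ x, ENNReal.ofReal (inner ℝ (ξ x) v ^ 2) ∂ν ≤ ENNReal.ofReal (μ * ‖v‖ ^ 2))
    {m : ℝ} (hm : 0 < m) (r n : ℕ) :
    powMoment ν ξ m (r + 1) n ≤ ENNReal.ofReal (m ^ 2) * powMoment ν ξ m r n
      + ENNReal.ofReal (m⁻¹ * μ) * samplePowMoment ν ξ m (r + 1) n
      + ENNReal.ofReal (m * μ) * samplePowMoment ν ξ m r n := by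
  have := UniformSpace.secondCountable_of_separable H
  have hmeas : ∀ v : H, Measurable fun x => ENNReal.ofReal (inner ℝ (ξ x) v ^ 2) := fun v =>
    ((hξ.inner measurable_const).pow_const 2).ennreal_ofReal
  have hsum : ∀ (y : Fin n → H) (j : ℕ),
      ∫⁻ x, ∑ k, ENNReal.ofReal (inner ℝ (ξ x) ((regOp m y ^ j) (y k)) ^ 2) ∂ν
      ≤ ENNReal.ofReal μ * ∑ k, ENNReal.ofReal (inner ℝ (y k) ((regOp m y ^ (2 * j)) (y k))) := by
    intro y j
    rw [lintegral_finsetSum _ fun k _ => hmeas _, Finset.mul_sum]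
    refine Finset.sum_le_sum fun k _ => (hmom _).trans (le_of_eq ?_)
    rw [ENNReal.ofReal_mul hμ, inner_pow_two_mul (isPositive_regOp hm.le y)]
  have hmS : ∀ j, Measurable fun z : Fin n → Ω => ∑ k, ENNReal.ofReal
      (inner ℝ (ξ (z k)) ((regOp m (fun i => ξ (z i)) ^ (2 * j)) (ξ (z k)))) := fun j =>
    Finset.measurable_fun_sum _ fun k _ => measurable_inner_pow (continuous_regOp m n) _
      (hξ.comp (measurable_pi_apply k)) (measurable_pi_lambda _ fun i => hξ.comp
        (measurable_pi_apply i))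
  rw [powMoment_eq hξ, powMoment_eq hξ, samplePowMoment, samplePowMoment,
    ← lintegral_const_mul' _ _ ENNReal.ofReal_ne_top, ← lintegral_const_mul' _ _ ENNReal.ofReal_ne_top,
    ← lintegral_const_mul' _ _ ENNReal.ofReal_ne_top,
    ← lintegral_add_right _ ((hmS _).const_mul _), ← lintegral_add_right _ ((hmS _).const_mul _)]
  refine lintegral_mono fun z => ?_
  set y : Fin n → H := fun i => ξ (z i) with hy
  have hM := isPositive_regOp hm.le y
  calc ∫⁻ x, ENNReal.ofReal (inner ℝ (ξ x) ((regOp m y ^ (2 * (r + 1))) (ξ x))) ∂ν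
      ≤ ∫⁻ x, (ENNReal.ofReal (m ^ 2) * ENNReal.ofReal (inner ℝ (ξ x) ((regOp m y ^ (2 * r)) (ξ x)))
        + ENNReal.ofReal m⁻¹ *
          ∑ k, ENNReal.ofReal (inner ℝ (ξ x) ((regOp m y ^ (r + 1)) (y k)) ^ 2)
        + ENNReal.ofReal m *
          ∑ k, ENNReal.ofReal (inner ℝ (ξ x) ((regOp m y ^ r) (y k)) ^ 2)) ∂ν := by
        refine lintegral_mono fun x => ?_
        have h0 := inner_pow_nonneg hM (ξ x) (2 * r)
        rw [← ENNReal.ofReal_sum_of_nonneg fun k _ => sq_nonneg _,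
          ← ENNReal.ofReal_sum_of_nonneg fun k _ => sq_nonneg _, ← ENNReal.ofReal_mul (by positivity),
          ← ENNReal.ofReal_mul (by positivity), ← ENNReal.ofReal_mul (by positivity),
          ← ENNReal.ofReal_add (by positivity) (by positivity),
          ← ENNReal.ofReal_add (by positivity) (by positivity)]
        exact ENNReal.ofReal_le_ofReal (inner_regOp_pow_succ_le hm y r (ξ x))
    _ = ENNReal.ofReal (m ^ 2) *
          ∫⁻ x, ENNReal.ofReal (inner ℝ (ξ x) ((regOp m y ^ (2 * r)) (ξ x))) ∂ν
        + ENNReal.ofReal m⁻¹ *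
          ∫⁻ x, ∑ k, ENNReal.ofReal (inner ℝ (ξ x) ((regOp m y ^ (r + 1)) (y k)) ^ 2) ∂ν
        + ENNReal.ofReal m *
          ∫⁻ x, ∑ k, ENNReal.ofReal (inner ℝ (ξ x) ((regOp m y ^ r) (y k)) ^ 2) ∂ν := by
        have hms : ∀ j, Measurable fun x => ∑ k, ENNReal.ofReal
            (inner ℝ (ξ x) ((regOp m y ^ j) (y k)) ^ 2) := fun j =>
          Finset.measurable_fun_sum _ fun k _ => hmeas _
        rw [lintegral_add_right _ ((hms _).const_mul _), lintegral_add_right _ ((hms _).const_mul _),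
          lintegral_const_mul' _ _ ENNReal.ofReal_ne_top,
          lintegral_const_mul' _ _ ENNReal.ofReal_ne_top,
          lintegral_const_mul' _ _ ENNReal.ofReal_ne_top]
    _ ≤ _ := by
        rw [ENNReal.ofReal_mul (p := m⁻¹) (by positivity), ENNReal.ofReal_mul (p := m) hm.le,
          mul_assoc, mul_assoc]
        exact add_le_add (add_le_add le_rfl (mul_le_mul' le_rfl (hsum y _)))
          (mul_le_mul' le_rfl (hsum y _))

/-- The recursions for the two moments combine to geometric growth with ratio `2 m²`. The choice
`m = 8 N μ` makes the contribution of the sample moments at most `3/4 m²`. -/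
theorem samplePowMoment_le (hξ : Measurable ξ) {K : ℝ} (hK : ∀ x, ‖ξ x‖ ^ 2 ≤ K) {μ : ℝ}
    (hμ : 0 < μ)
    (hmom : ∀ v, ∫⁻ x, ENNReal.ofReal (inner ℝ (ξ x) v ^ 2) ∂ν ≤ ENNReal.ofReal (μ * ‖v‖ ^ 2))
    {V : ℝ} (hV : ∫⁻ x, ENNReal.ofReal (‖ξ x‖ ^ 2) ∂ν ≤ ENNReal.ofReal V) (hV0 : 0 ≤ V)
    {m : ℝ} {N : ℕ} (hN : 1 ≤ N) (hm : m = 8 * N * μ) {r : ℕ} (hr : 4 * r * K ≤ m) {n : ℕ}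
    (hn : n ≤ N) :
    samplePowMoment ν ξ m r n ≤ ENNReal.ofReal (2 * N * V * (2 * m ^ 2) ^ r) := by
  obtain ⟨x0⟩ : Nonempty Ω := nonempty_of_isProbabilityMeasure ν
  have hK0 : 0 ≤ K := (sq_nonneg _).trans (hK x0)
  have hN0 : (0 : ℝ) < N := by exact_mod_cast hN
  have hm0 : 0 < m := by rw [hm]; positivity
  induction n generalizing r with
  | zero => simp [samplePowMoment]
  | succ n ih =>
    have ih' : ∀ {r : ℕ}, 4 * r * K ≤ m → samplePowMoment ν ξ m r n
        ≤ ENNReal.ofReal (2 * N * V * (2 * m ^ 2) ^ r) := fun h => ih h (by omega)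
    have he : powMoment ν ξ m r n ≤ ENNReal.ofReal (V * (2 * m ^ 2) ^ r) := by
      clear ih
      induction r with
      | zero =>
        simp only [powMoment, mul_zero, pow_zero, mul_one, one_apply_eq_self,
          real_inner_self_eq_norm_sq, lintegral_const, measure_univ]
        exact hV
      | succ r ihr =>
        have hr' : 4 * (r : ℝ) * K ≤ m := by
          refine le_trans ?_ hr
          push_cast
          nlinarith
        refine (powMoment_succ_le hξ hμ.le hmom hm0 r n).trans ?_
        calc _ ≤ ENNReal.ofReal (m ^ 2) * ENNReal.ofReal (V * (2 * m ^ 2) ^ r)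
              + ENNReal.ofReal (m⁻¹ * μ) * ENNReal.ofReal (2 * N * V * (2 * m ^ 2) ^ (r + 1))
              + ENNReal.ofReal (m * μ) * ENNReal.ofReal (2 * N * V * (2 * m ^ 2) ^ r) :=
              add_le_add (add_le_add (mul_le_mul' le_rfl (ihr hr'))
                (mul_le_mul' le_rfl (ih' hr))) (mul_le_mul' le_rfl (ih' hr'))
          _ = ENNReal.ofReal (m ^ 2 * (V * (2 * m ^ 2) ^ r)
              + m⁻¹ * μ * (2 * N * V * (2 * m ^ 2) ^ (r + 1))
              + m * μ * (2 * N * V * (2 * m ^ 2) ^ r)) := by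
              rw [ENNReal.ofReal_add (by positivity) (by positivity),
                ENNReal.ofReal_add (by positivity) (by positivity),
                ENNReal.ofReal_mul (p := m ^ 2) (by positivity),
                ENNReal.ofReal_mul (p := m⁻¹ * μ) (by positivity),
                ENNReal.ofReal_mul (p := m * μ) (by positivity)]
          _ ≤ _ := by
              refine ENNReal.ofReal_le_ofReal ?_
              have h0 : 0 ≤ V * (2 * m ^ 2) ^ r := by positivity
              have h1 : m⁻¹ * μ * (2 * N * V * (2 * m ^ 2) ^ (r + 1))
                  = (4 * N * μ * m) * (V * (2 * m ^ 2) ^ r) := by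
                rw [pow_succ]; field_simp; ring
              rw [h1, pow_succ (2 * m ^ 2) r]
              have h2 : N * μ = m / 8 := by rw [hm]; ring
              have h3 : m ^ 2 * (V * (2 * m ^ 2) ^ r) + 4 * N * μ * m * (V * (2 * m ^ 2) ^ r)
                  + m * μ * (2 * N * V * (2 * m ^ 2) ^ r)
                  = (m ^ 2 + 6 * (N * μ) * m) * (V * (2 * m ^ 2) ^ r) := by ring
              rw [h3, h2]
              nlinarith [mul_nonneg (sq_nonneg m) h0]
    refine (samplePowMoment_succ_le hξ hK hm0.le hr n).trans ?_
    refine (mul_le_mul' le_rfl he).trans ?_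
    rw [← ENNReal.ofReal_ofNat 2, ← ENNReal.ofReal_natCast, ← ENNReal.ofReal_mul zero_le_two,
      ← ENNReal.ofReal_mul (by positivity)]
    refine ENNReal.ofReal_le_ofReal ?_
    have : ((n + 1 : ℕ) : ℝ) ≤ N := by exact_mod_cast hn
    rw [← mul_assoc]
    gcongr

/-- The largest eigenvalue of a sum of rank-one operators: if `E⟨ξ, v⟩² ≤ μ ‖v‖²` and
`‖ξ‖² ≤ K`, then `∑ i, ξ_i ⊗ ξ_i ≤ 8 n μ` outside an event of probability at most
`2^{-r} E‖ξ‖² / (4 μ)`, as soon as `2 n μ ≥ r K`. -/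
theorem measure_exists_le_inner_sampleOp (hξ : Measurable ξ) {K : ℝ} (hK : ∀ x, ‖ξ x‖ ^ 2 ≤ K)
    {μ : ℝ} (hμ : 0 < μ)
    (hmom : ∀ v, ∫⁻ x, ENNReal.ofReal (inner ℝ (ξ x) v ^ 2) ∂ν ≤ ENNReal.ofReal (μ * ‖v‖ ^ 2))
    {V : ℝ} (hV : ∫⁻ x, ENNReal.ofReal (‖ξ x‖ ^ 2) ∂ν ≤ ENNReal.ofReal V) (hV0 : 0 ≤ V)
    {n r : ℕ} (hn : 1 ≤ n) (hr : r * K ≤ 2 * n * μ) :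
    (Measure.pi fun _ : Fin n => ν) {z | ∃ u : H, ‖u‖ = 1 ∧
        8 * n * μ ≤ inner ℝ u (sampleOp (fun i => ξ (z i)) u)}
      ≤ ENNReal.ofReal (V / (4 * μ) * (1 / 2) ^ r) := by
  set m : ℝ := 8 * n * μ with hm
  have hn0 : (0 : ℝ) < n := by exact_mod_cast hn
  have hm0 : 0 < m := by positivity
  set F : (Fin n → Ω) → ℝ≥0∞ := fun z => ∑ k, ENNReal.ofReal
    (inner ℝ (ξ (z k)) ((regOp m (fun i => ξ (z i)) ^ (2 * r)) (ξ (z k)))) with hF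
  have hFm : Measurable F :=
    Finset.measurable_fun_sum _ fun k _ => measurable_inner_pow (continuous_regOp m n) _
      (hξ.comp (measurable_pi_apply k)) (measurable_pi_lambda _ fun i => hξ.comp
        (measurable_pi_apply i))
  set s : ℝ := m * (2 * m) ^ (2 * r) with hs
  have hs0 : 0 < s := by positivity
  have hsub : {z : Fin n → Ω | ∃ u : H, ‖u‖ = 1 ∧
        m ≤ inner ℝ u (sampleOp (fun i => ξ (z i)) u)} ⊆ {z | ENNReal.ofReal s ≤ F z} := by
    rintro z ⟨u, hu, hS⟩
    set y : Fin n → H := fun i => ξ (z i) with hy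
    have hM := isPositive_regOp hm0.le y
    change ENNReal.ofReal s ≤ ∑ k, ENNReal.ofReal (inner ℝ (y k) ((regOp m y ^ (2 * r)) (y k)))
    rw [← ENNReal.ofReal_sum_of_nonneg fun k _ => inner_pow_nonneg hM _ _]
    refine ENNReal.ofReal_le_ofReal ?_
    have h1 : ∑ k, inner ℝ (y k) ((regOp m y ^ r) u) ^ 2
        ≤ ∑ k, inner ℝ (y k) ((regOp m y ^ (2 * r)) (y k)) := by
      refine Finset.sum_le_sum fun k _ => ?_
      rw [inner_pow_two_mul hM, ← inner_pow_left hM, ← sq_abs]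
      gcongr
      refine (abs_real_inner_le_norm _ _).trans ?_
      rw [hu, mul_one]
    refine le_trans ?_ h1
    rw [← inner_sampleOp_self, sampleOp_eq_sub m, inner_sub_right, real_inner_smul_right,
      ← inner_pow_two_mul_succ hM, ← inner_pow_add hM]
    -- `⟨u, M u⟩ ≥ 2 m` propagates to all powers by log-convexity
    set c : ℕ → ℝ := fun k => inner ℝ u ((regOp m y ^ k) u) with hc
    have hc0 : c 0 = 1 := by simp [hc, hu]
    have hcn : ∀ k, 0 ≤ c k := inner_pow_nonneg hM u
    have hcc : ∀ k, c (k + 1) ^ 2 ≤ c k * c (k + 2) := inner_pow_logConvex hM u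
    have hc1 : 2 * m ≤ c 1 := by
      simp only [hc, pow_one]
      rw [regOp_apply, inner_add_right, real_inner_smul_right, real_inner_self_eq_norm_sq, hu]
      linarith
    have h2 : (2 * m) ^ (2 * r) ≤ c (2 * r) :=
      (pow_le_pow_left₀ (by positivity) hc1 _).trans (pow_le_of_logConvex hcn hcc hc0 _)
    have h3 := mul_le_mul_of_logConvex hcn hcc (Nat.zero_le (2 * r))
    rw [hc0, one_mul, zero_add] at h3
    have h4 := mul_le_mul_of_nonneg_right hc1 (hcn (2 * r))
    have h5 := mul_le_mul_of_nonneg_left h2 hm0.le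
    change s ≤ c (2 * r + 1) - m * c (2 * r)
    linarith
  have hmark := mul_meas_ge_le_lintegral (μ := Measure.pi fun _ : Fin n => ν) hFm
    (ENNReal.ofReal s)
  refine (measure_mono hsub).trans ?_
  have hb := samplePowMoment_le hξ hK hμ hmom hV hV0 hn hm (r := r) (by linarith) le_rfl
  have h1 := hmark.trans hb
  rw [mul_comm, ← ENNReal.le_div_iff_mul_le (Or.inl (by simpa using hs0)) (Or.inl (by simp)),
    ← ENNReal.ofReal_div_of_pos hs0] at h1
  refine h1.trans (ENNReal.ofReal_le_ofReal (le_of_eq ?_))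
  have h8 : (8 : ℝ) * n = m / μ := by rw [hm]; field_simp
  have h2 : s = m * (2 * m ^ 2) ^ r * 2 ^ r := by
    rw [hs, pow_mul, mul_assoc m ((2 * m ^ 2) ^ r), ← mul_pow]
    congr 2
    ring
  rw [h2, div_pow, one_pow, show 2 * (n : ℝ) * V = m / μ * V / 4 by rw [← h8]; ring]
  field_simp

end Upper

/-! ### Comparison of the covariance with the empirical covariance -/

section Covariance

variable {H : Type*} [NormedAddCommGroup H] [InnerProductSpace ℝ H] [CompleteSpace H]

/-- The spectral weight `s^{-1/2}` on `[lam, ∞)`. -/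
def whitenWeight (lam s : ℝ) : ℝ := if lam ≤ s then (√s)⁻¹ else 0

/-- The indicator function of `[lam, ∞)`. -/
def highWeight (lam s : ℝ) : ℝ := if lam ≤ s then 1 else 0

/-- The indicator function of `(-∞, lam)`. -/
def lowWeight (lam s : ℝ) : ℝ := if lam ≤ s then 0 else 1

variable {T : H →L[ℝ] H} {lam : ℝ}

theorem abs_whitenWeight_le (hlam : 0 < lam) (s : ℝ) : |whitenWeight lam s| ≤ (√lam)⁻¹ := by
  unfold whitenWeight
  split_ifs with h
  · rw [abs_of_nonneg (by positivity)]
    have := Real.sqrt_pos.2 hlam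
    gcongr
  · simp

theorem abs_highWeight_le (lam s : ℝ) : |highWeight lam s| ≤ 1 := by
  unfold highWeight; split_ifs <;> simp

theorem abs_lowWeight_le (lam s : ℝ) : |lowWeight lam s| ≤ 1 := by
  unfold lowWeight; split_ifs <;> simp

theorem IsCompactPos.bddSpec_whiten (hT : IsCompactPos T) (hlam : 0 < lam) :
    BddSpec T (whitenWeight lam) :=
  hT.bddSpec (by positivity) fun s _ => abs_whitenWeight_le hlam s

theorem IsCompactPos.bddSpec_high (hT : IsCompactPos T) (lam : ℝ) : BddSpec T (highWeight lam) :=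
  hT.bddSpec zero_le_one fun s _ => abs_highWeight_le lam s

theorem IsCompactPos.bddSpec_low (hT : IsCompactPos T) (lam : ℝ) : BddSpec T (lowWeight lam) :=
  hT.bddSpec zero_le_one fun s _ => abs_lowWeight_le lam s

theorem IsCompactPos.specOp_high_add_low (hT : IsCompactPos T) (lam : ℝ) (v : H) :
    specOp T (highWeight lam) v + specOp T (lowWeight lam) v = v := by
  refine hT.ext fun s => ?_
  rw [eigenProj_add, hT.eigenProj_specOp (hT.bddSpec_high lam),
    hT.eigenProj_specOp (hT.bddSpec_low lam), ← add_smul, highWeight, lowWeight]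
  split_ifs <;> simp

theorem IsCompactPos.whiten_apply_whiten (hT : IsCompactPos T) (hlam : 0 < lam) (v : H) :
    specOp T (whitenWeight lam) (T (specOp T (whitenWeight lam) v))
      = specOp T (highWeight lam) v := by
  refine hT.ext fun s => ?_
  have hb := hT.bddSpec_whiten hlam
  rw [hT.eigenProj_specOp hb, hT.eigenProj_apply, hT.eigenProj_specOp hb,
    hT.eigenProj_specOp (hT.bddSpec_high lam), smul_smul, smul_smul]
  congr 1
  unfold whitenWeight highWeight
  split_ifs with h
  · have hs : 0 < √s := Real.sqrt_pos.2 (hlam.trans_le h)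
    nth_rewrite 2 [← Real.mul_self_sqrt (hlam.le.trans h)]
    field_simp
  · simp

theorem IsCompactPos.high_whiten (hT : IsCompactPos T) (hlam : 0 < lam) (v : H) :
    specOp T (highWeight lam) (specOp T (whitenWeight lam) v) = specOp T (whitenWeight lam) v := by
  have hb := hT.bddSpec_whiten hlam
  refine hT.specOp_comp (hT.bddSpec_high lam) hb hb (fun s _ => ?_) v
  unfold whitenWeight highWeight
  split_ifs <;> simp

theorem IsCompactPos.norm_sq_whiten_le (hT : IsCompactPos T) (hlam : 0 < lam) (v : H) :
    ‖specOp T (whitenWeight lam) v‖ ^ 2 ≤ 2 * ‖specOp T (invSqrtWeight lam) v‖ ^ 2 := by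
  refine hasSum_le (fun s => ?_) (hT.hasSum_norm_sq_specOp (hT.bddSpec_whiten hlam) v)
    ((hT.hasSum_norm_sq_specOp (hT.bddSpec_invSqrt hlam) v).mul_left 2)
  rw [← mul_assoc]
  refine hT.mul_norm_sq_le (f := fun s => whitenWeight lam s ^ 2)
    (g := fun s => 2 * invSqrtWeight lam s ^ 2) (fun s hs => ?_) s v
  rw [invSqrtWeight_sq hlam hs, whitenWeight]
  split_ifs with h
  · have hs' := hlam.trans_le h
    rw [inv_pow, Real.sq_sqrt hs, ← div_eq_mul_inv, inv_eq_one_div,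
      div_le_div_iff₀ hs' (by positivity)]
    linarith
  · rw [zero_pow two_ne_zero]; positivity

theorem IsCompactPos.norm_sq_low_le (hT : IsCompactPos T) (hlam : 0 < lam) (v : H) :
    ‖specOp T (lowWeight lam) v‖ ^ 2 ≤ 2 * lam * ‖specOp T (invSqrtWeight lam) v‖ ^ 2 := by
  refine hasSum_le (fun s => ?_) (hT.hasSum_norm_sq_specOp (hT.bddSpec_low lam) v)
    ((hT.hasSum_norm_sq_specOp (hT.bddSpec_invSqrt hlam) v).mul_left (2 * lam))
  rw [← mul_assoc]
  refine hT.mul_norm_sq_le (f := fun s => lowWeight lam s ^ 2)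
    (g := fun s => 2 * lam * invSqrtWeight lam s ^ 2) (fun s hs => ?_) s v
  rw [invSqrtWeight_sq hlam hs, lowWeight]
  split_ifs with h
  · rw [zero_pow two_ne_zero]; positivity
  · rw [← div_eq_mul_inv, le_div_iff₀ (by positivity)]
    linarith

theorem IsCompactPos.inner_low_le (hT : IsCompactPos T) (hlam : 0 < lam) (v : H) :
    inner ℝ (specOp T (lowWeight lam) v) (T (specOp T (lowWeight lam) v)) ≤ lam * ‖v‖ ^ 2 := by
  refine hasSum_le (fun s => ?_) (hT.hasSum_inner_apply _) ((hT.hasSum_norm_sq v).mul_left lam)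
  rw [hT.eigenProj_specOp (hT.bddSpec_low lam), norm_smul, mul_pow, ← mul_assoc]
  gcongr
  unfold lowWeight
  split_ifs with h
  · simpa using hlam.le
  · simpa using (not_le.1 h).le

theorem IsCompactPos.norm_sq_apply_whiten (hT : IsCompactPos T) (hlam : 0 < lam) (v : H) :
    ‖T (specOp T (whitenWeight lam) v)‖ ^ 2
      = inner ℝ (specOp T (highWeight lam) v) (T (specOp T (highWeight lam) v)) := by
  have hb := hT.bddSpec_whiten hlam
  refine (hT.hasSum_norm_sq _).unique ?_
  convert! hT.hasSum_inner_apply (specOp T (highWeight lam) v) using 1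
  funext s
  rw [hT.eigenProj_apply, hT.eigenProj_specOp hb, hT.eigenProj_specOp (hT.bddSpec_high lam),
    smul_smul, norm_smul, norm_smul, mul_pow, mul_pow, ← mul_assoc]
  congr 1
  unfold whitenWeight highWeight
  split_ifs with h
  · have hs : 0 < √s := Real.sqrt_pos.2 (hlam.trans_le h)
    rw [norm_one, one_pow, mul_one, Real.norm_eq_abs, sq_abs, mul_pow, inv_pow,
      Real.sq_sqrt (hlam.le.trans h)]
    have := hlam.trans_le h
    field_simp
  · simp

theorem IsCompactPos.inner_apply_eq_high_add_low (hT : IsCompactPos T) (lam : ℝ) (v : H) :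
    inner ℝ v (T v) = inner ℝ (specOp T (highWeight lam) v) (T (specOp T (highWeight lam) v))
      + inner ℝ (specOp T (lowWeight lam) v) (T (specOp T (lowWeight lam) v)) := by
  refine (hT.hasSum_inner_apply v).unique ?_
  convert! (hT.hasSum_inner_apply (specOp T (highWeight lam) v)).add
    (hT.hasSum_inner_apply (specOp T (lowWeight lam) v)) using 1
  funext s
  rw [hT.eigenProj_specOp (hT.bddSpec_high lam), hT.eigenProj_specOp (hT.bddSpec_low lam),
    norm_smul, norm_smul, highWeight, lowWeight]
  split_ifs <;> simp

end Covariance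

section EmpCov

variable {H : Type*} [NormedAddCommGroup H] [InnerProductSpace ℝ H]

theorem empCov_eq {n : ℕ} (z : Fin n → H × ℝ) :
    empCov z = (n : ℝ)⁻¹ • sampleOp (fun i => (z i).1) := rfl

theorem inner_empCov {n : ℕ} (z : Fin n → H × ℝ) (v : H) :
    inner ℝ v (empCov z v) = (n : ℝ)⁻¹ * ∑ i, inner ℝ (z i).1 v ^ 2 := by
  rw [empCov_eq, smul_apply, real_inner_smul_right, inner_sampleOp_self]

end EmpCov

section Comparison

variable {H : Type*} [NormedAddCommGroup H] [InnerProductSpace ℝ H] [CompleteSpace H]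
  [TopologicalSpace.SeparableSpace H] [MeasurableSpace H] [BorelSpace H]
  {ρ : Measure (H × ℝ)} [IsProbabilityMeasure ρ] {κ : ℝ}

theorem inner_sampleOp_specOp {T : H →L[ℝ] H} (hT : IsCompactPos T) {g : ℝ → ℝ}
    (hg : BddSpec T g) {n : ℕ} (y : Fin n → H) (v : H) :
    inner ℝ v (sampleOp (fun i => specOp T g (y i)) v) = ∑ i, inner ℝ (y i) (specOp T g v) ^ 2 := by
  rw [inner_sampleOp_self]
  exact Finset.sum_congr rfl fun i _ => by rw [hT.specOp_symm hg]

theorem lintegral_fst (ρ : Measure (H × ℝ)) {f : H → ℝ≥0∞} (hf : Measurable f) :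
    ∫⁻ z, f z.1 ∂ρ = ∫⁻ x, f x ∂ρ.fst :=
  (lintegral_map hf measurable_fst).symm

/-- Both parts of the spectrum of `T` are treated separately: above `lam` the whitened vectors
`T^{-1/2} x_i` are isotropic and the lower tail bound applies, below `lam` the upper one. -/
theorem measure_not_inner_covOp_le (hκ : 0 < κ) (hb : ∀ᵐ x ∂ρ.fst, ‖x‖ ≤ κ) {lam N : ℝ}
    (hlam : 0 < lam) (hN0 : 0 ≤ N) (hN : effDim (covOp ρ.fst) lam ≤ ENNReal.ofReal N) {r n : ℕ}
    (hr : 1 ≤ r) (hn : 32 * r * κ ^ 2 ≤ n * lam) :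
    (Measure.pi fun _ : Fin n => ρ) {z | (∀ i, ‖(z i).1‖ ≤ κ) ∧ ¬ ∀ v : H,
      inner ℝ v (covOp ρ.fst v) ≤ 16 * inner ℝ v (empCov z v) + 129 * lam * ‖v‖ ^ 2}
      ≤ ENNReal.ofReal (2 * N * (1 / 4) ^ r) + ENNReal.ofReal (N / 2 * (1 / 2) ^ r) := by
  have := UniformSpace.secondCountable_of_separable H
  have hT := isCompactPos_covOp hb
  set T := covOp ρ.fst with hTdef
  have hgA := hT.bddSpec_whiten hlam
  have hgB := hT.bddSpec_low lam
  have hgI := hT.bddSpec_invSqrt hlam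
  have hr0 : (0 : ℝ) < r := by exact_mod_cast hr
  have hn0 : (0 : ℝ) < n := by
    have : 0 < n * lam := lt_of_lt_of_le (by positivity) hn
    exact pos_of_mul_pos_left this hlam.le
  -- the inputs are truncated to make them bounded everywhere
  set X : H × ℝ → H := fun z => (Metric.closedBall (0 : H) κ).indicator id z.1 with hX
  have hXm : Measurable X :=
    (measurable_id.indicator Metric.isClosed_closedBall.measurableSet).comp measurable_fst
  have hXe : ∀ z : H × ℝ, ‖z.1‖ ≤ κ → X z = z.1 := fun z hz =>
    Set.indicator_of_mem (by simpa using hz) _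
  have hXb : ∀ z, ‖X z‖ ≤ κ := fun z => by
    by_cases hz : ‖z.1‖ ≤ κ
    · rwa [hXe z hz]
    · rw [hX]
      simp only
      rw [Set.indicator_of_notMem (by simpa using hz), norm_zero]
      exact hκ.le
  have hXae : ∀ᵐ z ∂ρ, X z = z.1 := (ae_norm_fst_le hb).mono hXe
  have hIm : ∀ g : ℝ → ℝ, Measurable fun z => specOp T g (X z) := fun g =>
    (specOp T g).continuous.measurable.comp hXm
  have hXmom : ∀ g : ℝ → ℝ, ∀ C : ℝ, 0 ≤ C →
      (∀ v, ‖specOp T g v‖ ^ 2 ≤ C * ‖specOp T (invSqrtWeight lam) v‖ ^ 2) →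
      ∫⁻ z, ENNReal.ofReal (‖specOp T g (X z)‖ ^ 2) ∂ρ ≤ ENNReal.ofReal (C * N) := by
    intro g C hC h
    have hm : Measurable fun x : H =>
        ENNReal.ofReal (‖specOp T (invSqrtWeight lam) x‖ ^ 2) := by fun_prop
    calc ∫⁻ z, ENNReal.ofReal (‖specOp T g (X z)‖ ^ 2) ∂ρ
        ≤ ∫⁻ z, ENNReal.ofReal C
            * ENNReal.ofReal (‖specOp T (invSqrtWeight lam) z.1‖ ^ 2) ∂ρ := by
          refine lintegral_mono_ae (hXae.mono fun z hz => ?_)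
          rw [hz, ← ENNReal.ofReal_mul hC]
          exact ENNReal.ofReal_le_ofReal (h _)
      _ = ENNReal.ofReal C * ∫⁻ x, ENNReal.ofReal (‖specOp T (invSqrtWeight lam) x‖ ^ 2) ∂ρ.fst := by
          rw [lintegral_const_mul' _ _ ENNReal.ofReal_ne_top, lintegral_fst ρ hm]
      _ ≤ ENNReal.ofReal C * ENNReal.ofReal N :=
          mul_le_mul' le_rfl ((lintegral_norm_sq_le_effDim hb hlam).trans hN)
      _ = _ := (ENNReal.ofReal_mul hC).symm
  have hiso : ∀ u v, ∫ z, inner ℝ (specOp T (whitenWeight lam) (X z)) u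
      * inner ℝ (specOp T (whitenWeight lam) (X z)) v ∂ρ
      = inner ℝ u (specOp T (highWeight lam) v) := by
    intro u v
    have h1 : ∀ᵐ z ∂ρ, inner ℝ (specOp T (whitenWeight lam) (X z)) u
        * inner ℝ (specOp T (whitenWeight lam) (X z)) v
        = inner ℝ (specOp T (whitenWeight lam) u) z.1
          * inner ℝ (specOp T (whitenWeight lam) v) z.1 := hXae.mono fun z hz => by
      rw [hz, hT.specOp_symm hgA, hT.specOp_symm hgA, real_inner_comm z.1,
        real_inner_comm z.1 (specOp T (whitenWeight lam) v)]
    rw [integral_congr_ae h1, ← hT.whiten_apply_whiten hlam, ← hT.specOp_symm hgA, hTdef,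
      inner_covOp hb]
    exact (integral_map (μ := ρ) measurable_fst.aemeasurable
      (integrable_inner_mul_inner hb _ _).aestronglyMeasurable).symm
  have hlow := measure_exists_inner_sampleOp_lt (ν := ρ) (n := n) (r := r)
    (ξ := fun z => specOp T (whitenWeight lam) (X z)) (K := κ ^ 2 / lam) (V := 2 * N)
    (hIm _) (fun z => by
      have h := hT.norm_specOp_le hgA (by positivity) (fun s _ => abs_whitenWeight_le hlam s) (X z)
      calc ‖specOp T (whitenWeight lam) (X z)‖ ^ 2 ≤ ((√lam)⁻¹ * ‖X z‖) ^ 2 := by gcongr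
        _ ≤ ((√lam)⁻¹ * κ) ^ 2 := by gcongr; exact hXb z
        _ = κ ^ 2 / lam := by rw [mul_pow, inv_pow, Real.sq_sqrt hlam.le]; ring)
    (by positivity) hiso (fun z => hT.high_whiten hlam _) hr
    (by rw [← mul_div_assoc, div_le_iff₀ hlam]; exact hn)
    (hXmom _ 2 zero_le_two fun v => hT.norm_sq_whiten_le hlam v)
  have hup := measure_exists_le_inner_sampleOp (ν := ρ) (n := n) (r := r)
    (ξ := fun z => specOp T (lowWeight lam) (X z)) (K := κ ^ 2) (V := 2 * lam * N) (μ := lam)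
    (hIm _) (fun z => by
      have h := hT.norm_specOp_le hgB zero_le_one (fun s _ => abs_lowWeight_le lam s) (X z)
      calc ‖specOp T (lowWeight lam) (X z)‖ ^ 2 ≤ (1 * ‖X z‖) ^ 2 := by gcongr
        _ ≤ κ ^ 2 := by rw [one_mul]; gcongr; exact hXb z)
    hlam (fun v => by
      have hm : Measurable fun x : H =>
        ENNReal.ofReal (inner ℝ (specOp T (lowWeight lam) v) x ^ 2) := by fun_prop
      calc ∫⁻ z, ENNReal.ofReal (inner ℝ (specOp T (lowWeight lam) (X z)) v ^ 2) ∂ρ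
          = ∫⁻ z, ENNReal.ofReal (inner ℝ (specOp T (lowWeight lam) v) z.1 ^ 2) ∂ρ := by
            refine lintegral_congr_ae (hXae.mono fun z hz => ?_)
            simp only
            rw [hz, hT.specOp_symm hgB, real_inner_comm]
        _ = ENNReal.ofReal (inner ℝ (specOp T (lowWeight lam) v)
              (T (specOp T (lowWeight lam) v))) := by
            rw [lintegral_fst ρ hm, lintegral_inner_sq hb]
        _ ≤ _ := ENNReal.ofReal_le_ofReal (hT.inner_low_le hlam v))
    (hXmom _ (2 * lam) (by positivity) fun v => hT.norm_sq_low_le hlam v) (by positivity)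
    (by exact_mod_cast hn0) (by nlinarith [sq_nonneg κ])
  have hV : 2 * lam * N / (4 * lam) = N / 2 := by field_simp; ring
  rw [hV] at hup
  refine le_trans (measure_mono ?_) ((measure_union_le _ _).trans (add_le_add hlow hup))
  rintro z ⟨hz, hbad⟩
  by_contra hgood
  refine hbad fun v => ?_
  simp only [Set.mem_union, not_or, Set.mem_ofPred_eq, not_exists, not_and, not_lt, not_le] at hgood
  obtain ⟨hg1, hg2⟩ := hgood
  have hXz : ∀ i, X (z i) = (z i).1 := fun i => hXe _ (hz i)
  simp only [hXz] at hg1 hg2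
  have h1 : ∀ w, specOp T (highWeight lam) w = w →
      n / 8 * ‖w‖ ^ 2 ≤ ∑ i, inner ℝ (z i).1 (specOp T (whitenWeight lam) w) ^ 2 := by
    intro w hw
    rcases eq_or_ne w 0 with rfl | hw0
    · simp
    have hw' : 0 < ‖w‖ := norm_pos_iff.2 hw0
    have h := hg1 (‖w‖⁻¹ • w) (by rw [norm_smul, norm_inv, norm_norm, inv_mul_cancel₀ hw'.ne'])
      (by rw [map_smul, hw])
    rw [inner_sampleOp_specOp hT hgA] at h
    simp only [map_smul, real_inner_smul_right, mul_pow, ← Finset.mul_sum, inv_pow] at h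
    rwa [inv_mul_eq_div, le_div_iff₀ (by positivity)] at h
  have h2 : ∀ w, ∑ i, inner ℝ (z i).1 (specOp T (lowWeight lam) w) ^ 2 ≤ 8 * n * lam * ‖w‖ ^ 2 := by
    intro w
    rcases eq_or_ne w 0 with rfl | hw0
    · simp
    have hw' : 0 < ‖w‖ := norm_pos_iff.2 hw0
    have h := hg2 (‖w‖⁻¹ • w) (by rw [norm_smul, norm_inv, norm_norm, inv_mul_cancel₀ hw'.ne'])
    rw [inner_sampleOp_specOp hT hgB] at h
    simp only [map_smul, real_inner_smul_right, mul_pow, ← Finset.mul_sum, inv_pow] at h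
    rw [inv_mul_eq_div, div_lt_iff₀ (by positivity)] at h
    exact h.le
  -- the lower bound is applied to the vector `T^{1/2} v1`, whitened to `v1`
  set v1 := specOp T (highWeight lam) v with hv1
  set v2 := specOp T (lowWeight lam) v with hv2
  have hw := h1 (T (specOp T (whitenWeight lam) v)) (by
    refine hT.ext fun s => ?_
    rw [hT.eigenProj_specOp (hT.bddSpec_high lam), hT.eigenProj_apply, hT.eigenProj_specOp hgA]
    simp only [smul_smul]
    congr 1
    unfold highWeight whitenWeight
    split_ifs <;> simp)
  rw [hT.whiten_apply_whiten hlam, hT.norm_sq_apply_whiten hlam, ← hv1] at hw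
  have hlo := h2 v
  rw [← hv2] at hlo
  have hsplit : ∑ i, inner ℝ (z i).1 v1 ^ 2
      ≤ 2 * ∑ i, inner ℝ (z i).1 v ^ 2 + 2 * ∑ i, inner ℝ (z i).1 v2 ^ 2 := by
    rw [Finset.mul_sum, Finset.mul_sum, ← Finset.sum_add_distrib]
    refine Finset.sum_le_sum fun i _ => ?_
    have : inner ℝ (z i).1 v = inner ℝ (z i).1 v1 + inner ℝ (z i).1 v2 := by
      rw [← inner_add_right, hT.specOp_high_add_low]
    rw [this]
    nlinarith [sq_nonneg (inner ℝ (z i).1 v1 + 2 * inner ℝ (z i).1 v2)]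
  rw [hT.inner_apply_eq_high_add_low lam v, inner_empCov, ← hv1, ← hv2]
  have h3 := hT.inner_low_le hlam v
  rw [← hv2] at h3
  set S := ∑ i, inner ℝ (z i).1 v ^ 2 with hS
  have h4 : inner ℝ v1 (T v1) ≤ 16 * ((n : ℝ)⁻¹ * S) + 128 * lam * ‖v‖ ^ 2 := by
    have h5 : n * inner ℝ v1 (T v1) ≤ n * (16 * ((n : ℝ)⁻¹ * S) + 128 * lam * ‖v‖ ^ 2) := by
      have : n * (16 * ((n : ℝ)⁻¹ * S) + 128 * lam * ‖v‖ ^ 2)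
          = 16 * S + 128 * n * lam * ‖v‖ ^ 2 := by field_simp
      rw [this]
      linarith
    exact le_of_mul_le_mul_left h5 hn0
  linarith

end Comparison

/-! ### The error of the estimator for a fixed sample -/

section Multiplier

variable {H : Type*} [NormedAddCommGroup H] [InnerProductSpace ℝ H] [CompleteSpace H]
  {L : H →L[ℝ] H} {C : ℝ}

theorem IsCompactPos.bddSpec_of_le (hL : IsCompactPos L)
    (hC : ∀ x, inner ℝ x (L x) ≤ C * ‖x‖ ^ 2) {g : ℝ → ℝ} {k : ℝ} (hk : 0 ≤ k)
    (h : ∀ s, 0 ≤ s → s ≤ C → |g s| ≤ k) : BddSpec L g :=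
  ⟨k, hk, fun s x hs => h s (hL.nonneg_of_ne hs)
    (not_lt.1 fun hlt => hs (eigenProj_eq_zero_of_gt hC hlt x))⟩

theorem BddSpec.mul {g h : ℝ → ℝ} (hg : BddSpec L g) (hh : BddSpec L h) :
    BddSpec L fun s => g s * h s := by
  obtain ⟨a, ha, hg⟩ := hg
  obtain ⟨b, hb, hh⟩ := hh
  refine ⟨a * b, mul_nonneg ha hb, fun s x hs => ?_⟩
  rw [abs_mul]
  exact mul_le_mul (hg s x hs) (hh s x hs) (abs_nonneg _) ha

theorem IsCompactPos.specOp_specOp (hL : IsCompactPos L) {g h : ℝ → ℝ} (hg : BddSpec L g)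
    (hh : BddSpec L h) (x : H) :
    specOp L g (specOp L h x) = specOp L (fun s => g s * h s) x :=
  hL.specOp_comp hg hh (hg.mul hh) (fun _ _ => rfl) x

theorem IsCompactPos.specOp_congr (hL : IsCompactPos L)
    (hC : ∀ x, inner ℝ x (L x) ≤ C * ‖x‖ ^ 2) {g h : ℝ → ℝ} (hg : BddSpec L g) (hh : BddSpec L h)
    (hgh : ∀ s, 0 ≤ s → s ≤ C → g s = h s) (x : H) : specOp L g x = specOp L h x := by
  refine hL.ext fun s => ?_
  rw [hL.eigenProj_specOp hg, hL.eigenProj_specOp hh]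
  by_cases hs : eigenProj L s x = 0
  · rw [hs, smul_zero, smul_zero]
  · rw [hgh s (hL.nonneg_of_ne hs)
      (not_lt.1 fun hlt => hs (eigenProj_eq_zero_of_gt hC hlt x))]

theorem IsCompactPos.norm_sq_specOp_le_mul (hL : IsCompactPos L)
    (hC : ∀ x, inner ℝ x (L x) ≤ C * ‖x‖ ^ 2) {g h : ℝ → ℝ} (hg : BddSpec L g) (hh : BddSpec L h)
    {k : ℝ} (hgh : ∀ s, 0 ≤ s → s ≤ C → g s ^ 2 ≤ k * h s ^ 2) (x : H) :
    ‖specOp L g x‖ ^ 2 ≤ k * ‖specOp L h x‖ ^ 2 := by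
  refine hasSum_le (fun s => ?_) (hL.hasSum_norm_sq_specOp hg x)
    ((hL.hasSum_norm_sq_specOp hh x).mul_left k)
  by_cases hs : eigenProj L s x = 0
  · simp [hs]
  · rw [← mul_assoc]
    gcongr
    exact hgh s (hL.nonneg_of_ne hs)
      (not_lt.1 fun hlt => hs (eigenProj_eq_zero_of_gt hC hlt x))

theorem IsCompactPos.norm_sq_specOp_le_norm (hL : IsCompactPos L)
    (hC : ∀ x, inner ℝ x (L x) ≤ C * ‖x‖ ^ 2) {g : ℝ → ℝ} (hg : BddSpec L g)
    {k : ℝ} (hgh : ∀ s, 0 ≤ s → s ≤ C → g s ^ 2 ≤ k) (x : H) :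
    ‖specOp L g x‖ ^ 2 ≤ k * ‖x‖ ^ 2 := by
  refine hasSum_le (fun s => ?_) (hL.hasSum_norm_sq_specOp hg x) ((hL.hasSum_norm_sq x).mul_left k)
  by_cases hs : eigenProj L s x = 0
  · simp [hs]
  · gcongr
    exact hgh s (hL.nonneg_of_ne hs)
      (not_lt.1 fun hlt => hs (eigenProj_eq_zero_of_gt hC hlt x))

/-- If `f` is `k`-Lipschitz, then `‖(f(L) - f(s)) e‖ ≤ k ‖(L - s) e‖`. -/
theorem IsCompactPos.norm_specOp_sub_smul_le (hL : IsCompactPos L)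
    (hC : ∀ x, inner ℝ x (L x) ≤ C * ‖x‖ ^ 2) {f : ℝ → ℝ} (hf : BddSpec L f) {s k : ℝ} (hk : 0 ≤ k)
    (h : ∀ t, 0 ≤ t → t ≤ C → |f t - f s| ≤ k * |t - s|) (e : H) :
    ‖specOp L f e - f s • e‖ ≤ k * ‖L e - s • e‖ := by
  have h1 := hL.hasSum_norm_sq (specOp L f e - f s • e)
  have h2 := (hL.hasSum_norm_sq (L e - s • e)).mul_left (k ^ 2)
  refine abs_le_of_sq_le_sq' ?_ (by positivity) |>.2
  rw [mul_pow]
  refine hasSum_le (fun t => ?_) h1 h2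
  rw [eigenProj_sub, eigenProj_sub, hL.eigenProj_specOp hf, hL.eigenProj_apply, eigenProj_smul,
    eigenProj_smul, ← sub_smul, ← sub_smul, norm_smul, norm_smul, mul_pow, mul_pow, ← mul_assoc]
  by_cases ht : eigenProj L t e = 0
  · simp [ht]
  · gcongr
    rw [← mul_pow]
    gcongr
    exact h t (hL.nonneg_of_ne ht)
      (not_lt.1 fun hlt => ht (eigenProj_eq_zero_of_gt hC hlt e))

/-- The normalized component of `w` in the eigenspace of `s` (or `0`). -/
def unitEigenProj (L : H →L[ℝ] H) (w : H) (s : ℝ) : H := ‖eigenProj L s w‖⁻¹ • eigenProj L s w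

theorem norm_smul_unitEigenProj (L : H →L[ℝ] H) (w : H) (s : ℝ) :
    ‖eigenProj L s w‖ • unitEigenProj L w s = eigenProj L s w := by
  rw [unitEigenProj]
  by_cases h : eigenProj L s w = 0
  · simp [h]
  · rw [smul_smul, mul_inv_cancel₀ (norm_ne_zero_iff.2 h), one_smul]

/-- The Lipschitz bound `‖(f(T) - f(X)) w‖ ≤ k ‖T - X‖_HS ‖w‖`, with the Hilbert–Schmidt norm
taken over the normalized components of `w` in the eigenspaces of `T`. -/
theorem norm_specOp_sub_specOp_le {T X : H →L[ℝ] H} (hT : IsCompactPos T) (hX : IsCompactPos X)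
    (hTC : ∀ x, inner ℝ x (T x) ≤ C * ‖x‖ ^ 2) (hXC : ∀ x, inner ℝ x (X x) ≤ C * ‖x‖ ^ 2)
    {f : ℝ → ℝ} (hfT : BddSpec T f) (hfX : BddSpec X f) {k : ℝ} (hk : 0 ≤ k)
    (h : ∀ s t, 0 ≤ s → s ≤ C → 0 ≤ t → t ≤ C → |f t - f s| ≤ k * |t - s|) {w : H} {d : ℝ}
    (hd0 : 0 ≤ d)
    (hd : ∀ A : Finset ℝ, ∑ s ∈ A, ‖(X - T) (unitEigenProj T w s)‖ ^ 2 ≤ d ^ 2) :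
    ‖specOp X f w - specOp T f w‖ ≤ k * d * ‖w‖ := by
  have hsum : HasSum (fun s => specOp X f (eigenProj T s w) - specOp T f (eigenProj T s w))
      (specOp X f w - specOp T f w) :=
    ((specOp X f - specOp T f).hasSum (hT.hasSum_eigenProj w))
  refine le_of_tendsto hsum.norm (Filter.Eventually.of_forall fun A => ?_)
  have hterm : ∀ s, ‖specOp X f (eigenProj T s w) - specOp T f (eigenProj T s w)‖
      ≤ k * (‖eigenProj T s w‖ * ‖(X - T) (unitEigenProj T w s)‖) := by
    intro s
    by_cases hs : eigenProj T s w = 0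
    · simp [hs]
    have hs0 := hT.nonneg_of_ne hs
    have hsC : s ≤ C := not_lt.1 fun hlt => hs (eigenProj_eq_zero_of_gt hTC hlt w)
    have hTf : specOp T f (eigenProj T s w) = f s • eigenProj T s w := by
      refine hT.ext fun t => ?_
      rw [hT.eigenProj_specOp hfT, eigenProj_smul]
      rcases eq_or_ne t s with rfl | hts
      · rfl
      · rw [hT.eigenProj_eigenvector hts (apply_eigenProj T s w), smul_zero, smul_zero]
    have h1 := hX.norm_specOp_sub_smul_le hXC hfX hk (fun t h0 h1 => h s t hs0 hsC h0 h1)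
      (eigenProj T s w)
    rw [hTf]
    refine h1.trans (le_of_eq ?_)
    rw [← apply_eigenProj T s w, ← sub_apply]
    conv_lhs => rw [← norm_smul_unitEigenProj T w s, map_smul, norm_smul, norm_norm]
  calc ‖∑ s ∈ A, (specOp X f (eigenProj T s w) - specOp T f (eigenProj T s w))‖
      ≤ ∑ s ∈ A, k * (‖eigenProj T s w‖ * ‖(X - T) (unitEigenProj T w s)‖) :=
        (norm_sum_le _ _).trans (Finset.sum_le_sum fun s _ => hterm s)
    _ = k * ∑ s ∈ A, ‖eigenProj T s w‖ * ‖(X - T) (unitEigenProj T w s)‖ := by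
        rw [Finset.mul_sum]
    _ ≤ k * (√(∑ s ∈ A, ‖eigenProj T s w‖ ^ 2)
          * √(∑ s ∈ A, ‖(X - T) (unitEigenProj T w s)‖ ^ 2)) := by
        gcongr
        exact Real.sum_mul_le_sqrt_mul_sqrt _ _ _
    _ ≤ k * (‖w‖ * d) := by
        gcongr
        · refine Real.sqrt_le_iff.2 ⟨norm_nonneg _, ?_⟩
          exact sum_le_hasSum A (fun s _ => sq_nonneg _) (hT.hasSum_norm_sq w)
        · exact Real.sqrt_le_iff.2 ⟨hd0, hd A⟩
    _ = k * d * ‖w‖ := by ring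

end Multiplier

section Powers

/-- A concave power is dominated by an affine function. -/
theorem rpow_le_affine {s t θ : ℝ} (hs : 0 ≤ s) (ht : 0 < t) (h0 : 0 ≤ θ) (h1 : θ ≤ 1) :
    s ^ θ ≤ t ^ (θ - 1) * s + t ^ θ := by
  rcases le_total s t with h | h
  · have := Real.rpow_le_rpow hs h h0
    have : 0 ≤ t ^ (θ - 1) * s := by positivity
    linarith
  · have hs' := ht.trans_le h
    have h2 : s ^ θ = s ^ (θ - 1) * s := by
      rw [Real.rpow_sub_one hs'.ne']; field_simp
    have h3 : s ^ (θ - 1) ≤ t ^ (θ - 1) := Real.rpow_le_rpow_of_nonpos ht h (by linarith)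
    have h4 : 0 < t ^ θ := by positivity
    rw [h2]
    nlinarith

/-- The function `s ↦ (s + lam)^p` is Lipschitz on `[0, C]`. -/
theorem abs_rpow_sub_le {lam C p : ℝ} (hlam : 0 < lam) (hlam1 : lam ≤ 1) (hC : 0 ≤ C) (hp : 0 ≤ p)
    {s t : ℝ} (hs0 : 0 ≤ s) (hsC : s ≤ C) (ht0 : 0 ≤ t) (htC : t ≤ C) :
    |(t + lam) ^ p - (s + lam) ^ p|
      ≤ p * (lam ^ (p - 1) + (C + 1) ^ (p - 1)) * |t - s| := by
  have hder : ∀ x ∈ Set.Icc (0 : ℝ) C, HasDerivWithinAt (fun x => (x + lam) ^ p)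
      (p * (x + lam) ^ (p - 1)) (Set.Icc 0 C) x := by
    intro x hx
    have hx' : x + lam ≠ 0 := by have := hx.1; positivity
    have h := (Real.hasDerivAt_rpow_const (p := p) (Or.inl hx')).comp x
      ((hasDerivAt_id x).add_const lam)
    rw [mul_one] at h
    exact h.hasDerivWithinAt
  have hbound : ∀ x ∈ Set.Icc (0 : ℝ) C, ‖p * (x + lam) ^ (p - 1)‖
      ≤ p * (lam ^ (p - 1) + (C + 1) ^ (p - 1)) := by
    intro x hx
    have hx0 : 0 < x + lam := by have := hx.1; positivity
    rw [Real.norm_eq_abs, abs_of_nonneg (by positivity)]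
    gcongr
    rcases le_total 0 (p - 1) with h | h
    · have h1 : (x + lam) ^ (p - 1) ≤ (C + 1) ^ (p - 1) :=
        Real.rpow_le_rpow hx0.le (by linarith [hx.2]) h
      have : 0 < lam ^ (p - 1) := by positivity
      linarith
    · have h1 : (x + lam) ^ (p - 1) ≤ lam ^ (p - 1) :=
        Real.rpow_le_rpow_of_nonpos hlam (by linarith [hx.1]) h
      have : 0 < (C + 1) ^ (p - 1) := by positivity
      linarith
  exact Convex.norm_image_sub_le_of_norm_hasDerivWithin_le hder hbound (convex_Icc 0 C)
    ⟨hs0, hsC⟩ ⟨ht0, htC⟩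

end Powers

section Deterministic

variable {H : Type*} [NormedAddCommGroup H] [InnerProductSpace ℝ H] [CompleteSpace H]
  {T X : H →L[ℝ] H} {C lam Δ : ℝ}

/-- The spectral weight `(s + lam)^{1/2}`. -/
def sqrtWeight (lam s : ℝ) : ℝ := √(s + lam)

theorem sqrtWeight_sq (hlam : 0 < lam) {s : ℝ} (hs : 0 ≤ s) : sqrtWeight lam s ^ 2 = s + lam :=
  Real.sq_sqrt (by positivity)

theorem IsCompactPos.bddSpec_sqrt (hX : IsCompactPos X)
    (hXC : ∀ x, inner ℝ x (X x) ≤ C * ‖x‖ ^ 2) : BddSpec X (sqrtWeight lam) :=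
  hX.bddSpec_of_le hXC (Real.sqrt_nonneg (C + lam)) fun s _ h1 => by
    rw [sqrtWeight, abs_of_nonneg (Real.sqrt_nonneg _)]
    gcongr

theorem IsCompactPos.norm_sq_sqrt (hX : IsCompactPos X)
    (hXC : ∀ x, inner ℝ x (X x) ≤ C * ‖x‖ ^ 2) (hlam : 0 < lam) (v : H) :
    ‖specOp X (sqrtWeight lam) v‖ ^ 2 = inner ℝ v (X v) + lam * ‖v‖ ^ 2 := by
  refine (hX.hasSum_norm_sq_specOp (hX.bddSpec_sqrt hXC) v).unique ?_
  convert! (hX.hasSum_inner_apply v).add ((hX.hasSum_norm_sq v).mul_left lam) using 1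
  funext s
  by_cases hs : eigenProj X s v = 0
  · simp [hs]
  · rw [sqrtWeight_sq hlam (hX.nonneg_of_ne hs), add_mul]

/-- The variance part: if `u` is small in the norm dual to `(T + lam)^{1/2}`, then so is
`(X + lam)^{1/2} G(X) u`. -/
theorem norm_sqrt_filter_le (hX : IsCompactPos X) (hXC : ∀ x, inner ℝ x (X x) ≤ C * ‖x‖ ^ 2)
    (hlam : 0 < lam) (hΔ : 0 ≤ Δ)
    (hcmp : ∀ v, inner ℝ v (T v) + lam * ‖v‖ ^ 2 ≤ Δ * ‖specOp X (sqrtWeight lam) v‖ ^ 2)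
    {G : ℝ → ℝ} (hG : BddSpec X G) {E : ℝ} (hE : 0 ≤ E)
    (hGE : ∀ s, 0 ≤ s → s ≤ C → (s + lam) * |G s| ≤ E) {u : H} {b : ℝ} (hb : 0 ≤ b)
    (hu : ∀ y, inner ℝ u y ≤ b * √(inner ℝ y (T y) + lam * ‖y‖ ^ 2)) :
    ‖specOp X (sqrtWeight lam) (specOp X G u)‖ ≤ E * (√Δ * b) := by
  have hQ : BddSpec X (sqrtWeight lam) := hX.bddSpec_sqrt hXC
  have hI := hX.bddSpec_invSqrt hlam
  set p := specOp X (invSqrtWeight lam) u with hp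
  have hQp : specOp X (sqrtWeight lam) (specOp X (invSqrtWeight lam) p) = p := by
    refine hX.ext fun s => ?_
    rw [hX.eigenProj_specOp hQ, hX.eigenProj_specOp hI, smul_smul]
    by_cases hs : eigenProj X s p = 0
    · simp [hs]
    · have hs0 := hX.nonneg_of_ne hs
      have : 0 < √(s + lam) := Real.sqrt_pos.2 (by positivity)
      rw [sqrtWeight, invSqrtWeight, mul_inv_cancel₀ this.ne', one_smul]
  have h1 : ‖p‖ ^ 2 ≤ b * (√Δ * ‖p‖) := by
    calc ‖p‖ ^ 2 = inner ℝ u (specOp X (invSqrtWeight lam) p) := by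
          rw [← hX.specOp_symm hI, real_inner_self_eq_norm_sq]
      _ ≤ _ := hu _
      _ ≤ b * √(Δ * ‖p‖ ^ 2) := by
          gcongr
          have := hcmp (specOp X (invSqrtWeight lam) p)
          rwa [hQp] at this
      _ = b * (√Δ * ‖p‖) := by rw [Real.sqrt_mul hΔ, Real.sqrt_sq (norm_nonneg _)]
  have h2 : ‖p‖ ≤ √Δ * b := by
    rcases (norm_nonneg p).eq_or_lt with h | h
    · rw [← h]; positivity
    · refine le_of_mul_le_mul_right ?_ h
      nlinarith
  have h3 : ‖specOp X (sqrtWeight lam) (specOp X G u)‖ ^ 2 ≤ E ^ 2 * ‖p‖ ^ 2 := by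
    rw [hX.specOp_specOp hQ hG, hp]
    refine hX.norm_sq_specOp_le_mul hXC (hQ.mul hG) hI (fun s h0 hC => ?_) u
    have hs : 0 < s + lam := by positivity
    have h := hGE s h0 hC
    rw [mul_pow, sqrtWeight_sq hlam h0, invSqrtWeight_sq hlam h0, ← div_eq_mul_inv,
      le_div_iff₀ hs]
    calc (s + lam) * G s ^ 2 * (s + lam) = ((s + lam) * |G s|) ^ 2 := by
          rw [mul_pow, sq_abs]; ring
      _ ≤ E ^ 2 := by gcongr
  have h4 : ‖specOp X (sqrtWeight lam) (specOp X G u)‖ ≤ E * ‖p‖ := by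
    refine abs_le_of_sq_le_sq' ?_ (by positivity) |>.2
    rwa [mul_pow]
  exact h4.trans (by gcongr)

variable {K : ℝ → ℝ} {F τ : ℝ}

/-- The residual function of a filter, as a multiplier of `(s + lam)^{1/2}`. -/
theorem add_mul_residual_sq_le (hlam : 0 < lam) (hτ : 1 ≤ τ)
    (hK : ∀ α, 0 ≤ α → α ≤ τ → ∀ s, 0 ≤ s → s ≤ C → |K s| * s ^ α ≤ F * lam ^ α) {s : ℝ}
    (h0 : 0 ≤ s) (h1 : s ≤ C) : (s + lam) * K s ^ 2 ≤ 2 * F ^ 2 * lam := by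
  have ha := hK (1 / 2) (by norm_num) (by linarith) s h0 h1
  have hb := hK 0 le_rfl (by linarith) s h0 h1
  rw [← Real.sqrt_eq_rpow, ← Real.sqrt_eq_rpow] at ha
  rw [Real.rpow_zero, Real.rpow_zero, mul_one, mul_one] at hb
  have ha' : (|K s| * √s) ^ 2 ≤ (F * √lam) ^ 2 := by gcongr
  have hb' : |K s| ^ 2 ≤ F ^ 2 := by gcongr
  rw [mul_pow, mul_pow, sq_abs, Real.sq_sqrt h0, Real.sq_sqrt hlam.le] at ha'
  rw [sq_abs] at hb'
  nlinarith

theorem add_mul_abs_residual_le (hτ : 1 ≤ τ)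
    (hK : ∀ α, 0 ≤ α → α ≤ τ → ∀ s, 0 ≤ s → s ≤ C → |K s| * s ^ α ≤ F * lam ^ α) {s : ℝ}
    (hlam : 0 < lam) (h0 : 0 ≤ s) (h1 : s ≤ C) : (s + lam) * |K s| ≤ 2 * F * lam := by
  have ha := hK 1 zero_le_one hτ s h0 h1
  have hb := hK 0 le_rfl (by linarith) s h0 h1
  rw [Real.rpow_one, Real.rpow_one] at ha
  rw [Real.rpow_zero, Real.rpow_zero, mul_one, mul_one] at hb
  nlinarith

theorem bddSpec_residual (hX : IsCompactPos X) (hXC : ∀ x, inner ℝ x (X x) ≤ C * ‖x‖ ^ 2)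
    (hτ : 1 ≤ τ) (hF : 0 ≤ F)
    (hK : ∀ α, 0 ≤ α → α ≤ τ → ∀ s, 0 ≤ s → s ≤ C → |K s| * s ^ α ≤ F * lam ^ α) :
    BddSpec X K :=
  hX.bddSpec_of_le hXC hF fun s h0 h1 => by
    simpa using hK 0 le_rfl (by linarith) s h0 h1

theorem norm_sqrt_residual_le (hX : IsCompactPos X) (hXC : ∀ x, inner ℝ x (X x) ≤ C * ‖x‖ ^ 2)
    (hlam : 0 < lam) (hτ : 1 ≤ τ) (hF : 0 ≤ F)
    (hK : ∀ α, 0 ≤ α → α ≤ τ → ∀ s, 0 ≤ s → s ≤ C → |K s| * s ^ α ≤ F * lam ^ α) (v : H) :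
    ‖specOp X (sqrtWeight lam) (specOp X K v)‖ ^ 2 ≤ 2 * F ^ 2 * lam * ‖v‖ ^ 2 := by
  have hQ : BddSpec X (sqrtWeight lam) := hX.bddSpec_sqrt hXC
  have hKb := bddSpec_residual hX hXC hτ hF hK
  rw [hX.specOp_specOp hQ hKb]
  refine hX.norm_sq_specOp_le_norm hXC (hQ.mul hKb) (fun s h0 h1 => ?_) v
  rw [mul_pow, sqrtWeight_sq hlam h0]
  exact add_mul_residual_sq_le hlam hτ hK h0 h1

/-- The spectral weight `(s + lam)^p`. -/
def powWeight (lam p s : ℝ) : ℝ := (s + lam) ^ p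

theorem IsCompactPos.bddSpec_pow (hT : IsCompactPos T)
    (hTC : ∀ x, inner ℝ x (T x) ≤ C * ‖x‖ ^ 2) (hlam : 0 < lam) (p : ℝ) :
    BddSpec T (powWeight lam p) := by
  refine hT.bddSpec_of_le hTC (k := |C + lam| ^ p + lam ^ p) (by positivity) fun s h0 h1 => ?_
  have hs : 0 < s + lam := by positivity
  have hC : 0 < C + lam := by linarith
  rw [powWeight, abs_of_nonneg (by positivity), abs_of_pos hC]
  rcases le_total 0 p with h | h
  · have := Real.rpow_le_rpow hs.le (show s + lam ≤ C + lam by linarith) h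
    have : 0 < lam ^ p := by positivity
    linarith
  · have := Real.rpow_le_rpow_of_nonpos hlam (show lam ≤ s + lam by linarith) h
    have : 0 < (C + lam) ^ p := by positivity
    linarith

theorem norm_sqrt_residual_pow_le_of_le_half (hX : IsCompactPos X)
    (hXC : ∀ x, inner ℝ x (X x) ≤ C * ‖x‖ ^ 2) (hT : IsCompactPos T)
    (hTC : ∀ x, inner ℝ x (T x) ≤ C * ‖x‖ ^ 2) (hlam : 0 < lam) (hτ : 1 ≤ τ) (hF : 0 ≤ F)
    (hK : ∀ α, 0 ≤ α → α ≤ τ → ∀ s, 0 ≤ s → s ≤ C → |K s| * s ^ α ≤ F * lam ^ α) {ζ : ℝ}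
    (hζ : ζ ≤ 1 / 2) (w : H) :
    ‖specOp X (sqrtWeight lam) (specOp X K (specOp T (powWeight lam (ζ - 1 / 2)) w))‖
      ≤ 2 * F * ‖w‖ * lam ^ ζ := by
  have h1 := norm_sqrt_residual_le hX hXC hlam hτ hF hK (specOp T (powWeight lam (ζ - 1 / 2)) w)
  have h2 : ‖specOp T (powWeight lam (ζ - 1 / 2)) w‖ ≤ lam ^ (ζ - 1 / 2) * ‖w‖ := by
    refine hT.norm_specOp_le (hT.bddSpec_pow hTC hlam _) (by positivity) (fun s hs => ?_) w
    have : 0 < s + lam := by positivity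
    rw [powWeight, abs_of_nonneg (by positivity)]
    exact Real.rpow_le_rpow_of_nonpos hlam (by linarith) (by linarith)
  have h3 : lam ^ ζ = √lam * lam ^ (ζ - 1 / 2) := by
    rw [Real.sqrt_eq_rpow, ← Real.rpow_add hlam]; congr 1; ring
  refine abs_le_of_sq_le_sq' ?_ (by positivity) |>.2
  calc _ ≤ 2 * F ^ 2 * lam * (lam ^ (ζ - 1 / 2) * ‖w‖) ^ 2 := h1.trans (by gcongr)
    _ ≤ 4 * F ^ 2 * lam * (lam ^ (ζ - 1 / 2) * ‖w‖) ^ 2 := by gcongr; norm_num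
    _ = (2 * F * ‖w‖ * lam ^ ζ) ^ 2 := by
        rw [h3, mul_pow, mul_pow, mul_pow √lam, Real.sq_sqrt hlam.le]; ring

/-- For `1/2 ≤ ζ ≤ 1` the power of `T` is moved to the other side of the inner product, where it
is dominated by an affine function of `T`, hence by `X`. -/
theorem norm_sqrt_residual_pow_le_of_le_one (hX : IsCompactPos X)
    (hXC : ∀ x, inner ℝ x (X x) ≤ C * ‖x‖ ^ 2) (hT : IsCompactPos T)
    (hTC : ∀ x, inner ℝ x (T x) ≤ C * ‖x‖ ^ 2) (hlam : 0 < lam) (hτ : 1 ≤ τ) (hF : 0 ≤ F)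
    (hK : ∀ α, 0 ≤ α → α ≤ τ → ∀ s, 0 ≤ s → s ≤ C → |K s| * s ^ α ≤ F * lam ^ α) (hΔ : 1 ≤ Δ)
    (hcmp : ∀ v, inner ℝ v (T v) + lam * ‖v‖ ^ 2 ≤ Δ * ‖specOp X (sqrtWeight lam) v‖ ^ 2) {ζ : ℝ}
    (hζ : 1 / 2 ≤ ζ) (hζ1 : ζ ≤ 1) (w : H) :
    ‖specOp X (sqrtWeight lam) (specOp X K (specOp T (powWeight lam (ζ - 1 / 2)) w))‖
      ≤ 3 * F * ‖w‖ * (√Δ * lam ^ ζ) := by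
  have hQ : BddSpec X (sqrtWeight lam) := hX.bddSpec_sqrt hXC
  have hKb := bddSpec_residual hX hXC hτ hF hK
  have hP := hT.bddSpec_pow hTC hlam (ζ - 1 / 2)
  have hΔ0 : 0 < Δ := by linarith
  rw [hX.specOp_specOp hQ hKb]
  set x := specOp X (fun s => sqrtWeight lam s * K s) (specOp T (powWeight lam (ζ - 1 / 2)) w)
    with hx
  set y := specOp X (fun s => sqrtWeight lam s * K s) x with hy
  set θ := 2 * ζ - 1 with hθ
  have h1 : ‖x‖ ^ 2 ≤ ‖w‖ * ‖specOp T (powWeight lam (ζ - 1 / 2)) y‖ := by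
    calc ‖x‖ ^ 2 = inner ℝ w (specOp T (powWeight lam (ζ - 1 / 2)) y) := by
          rw [← hT.specOp_symm hP, hy, ← hX.specOp_symm (hQ.mul hKb), ← hx,
            real_inner_self_eq_norm_sq]
      _ ≤ _ := real_inner_le_norm _ _
  have h2 : ‖specOp X (sqrtWeight lam) y‖ ^ 2 ≤ (2 * F * lam) ^ 2 * ‖x‖ ^ 2 := by
    rw [hy, hX.specOp_specOp hQ (hQ.mul hKb)]
    refine hX.norm_sq_specOp_le_norm hXC (hQ.mul (hQ.mul hKb)) (fun s h0 h1 => ?_) x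
    have h := add_mul_abs_residual_le hτ hK hlam h0 h1
    have hs : 0 ≤ s + lam := by positivity
    rw [← mul_assoc, ← sq, sqrtWeight_sq hlam h0, ← sq_abs, abs_mul, abs_of_nonneg hs]
    gcongr
  have h3 : ‖y‖ ^ 2 ≤ 2 * F ^ 2 * lam * ‖x‖ ^ 2 := by
    refine hX.norm_sq_specOp_le_norm hXC (hQ.mul hKb) (fun s h0 h1 => ?_) x
    rw [mul_pow, sqrtWeight_sq hlam h0]
    exact add_mul_residual_sq_le hlam hτ hK h0 h1
  -- the level `lam * Δ` in the affine bound balances its two terms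
  have h4 : ‖specOp T (powWeight lam (ζ - 1 / 2)) y‖ ^ 2
      ≤ (lam * Δ) ^ (θ - 1) * (inner ℝ y (T y) + lam * ‖y‖ ^ 2) + (lam * Δ) ^ θ * ‖y‖ ^ 2 := by
    have := hT.norm_sq_specOp_le hP (α := (lam * Δ) ^ (θ - 1))
      (β := (lam * Δ) ^ (θ - 1) * lam + (lam * Δ) ^ θ) (fun s hs => ?_) y
    · linarith
    · have hs' : 0 < s + lam := by positivity
      rw [powWeight, ← Real.rpow_natCast, ← Real.rpow_mul hs'.le]
      have := rpow_le_affine hs'.le (show 0 < lam * Δ by positivity) (show 0 ≤ θ by linarith)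
        (show θ ≤ 1 by linarith)
      rw [show (ζ - 1 / 2) * ((2 : ℕ) : ℝ) = θ by rw [hθ]; push_cast; ring]
      linarith
  have h5 : (lam * Δ) ^ (θ - 1) * Δ * lam = (lam * Δ) ^ θ := by
    rw [Real.rpow_sub_one (by positivity)]; field_simp
  have h6 : (lam * Δ) ^ θ * lam ≤ Δ * (lam ^ ζ) ^ 2 := by
    rw [Real.mul_rpow hlam.le hΔ0.le]
    have e1 : lam ^ θ * lam = (lam ^ ζ) ^ 2 := by
      rw [← Real.rpow_natCast, ← Real.rpow_mul hlam.le]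
      nth_rewrite 2 [← Real.rpow_one lam]
      rw [← Real.rpow_add hlam]; congr 1; rw [hθ]; push_cast; ring
    have e2 : Δ ^ θ ≤ Δ := by
      nth_rewrite 2 [← Real.rpow_one Δ]
      exact Real.rpow_le_rpow_of_exponent_le hΔ (by linarith)
    calc lam ^ θ * Δ ^ θ * lam = Δ ^ θ * (lam ^ θ * lam) := by ring
      _ = Δ ^ θ * (lam ^ ζ) ^ 2 := by rw [e1]
      _ ≤ _ := by gcongr
  have h7 : ‖specOp T (powWeight lam (ζ - 1 / 2)) y‖ ^ 2
      ≤ (3 * F * (√Δ * lam ^ ζ) * ‖x‖) ^ 2 := by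
    calc _ ≤ (lam * Δ) ^ (θ - 1) * (Δ * ((2 * F * lam) ^ 2 * ‖x‖ ^ 2))
          + (lam * Δ) ^ θ * (2 * F ^ 2 * lam * ‖x‖ ^ 2) := by
          refine h4.trans ?_
          gcongr
          exact (hcmp y).trans (by gcongr)
      _ = ((lam * Δ) ^ (θ - 1) * Δ * lam) * lam * (4 * F ^ 2 * ‖x‖ ^ 2)
          + (lam * Δ) ^ θ * lam * (2 * F ^ 2 * ‖x‖ ^ 2) := by ring
      _ = (lam * Δ) ^ θ * lam * (6 * F ^ 2 * ‖x‖ ^ 2) := by rw [h5]; ring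
      _ ≤ (Δ * (lam ^ ζ) ^ 2) * (9 * F ^ 2 * ‖x‖ ^ 2) := by gcongr; norm_num
      _ = _ := by rw [mul_pow, mul_pow, mul_pow √Δ, Real.sq_sqrt hΔ0.le]; ring
  have h8 := abs_le_of_sq_le_sq' h7 (by positivity) |>.2
  rcases (norm_nonneg x).eq_or_lt with h | h
  · rw [← h]; positivity
  · refine le_of_mul_le_mul_right ?_ h
    calc ‖x‖ * ‖x‖ = ‖x‖ ^ 2 := (sq _).symm
      _ ≤ ‖w‖ * (3 * F * (√Δ * lam ^ ζ) * ‖x‖) := h1.trans (by gcongr)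
      _ = _ := by ring

/-- For `ζ ≥ 1` the power of `T` is compared with that of `X` in Hilbert–Schmidt norm. -/
theorem norm_sqrt_residual_pow_le_of_one_le (hX : IsCompactPos X)
    (hXC : ∀ x, inner ℝ x (X x) ≤ C * ‖x‖ ^ 2) (hT : IsCompactPos T)
    (hTC : ∀ x, inner ℝ x (T x) ≤ C * ‖x‖ ^ 2) (hC : 0 ≤ C) (hlam : 0 < lam) (hlam1 : lam ≤ 1)
    (hτ : 1 ≤ τ) (hF : 0 ≤ F)
    (hK : ∀ α, 0 ≤ α → α ≤ τ → ∀ s, 0 ≤ s → s ≤ C → |K s| * s ^ α ≤ F * lam ^ α) {ζ : ℝ}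
    (hζ : 1 ≤ ζ) (hζτ : ζ ≤ τ) {w : H} {d k : ℝ} (hd0 : 0 ≤ d)
    (hd : ∀ A : Finset ℝ, ∑ s ∈ A, ‖(X - T) (unitEigenProj T w s)‖ ^ 2 ≤ d ^ 2)
    (hd1 : d ≤ k * lam) (hd2 : d ≤ k * lam ^ (ζ - 1 / 2)) :
    ‖specOp X (sqrtWeight lam) (specOp X K (specOp T (powWeight lam (ζ - 1 / 2)) w))‖
      ≤ F * ‖w‖ * lam ^ ζ * (2 * 2 ^ ζ + 2 * ζ * (1 + (C + 1) ^ (ζ - 3 / 2)) * k) := by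
  have hQ : BddSpec X (sqrtWeight lam) := hX.bddSpec_sqrt hXC
  have hKb := bddSpec_residual hX hXC hτ hF hK
  have hPT := hT.bddSpec_pow hTC hlam (ζ - 1 / 2)
  have hPX := hX.bddSpec_pow hXC hlam (ζ - 1 / 2)
  set p := powWeight lam (ζ - 1 / 2) with hp
  have hpos : 0 < lam ^ ζ := by positivity
  have hsplit : specOp T p w = specOp X p w - (specOp X p w - specOp T p w) := by abel
  rw [hsplit, map_sub, map_sub]
  have h1 : ‖specOp X (sqrtWeight lam) (specOp X K (specOp X p w))‖ ^ 2
      ≤ (F * lam ^ ζ * (2 * 2 ^ ζ)) ^ 2 * ‖w‖ ^ 2 := by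
    rw [hX.specOp_specOp hKb hPX, hX.specOp_specOp hQ (hKb.mul hPX)]
    refine hX.norm_sq_specOp_le_norm hXC (hQ.mul (hKb.mul hPX)) (fun s h0 h1 => ?_) w
    have hs : 0 < s + lam := by positivity
    have e1 : (sqrtWeight lam s * (K s * p s)) ^ 2 = ((s + lam) ^ ζ * |K s|) ^ 2 := by
      have e0 : (s + lam) ^ ζ = (s + lam) ^ (ζ - 1 / 2) * √(s + lam) := by
        rw [Real.sqrt_eq_rpow, ← Real.rpow_add hs]; congr 1; ring
      rw [e0, mul_pow, mul_pow, sqrtWeight_sq hlam h0, mul_pow, mul_pow, Real.sq_sqrt hs.le, sq_abs,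
        hp, powWeight]
      ring
    have e2 : (s + lam) ^ ζ ≤ 2 ^ ζ * (s ^ ζ + lam ^ ζ) := by
      have hmax : s + lam ≤ 2 * max s lam := by
        have := le_max_left s lam; have := le_max_right s lam; linarith
      calc (s + lam) ^ ζ ≤ (2 * max s lam) ^ ζ := Real.rpow_le_rpow hs.le hmax (by linarith)
        _ = 2 ^ ζ * (max s lam) ^ ζ := Real.mul_rpow zero_le_two (le_max_of_le_left h0)
        _ ≤ _ := by
          gcongr
          have : 0 ≤ s ^ ζ := by positivity
          rcases max_choice s lam with h | h <;> rw [h] <;> linarith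
    have e3 := hK ζ (by linarith) hζτ s h0 h1
    have e4 := hK 0 le_rfl (by linarith) s h0 h1
    rw [Real.rpow_zero, Real.rpow_zero, mul_one, mul_one] at e4
    rw [e1]
    have e5 : (s + lam) ^ ζ * |K s| ≤ F * lam ^ ζ * (2 * 2 ^ ζ) := by
      calc (s + lam) ^ ζ * |K s| ≤ 2 ^ ζ * (s ^ ζ + lam ^ ζ) * |K s| := by gcongr
        _ = 2 ^ ζ * (|K s| * s ^ ζ + |K s| * lam ^ ζ) := by ring
        _ ≤ 2 ^ ζ * (F * lam ^ ζ + F * lam ^ ζ) := by gcongr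
        _ = _ := by ring
    gcongr
  have h1' : ‖specOp X (sqrtWeight lam) (specOp X K (specOp X p w))‖
      ≤ F * lam ^ ζ * (2 * 2 ^ ζ) * ‖w‖ := by
    refine abs_le_of_sq_le_sq' ?_ (by positivity) |>.2
    rwa [mul_pow]
  set D := specOp X p w - specOp T p w with hD
  have hD1 : ‖D‖ ≤ (ζ - 1 / 2) * (lam ^ (ζ - 1 / 2 - 1) + (C + 1) ^ (ζ - 1 / 2 - 1)) * d * ‖w‖ := by
    have hζ' : 0 ≤ ζ - 1 / 2 := by linarith
    exact norm_specOp_sub_specOp_le hT hX hTC hXC hPT hPX (by positivity)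
      (fun s t hs0 hsC ht0 htC => abs_rpow_sub_le hlam hlam1 hC hζ' hs0 hsC ht0 htC) hd0 hd
  have h2 := norm_sqrt_residual_le hX hXC hlam hτ hF hK D
  have h2' : ‖specOp X (sqrtWeight lam) (specOp X K D)‖ ≤ 2 * F * √lam * ‖D‖ := by
    refine abs_le_of_sq_le_sq' ?_ (by positivity) |>.2
    refine h2.trans ?_
    rw [mul_pow, mul_pow, Real.sq_sqrt hlam.le]
    have : 0 ≤ F ^ 2 * lam * ‖D‖ ^ 2 := by positivity
    linarith
  have h3 : √lam * ((lam ^ (ζ - 1 / 2 - 1) + (C + 1) ^ (ζ - 1 / 2 - 1)) * d)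
      ≤ (1 + (C + 1) ^ (ζ - 3 / 2)) * k * lam ^ ζ := by
    have e0 : ζ - 1 / 2 - 1 = ζ - 3 / 2 := by ring
    have e1 : √lam * lam ^ (ζ - 3 / 2) * lam = lam ^ ζ := by
      rw [Real.sqrt_eq_rpow, ← Real.rpow_add hlam]
      nth_rewrite 2 [← Real.rpow_one lam]
      rw [← Real.rpow_add hlam]; congr 1; ring
    have e2 : √lam * lam ^ (ζ - 1 / 2) = lam ^ ζ := by
      rw [Real.sqrt_eq_rpow, ← Real.rpow_add hlam]; congr 1; ring
    rw [e0]
    calc √lam * ((lam ^ (ζ - 3 / 2) + (C + 1) ^ (ζ - 3 / 2)) * d)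
        = √lam * lam ^ (ζ - 3 / 2) * d + √lam * (C + 1) ^ (ζ - 3 / 2) * d := by ring
      _ ≤ √lam * lam ^ (ζ - 3 / 2) * (k * lam)
          + √lam * (C + 1) ^ (ζ - 3 / 2) * (k * lam ^ (ζ - 1 / 2)) := by gcongr
      _ = (√lam * lam ^ (ζ - 3 / 2) * lam) * k
          + (C + 1) ^ (ζ - 3 / 2) * k * (√lam * lam ^ (ζ - 1 / 2)) := by ring
      _ = _ := by rw [e1, e2]; ring
  have hk : 0 ≤ k := by
    by_contra hk
    have : k * lam < 0 := mul_neg_of_neg_of_pos (not_le.1 hk) hlam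
    linarith
  calc _ ≤ _ := norm_sub_le _ _
    _ ≤ F * lam ^ ζ * (2 * 2 ^ ζ) * ‖w‖ + 2 * F * √lam * ((ζ - 1 / 2)
          * (lam ^ (ζ - 1 / 2 - 1) + (C + 1) ^ (ζ - 1 / 2 - 1)) * d * ‖w‖) := by
        refine add_le_add h1' (h2'.trans ?_)
        gcongr
    _ = F * lam ^ ζ * (2 * 2 ^ ζ) * ‖w‖ + 2 * F * (ζ - 1 / 2) * ‖w‖
          * (√lam * ((lam ^ (ζ - 1 / 2 - 1) + (C + 1) ^ (ζ - 1 / 2 - 1)) * d)) := by ring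
    _ ≤ F * lam ^ ζ * (2 * 2 ^ ζ) * ‖w‖ + 2 * F * (ζ - 1 / 2) * ‖w‖
          * ((1 + (C + 1) ^ (ζ - 3 / 2)) * k * lam ^ ζ) := by
        have : 0 ≤ ζ - 1 / 2 := by linarith
        gcongr
    _ ≤ F * lam ^ ζ * (2 * 2 ^ ζ) * ‖w‖ + 2 * F * ζ * ‖w‖
          * ((1 + (C + 1) ^ (ζ - 3 / 2)) * k * lam ^ ζ) := by
        gcongr; linarith
    _ = _ := by ring

end Deterministic

/-! ### Truncation of the target and the error in the interpolation norm -/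

section SourceWeights

/-- The function `κ^{-2(ζ-1)_+} s^{ζ-1}` on `[lam, ∞)`: a truncation of `φ(s) / s`. -/
def cutWeight (κ ζ lam s : ℝ) : ℝ :=
  if lam ≤ s then κ ^ (-2 * max (ζ - 1) 0) * s ^ (ζ - 1) else 0

variable {κ ζ lam : ℝ}

theorem kappa_factor_pos (hκ : 1 ≤ κ) : 0 < κ ^ (-2 * max (ζ - 1) 0) :=
  Real.rpow_pos_of_pos (by linarith) _

theorem kappa_factor_le_one (hκ : 1 ≤ κ) : κ ^ (-2 * max (ζ - 1) 0) ≤ 1 := by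
  refine Real.rpow_le_one_of_one_le_of_nonpos hκ ?_
  have := le_max_right (ζ - 1) 0
  linarith

theorem abs_cutWeight_le (hκ : 1 ≤ κ) (hlam : 0 < lam) {s : ℝ} (hsC : s ≤ κ ^ 2) :
    |cutWeight κ ζ lam s| ≤ lam ^ (ζ - 1) + (κ ^ 2) ^ (ζ - 1) := by
  have h1 : 0 < lam ^ (ζ - 1) := by positivity
  have h2 : 0 < (κ ^ 2) ^ (ζ - 1) := by positivity
  unfold cutWeight
  split_ifs with h
  · have hs := hlam.trans_le h
    have h3 : 0 < s ^ (ζ - 1) := by positivity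
    rw [abs_of_nonneg (mul_nonneg (kappa_factor_pos hκ).le h3.le)]
    have h4 : s ^ (ζ - 1) ≤ lam ^ (ζ - 1) + (κ ^ 2) ^ (ζ - 1) := by
      rcases le_total 0 (ζ - 1) with h | h'
      · have := Real.rpow_le_rpow hs.le hsC h
        linarith
      · have := Real.rpow_le_rpow_of_nonpos hlam h h'
        linarith
    exact (mul_le_of_le_one_left h3.le (kappa_factor_le_one hκ)).trans h4
  · simp only [abs_zero]; positivity

theorem cutWeight_mul_sub_holder (hlam : 0 < lam) (s : ℝ) :
    cutWeight κ ζ lam s * s - holder κ ζ s = -(holder κ ζ s * lowWeight lam s) := by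
  unfold cutWeight holder lowWeight
  split_ifs with h
  · have hs := hlam.trans_le h
    rw [Real.rpow_sub_one hs.ne']
    field_simp
    ring
  · ring

theorem abs_rpow_mul_holder_low_le (hκ : 1 ≤ κ) (hlam : 0 < lam) {a : ℝ} (ha0 : 0 ≤ a)
    (ha : a ≤ ζ) {s : ℝ} (hs : 0 ≤ s) :
    |s ^ (-a) * (holder κ ζ s * lowWeight lam s)| ≤ lam ^ (ζ - a) := by
  have hκ0 := kappa_factor_pos (ζ := ζ) hκ
  have hκ1 := kappa_factor_le_one (ζ := ζ) hκ
  have hl : 0 < lam ^ (ζ - a) := by positivity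
  unfold holder lowWeight
  split_ifs with h
  · simp only [mul_zero, abs_zero]; exact hl.le
  have hsl : s ≤ lam := (not_le.1 h).le
  rw [mul_one, abs_of_nonneg (by positivity)]
  have h1 : s ^ (-a) * s ^ ζ ≤ lam ^ (ζ - a) := by
    rcases hs.eq_or_lt with rfl | hs
    · rcases ha0.eq_or_lt with rfl | ha0
      · rcases ha.eq_or_lt with rfl | ha
        · simp
        · rw [Real.zero_rpow ha.ne', mul_zero]; exact hl.le
      · rw [Real.zero_rpow (neg_ne_zero.2 ha0.ne'), zero_mul]; exact hl.le
    · rw [← Real.rpow_add hs, neg_add_eq_sub]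
      exact Real.rpow_le_rpow hs.le hsl (by linarith)
  calc s ^ (-a) * (κ ^ (-2 * max (ζ - 1) 0) * s ^ ζ)
      = κ ^ (-2 * max (ζ - 1) 0) * (s ^ (-a) * s ^ ζ) := by ring
    _ ≤ 1 * lam ^ (ζ - a) := by gcongr
    _ = _ := one_mul _

theorem cutWeight_sq_mul_le (hκ : 1 ≤ κ) (hζ : 0 ≤ ζ) (hlam : 0 < lam) (s : ℝ) :
    (cutWeight κ ζ lam s * powWeight lam (1 / 2 - ζ) s) ^ 2 * s ≤ 4 := by
  have hκ0 := kappa_factor_pos (ζ := ζ) hκ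
  have hκ1 := kappa_factor_le_one (ζ := ζ) hκ
  unfold cutWeight powWeight
  split_ifs with h
  · have hs := hlam.trans_le h
    have hsl : 0 < s + lam := by positivity
    have h1 : (s ^ (ζ - 1)) ^ 2 * s = s ^ (2 * ζ - 1) := by
      rw [← Real.rpow_natCast, ← Real.rpow_mul hs.le]
      nth_rewrite 2 [← Real.rpow_one s]
      rw [← Real.rpow_add hs]; congr 1; push_cast; ring
    have h2 : ((s + lam) ^ (1 / 2 - ζ)) ^ 2 = ((s + lam) ^ (2 * ζ - 1))⁻¹ := by
      rw [← Real.rpow_natCast, ← Real.rpow_mul hsl.le, ← Real.rpow_neg hsl.le]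
      congr 1; push_cast; ring
    have h3 : (s / (s + lam)) ^ (2 * ζ - 1) ≤ 2 := by
      calc (s / (s + lam)) ^ (2 * ζ - 1) ≤ (s / (s + lam)) ^ (-1 : ℝ) := by
            refine Real.rpow_le_rpow_of_exponent_ge (by positivity) ?_ (by linarith)
            rw [div_le_one hsl]; linarith
        _ ≤ 2 := by
            rw [Real.rpow_neg_one, inv_div, div_le_iff₀ hs]; linarith
    calc (κ ^ (-2 * max (ζ - 1) 0) * s ^ (ζ - 1) * (s + lam) ^ (1 / 2 - ζ)) ^ 2 * s
        = (κ ^ (-2 * max (ζ - 1) 0)) ^ 2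
          * (((s ^ (ζ - 1)) ^ 2 * s) * ((s + lam) ^ (1 / 2 - ζ)) ^ 2) := by ring
      _ = (κ ^ (-2 * max (ζ - 1) 0)) ^ 2 * (s / (s + lam)) ^ (2 * ζ - 1) := by
          rw [h1, h2, Real.div_rpow hs.le hsl.le, div_eq_mul_inv]
      _ ≤ 1 ^ 2 * 2 := by gcongr
      _ ≤ 4 := by norm_num
  · norm_num

end SourceWeights

section Target

variable {H : Type*} [NormedAddCommGroup H] [InnerProductSpace ℝ H] [CompleteSpace H]
  [TopologicalSpace.SeparableSpace H] [MeasurableSpace H] [BorelSpace H]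
  {μ : Measure H} [IsProbabilityMeasure μ] {κ ζ lam : ℝ}

theorem inner_covOp_self_le (hb : ∀ᵐ x ∂μ, ‖x‖ ≤ κ) (v : H) :
    inner ℝ v (covOp μ v) ≤ κ ^ 2 * ‖v‖ ^ 2 := by
  rw [inner_covOp_self_eq hb]
  calc ∫ x, inner ℝ v x ^ 2 ∂μ ≤ ∫ _, κ ^ 2 * ‖v‖ ^ 2 ∂μ := by
        refine integral_mono_ae (integrable_inner_sq hb v) (integrable_const _)
          (hb.mono fun x hx => ?_)
        simp only
        rw [← sq_abs, ← mul_pow]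
        gcongr
        refine (abs_real_inner_le_norm v x).trans ?_
        rw [mul_comm]
        gcongr
    _ = _ := by simp

/-- The element `w` of `H` with `I w = 1_{L ≥ lam} f_H`, where `f_H = φ(L) g₀`. -/
def cutTarget (μ : Measure H) (κ ζ lam : ℝ) (g₀ : Lp ℝ 2 μ) : H :=
  specOp (covOp μ) (cutWeight κ ζ lam) (ContinuousLinearMap.adjoint (incl μ) g₀)

/-- The element `w'` of `H` with `w = (T + lam)^{ζ - 1/2} w'`, for the truncated target `w`. -/
def cutSource (μ : Measure H) (κ ζ lam : ℝ) (g₀ : Lp ℝ 2 μ) : H :=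
  specOp (covOp μ) (fun s => cutWeight κ ζ lam s * powWeight lam (1 / 2 - ζ) s)
    (ContinuousLinearMap.adjoint (incl μ) g₀)

theorem bddSpec_cutWeight (hκ : 1 ≤ κ) (hb : ∀ᵐ x ∂μ, ‖x‖ ≤ κ) (hlam : 0 < lam) :
    BddSpec (covOp μ) (cutWeight κ ζ lam) :=
  (isCompactPos_covOp hb).bddSpec_of_le (inner_covOp_self_le hb)
    (k := lam ^ (ζ - 1) + (κ ^ 2) ^ (ζ - 1)) (by positivity)
    fun _ _ h1 => abs_cutWeight_le hκ hlam h1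

theorem cutTarget_eq (hκ : 1 ≤ κ) (hb : ∀ᵐ x ∂μ, ‖x‖ ≤ κ) (hlam : 0 < lam) (g₀ : Lp ℝ 2 μ) :
    cutTarget μ κ ζ lam g₀
      = specOp (covOp μ) (powWeight lam (ζ - 1 / 2)) (cutSource μ κ ζ lam g₀) := by
  have hT := isCompactPos_covOp hb
  have hTC := inner_covOp_self_le hb
  have hc := bddSpec_cutWeight (ζ := ζ) hκ hb hlam
  have hp := hT.bddSpec_pow hTC hlam
  rw [cutTarget, cutSource, hT.specOp_specOp (hp _) (hc.mul (hp _))]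
  refine hT.specOp_congr hTC hc ((hp _).mul (hc.mul (hp _))) (fun s h0 _ => ?_) _
  have hs : 0 < s + lam := by positivity
  have : (s + lam) ^ (ζ - 1 / 2) * (s + lam) ^ (1 / 2 - ζ) = 1 := by
    rw [← Real.rpow_add hs]; simp
  unfold powWeight
  rw [mul_left_comm, this, mul_one]

theorem norm_cutSource_le (hκ : 1 ≤ κ) (hb : ∀ᵐ x ∂μ, ‖x‖ ≤ κ) (hζ : 0 ≤ ζ) (hlam : 0 < lam)
    (g₀ : Lp ℝ 2 μ) : ‖cutSource μ κ ζ lam g₀‖ ≤ 2 * ‖g₀‖ := by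
  have hT := isCompactPos_covOp hb
  have hTC := inner_covOp_self_le hb
  have hL := isCompactPos_intOp hb
  have hbd := (bddSpec_cutWeight (ζ := ζ) hκ hb hlam).mul (hT.bddSpec_pow hTC hlam (1 / 2 - ζ))
  refine abs_le_of_sq_le_sq' ?_ (by positivity) |>.2
  rw [mul_pow]
  refine hasSum_le (fun s => ?_) (hT.hasSum_norm_sq_specOp hbd
    (ContinuousLinearMap.adjoint (incl μ) g₀)) ((hL.hasSum_norm_sq g₀).mul_left (2 ^ 2))
  rw [eigenProj_adjoint_incl, norm_sq_adjoint_incl_eigenProj, ← mul_assoc]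
  by_cases hs : eigenProj (intOp μ) s g₀ = 0
  · simp [hs]
  · gcongr
    have := cutWeight_sq_mul_le hκ hζ hlam s
    linarith

theorem norm_cutTarget_le (hκ : 1 ≤ κ) (hb : ∀ᵐ x ∂μ, ‖x‖ ≤ κ) (hζ : 0 ≤ ζ) (hlam : 0 < lam)
    (hlam1 : lam ≤ 1) (g₀ : Lp ℝ 2 μ) :
    ‖cutTarget μ κ ζ lam g₀‖
      ≤ (lam ^ (ζ - 1 / 2) + (κ ^ 2 + 1) ^ (ζ - 1 / 2)) * (2 * ‖g₀‖) := by
  have hT := isCompactPos_covOp hb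
  have hTC := inner_covOp_self_le hb
  rw [cutTarget_eq hκ hb hlam]
  have h := norm_cutSource_le hκ hb hζ hlam g₀
  refine le_trans ?_ (mul_le_mul_of_nonneg_left h (by positivity))
  refine abs_le_of_sq_le_sq' ?_ (by positivity) |>.2
  rw [mul_pow]
  refine hT.norm_sq_specOp_le_norm hTC (hT.bddSpec_pow hTC hlam _) (fun s h0 h1 => ?_) _
  have hs : 0 < s + lam := by positivity
  have h2 : 0 < lam ^ (ζ - 1 / 2) := by positivity
  have h3 : 0 < (κ ^ 2 + 1) ^ (ζ - 1 / 2) := by positivity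
  unfold powWeight
  gcongr
  rcases le_total 0 (ζ - 1 / 2) with h | h
  · have := Real.rpow_le_rpow hs.le (show s + lam ≤ κ ^ 2 + 1 by linarith) h
    linarith
  · have := Real.rpow_le_rpow_of_nonpos hlam (show lam ≤ s + lam by linarith) h
    linarith

variable {g₀ : Lp ℝ 2 μ}

theorem eigenProj_cutTarget_sub (hκ : 1 ≤ κ) (hb : ∀ᵐ x ∂μ, ‖x‖ ≤ κ) (hlam : 0 < lam)
    (hg : InSpecDomain (intOp μ) (holder κ ζ) g₀) (s : ℝ) :
    eigenProj (intOp μ) s (incl μ (cutTarget μ κ ζ lam g₀)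
      - specApply (intOp μ) (holder κ ζ) g₀)
      = (-(holder κ ζ s * lowWeight lam s)) • eigenProj (intOp μ) s g₀ := by
  have hT := isCompactPos_covOp hb
  have hL := isCompactPos_intOp hb
  have hc := bddSpec_cutWeight (ζ := ζ) hκ hb hlam
  have h1 : incl μ (ContinuousLinearMap.adjoint (incl μ) (eigenProj (intOp μ) s g₀))
      = s • eigenProj (intOp μ) s g₀ := apply_eigenProj (intOp μ) s g₀
  rw [eigenProj_sub, hL.eigenProj_specApply hg, eigenProj_incl, cutTarget, hT.eigenProj_specOp hc,
    eigenProj_adjoint_incl, map_smul, h1, smul_smul, ← sub_smul, cutWeight_mul_sub_holder hlam]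

theorem norm_cutTarget_sub_le (hκ : 1 ≤ κ) (hb : ∀ᵐ x ∂μ, ‖x‖ ≤ κ) (hζ : 0 ≤ ζ) (hlam : 0 < lam)
    (hg : InSpecDomain (intOp μ) (holder κ ζ) g₀) :
    ‖incl μ (cutTarget μ κ ζ lam g₀) - specApply (intOp μ) (holder κ ζ) g₀‖
      ≤ lam ^ ζ * ‖g₀‖ := by
  have hL := isCompactPos_intOp hb
  refine abs_le_of_sq_le_sq' ?_ (by positivity) |>.2
  rw [mul_pow]
  refine hasSum_le (fun s => ?_) (hL.hasSum_norm_sq _) ((hL.hasSum_norm_sq g₀).mul_left _)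
  rw [eigenProj_cutTarget_sub hκ hb hlam hg, norm_smul, mul_pow, norm_neg]
  by_cases hs : eigenProj (intOp μ) s g₀ = 0
  · simp [hs]
  · have := abs_rpow_mul_holder_low_le (ζ := ζ) hκ hlam le_rfl hζ (hL.nonneg_of_ne hs)
    rw [neg_zero, Real.rpow_zero, one_mul, sub_zero] at this
    gcongr
    exact this

theorem inSpecDomain_cutTarget_sub (hκ : 1 ≤ κ) (hb : ∀ᵐ x ∂μ, ‖x‖ ≤ κ) (hlam : 0 < lam)
    (hg : InSpecDomain (intOp μ) (holder κ ζ) g₀) {a : ℝ} (ha0 : 0 ≤ a) (ha : a ≤ ζ) :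
    InSpecDomain (intOp μ) (fun u => u ^ (-a)) (incl μ (cutTarget μ κ ζ lam g₀)
        - specApply (intOp μ) (holder κ ζ) g₀) ∧
      ‖specApply (intOp μ) (fun u => u ^ (-a)) (incl μ (cutTarget μ κ ζ lam g₀)
        - specApply (intOp μ) (holder κ ζ) g₀)‖ ≤ lam ^ (ζ - a) * ‖g₀‖ := by
  have hL := isCompactPos_intOp hb
  have hle : ∀ s, (s ^ (-a)) ^ 2 * ‖eigenProj (intOp μ) s (incl μ (cutTarget μ κ ζ lam g₀)
        - specApply (intOp μ) (holder κ ζ) g₀)‖ ^ 2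
      ≤ (lam ^ (ζ - a)) ^ 2 * ‖eigenProj (intOp μ) s g₀‖ ^ 2 := by
    intro s
    rw [eigenProj_cutTarget_sub hκ hb hlam hg, norm_smul, mul_pow, norm_neg, ← mul_assoc,
      Real.norm_eq_abs, sq_abs, ← mul_pow]
    by_cases hs : eigenProj (intOp μ) s g₀ = 0
    · simp [hs]
    · have := abs_rpow_mul_holder_low_le (ζ := ζ) hκ hlam ha0 ha (hL.nonneg_of_ne hs)
      rw [← sq_abs]
      gcongr
  have hdom : InSpecDomain (intOp μ) (fun u => u ^ (-a)) (incl μ (cutTarget μ κ ζ lam g₀)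
        - specApply (intOp μ) (holder κ ζ) g₀) :=
    (hL.inSpecDomain_iff _ _).2 (((hL.summable_norm_sq g₀).mul_left _).of_nonneg_of_le
      (fun s => by positivity) hle)
  refine ⟨hdom, abs_le_of_sq_le_sq' ?_ (by positivity) |>.2⟩
  rw [mul_pow]
  exact hasSum_le hle (hL.hasSum_norm_sq_specApply hdom) ((hL.hasSum_norm_sq g₀).mul_left _)

/-- The norm of `L^{-a} I v` interpolates between those of `T^{1/2} v` and of `v`. -/
theorem inSpecDomain_incl (hb : ∀ᵐ x ∂μ, ‖x‖ ≤ κ) {a t : ℝ} (ha0 : 0 ≤ a) (ha : a ≤ 1 / 2)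
    (ht : 0 < t) (v : H) :
    InSpecDomain (intOp μ) (fun u => u ^ (-a)) (incl μ v) ∧
      ‖specApply (intOp μ) (fun u => u ^ (-a)) (incl μ v)‖ ^ 2
        ≤ t ^ (-(2 * a)) * (inner ℝ v (covOp μ v) + t * ‖v‖ ^ 2) := by
  have hT := isCompactPos_covOp hb
  have hL := isCompactPos_intOp hb
  have hle : ∀ s, (s ^ (-a)) ^ 2 * ‖eigenProj (intOp μ) s (incl μ v)‖ ^ 2
      ≤ t ^ (-(2 * a)) * (s * ‖eigenProj (covOp μ) s v‖ ^ 2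
        + t * ‖eigenProj (covOp μ) s v‖ ^ 2) := by
    intro s
    rw [eigenProj_incl, norm_sq_incl_eigenProj, ← mul_assoc, ← add_mul, ← mul_assoc]
    by_cases hs : eigenProj (covOp μ) s v = 0
    · simp [hs]
    refine mul_le_mul_of_nonneg_right ?_ (sq_nonneg _)
    rcases (hT.nonneg_of_ne hs).eq_or_lt with rfl | hs0
    · rw [mul_zero]; positivity
    · have h1 : (s ^ (-a)) ^ 2 * s = s ^ (1 - 2 * a) := by
        rw [← Real.rpow_natCast, ← Real.rpow_mul hs0.le]
        nth_rewrite 2 [← Real.rpow_one s]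
        rw [← Real.rpow_add hs0]; congr 1; push_cast; ring
      have h2 := rpow_le_affine hs0.le ht (θ := 1 - 2 * a) (by linarith) (by linarith)
      have h3 : t ^ (1 - 2 * a) = t ^ (-(2 * a)) * t := by
        nth_rewrite 3 [← Real.rpow_one t]
        rw [← Real.rpow_add ht]; congr 1; ring
      rw [h1, mul_add, ← h3, show -(2 * a) = 1 - 2 * a - 1 by ring]
      exact h2
  have hsum := ((hT.hasSum_inner_apply v).add ((hT.hasSum_norm_sq v).mul_left t)).mul_left
    (t ^ (-(2 * a)))
  have hdom : InSpecDomain (intOp μ) (fun u => u ^ (-a)) (incl μ v) :=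
    (hL.inSpecDomain_iff _ _).2 (hsum.summable.of_nonneg_of_le (fun s => by positivity) hle)
  exact ⟨hdom, hasSum_le hle (hL.hasSum_norm_sq_specApply hdom) hsum⟩

end Target

section Filter

variable {κ τ E F lam : ℝ} {Λ : Set ℝ} {g : ℝ → ℝ → ℝ}

/-- A filter function, with the value `0` at `0`. The conditions on a filter family only bound the
filter on `(0, κ²]`; its value at `0` does not affect the estimator, since the data vector is
orthogonal to the kernel of the empirical covariance. -/
def filterAt (g : ℝ → ℝ → ℝ) (lam s : ℝ) : ℝ := if s = 0 then 0 else g lam s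

theorem IsFilterFamily.filterAt_le (h : IsFilterFamily κ τ E F Λ g) (hE : 0 ≤ E) (hlam : lam ∈ Λ)
    {s : ℝ} (h0 : 0 ≤ s) (h1 : s ≤ κ ^ 2) : (s + lam) * |filterAt g lam s| ≤ 2 * E := by
  have hl := h.pos lam hlam
  unfold filterAt
  split_ifs with hs
  · rw [abs_zero, mul_zero]; positivity
  have hs0 : 0 < s := lt_of_le_of_ne h0 (Ne.symm hs)
  have ha := h.bound 1 ⟨zero_le_one, le_rfl⟩ lam hlam s ⟨hs0, h1⟩
  have hb := h.bound 0 ⟨le_rfl, zero_le_one⟩ lam hlam s ⟨hs0, h1⟩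
  rw [Real.rpow_one, sub_self, Real.rpow_zero, mul_one, abs_mul, abs_of_pos hs0] at ha
  rw [Real.rpow_zero, one_mul, sub_zero, Real.rpow_one] at hb
  linarith

theorem IsFilterFamily.residual_filterAt_le (h : IsFilterFamily κ τ E F Λ g) (hlam : lam ∈ Λ)
    {α : ℝ} (hα0 : 0 ≤ α) (hα : α ≤ τ) {s : ℝ} (h0 : 0 ≤ s) (h1 : s ≤ κ ^ 2) :
    |1 - filterAt g lam s * s| * s ^ α ≤ max F 1 * lam ^ α := by
  have hl := h.pos lam hlam
  have hlα : 0 < lam ^ α := by positivity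
  unfold filterAt
  split_ifs with hs
  · subst hs
    rcases hα0.eq_or_lt with rfl | hα0
    · simp
    · rw [Real.zero_rpow hα0.ne', mul_zero]
      have := le_max_right F 1
      positivity
  · have hs0 : 0 < s := lt_of_le_of_ne h0 (Ne.symm hs)
    have ha := h.residual α ⟨hα0, hα⟩ lam hlam s ⟨hs0, h1⟩
    rw [Real.rpow_neg hl.le, ← div_eq_mul_inv, div_le_iff₀ hlα] at ha
    refine ha.trans ?_
    gcongr
    exact le_max_left _ _

end Filter

section Sample

variable {H : Type*} [NormedAddCommGroup H] [InnerProductSpace ℝ H] [CompleteSpace H] {κ : ℝ}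
  {n : ℕ} {z : Fin n → H × ℝ}

theorem isCompactPos_empCov (z : Fin n → H × ℝ) : IsCompactPos (empCov z) where
  compact := by
    have h : ∀ s : Finset (Fin n),
        IsCompactOperator (∑ i ∈ s, InnerProductSpace.rankOne ℝ (z i).1 (z i).1 : H →L[ℝ] H) := by
      intro s
      induction s using Finset.induction_on with
      | empty => simpa using isCompactOperator_zero
      | insert i s hi ih =>
        rw [Finset.sum_insert hi]
        exact (isCompactOperator_rankOne _ _).add ih
    exact (h Finset.univ).smul _
  symm x y := by
    have h := (isPositive_sampleOp (fun i => (z i).1)).inner_left_eq_inner_right x y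
    rw [empCov_eq, smul_apply, smul_apply, real_inner_smul_left, real_inner_smul_right, h]
  nonneg x := by rw [inner_empCov]; positivity

theorem inner_empCov_le (hz : ∀ i, ‖(z i).1‖ ≤ κ) (v : H) :
    inner ℝ v (empCov z v) ≤ κ ^ 2 * ‖v‖ ^ 2 := by
  rw [inner_empCov]
  have h1 : ∑ i, inner ℝ (z i).1 v ^ 2 ≤ ∑ _i : Fin n, κ ^ 2 * ‖v‖ ^ 2 := by
    refine Finset.sum_le_sum fun i _ => ?_
    rw [← sq_abs, ← mul_pow]
    gcongr
    refine (abs_real_inner_le_norm _ _).trans ?_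
    gcongr
    exact hz i
  rw [Finset.sum_const, Finset.card_univ, Fintype.card_fin, nsmul_eq_mul] at h1
  rcases Nat.eq_zero_or_pos n with rfl | hn
  · simp; positivity
  · have : (0 : ℝ) < n := by exact_mod_cast hn
    rw [inv_mul_le_iff₀ this]
    exact h1

theorem eigenProj_zero_empVec (z : Fin n → H × ℝ) : eigenProj (empCov z) 0 (empVec z) = 0 := by
  refine eigenProj_eq_of (by simp) fun w hw => ?_
  rw [zero_smul] at hw
  have h1 : inner ℝ w (empCov z w) = 0 := by rw [hw, inner_zero_right]
  rw [inner_empCov] at h1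
  rw [sub_zero, empVec, real_inner_smul_left, sum_inner]
  rcases Nat.eq_zero_or_pos n with rfl | hn
  · simp
  have hn' : (n : ℝ)⁻¹ ≠ 0 := by positivity
  have h2 := (mul_eq_zero.1 h1).resolve_left hn'
  rw [Finset.sum_eq_zero_iff_of_nonneg fun i _ => sq_nonneg _] at h2
  rw [Finset.sum_eq_zero, mul_zero]
  intro i hi
  rw [real_inner_smul_left, pow_eq_zero_iff two_ne_zero |>.1 (h2 i hi), mul_zero]

theorem bddSpec_filterAt {τ E F lam : ℝ} {Λ : Set ℝ} {g : ℝ → ℝ → ℝ}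
    (h : IsFilterFamily κ τ E F Λ g) (hE : 0 ≤ E) (hlam : lam ∈ Λ) {X : H →L[ℝ] H}
    (hX : IsCompactPos X) (hXC : ∀ x, inner ℝ x (X x) ≤ κ ^ 2 * ‖x‖ ^ 2) :
    BddSpec X (filterAt g lam) := by
  have hl := h.pos lam hlam
  refine hX.bddSpec_of_le hXC (k := 2 * E / lam) (by positivity) fun s h0 h1 => ?_
  rw [le_div_iff₀ hl]
  have := h.filterAt_le hE hlam h0 h1
  have h2 : 0 ≤ s * |filterAt g lam s| := by positivity
  linarith

/-- The estimator is `G(X) b`, and `G(X) b - w = G(X) (b - X w) - (1 - G(X) X) w`. -/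
theorem estVec_sub_eq {τ E F lam : ℝ} {Λ : Set ℝ} {g : ℝ → ℝ → ℝ}
    (h : IsFilterFamily κ τ E F Λ g) (hE : 0 ≤ E) (hτ : 1 ≤ τ) (hlam : lam ∈ Λ)
    (hz : ∀ i, ‖(z i).1‖ ≤ κ) (w : H) :
    estVec (g lam) z - w = specOp (empCov z) (filterAt g lam) (empVec z - empCov z w)
      - specOp (empCov z) (fun s => 1 - filterAt g lam s * s) w := by
  have hX := isCompactPos_empCov z
  have hXC := inner_empCov_le hz
  have hG := bddSpec_filterAt h hE hlam hX hXC
  have hK : BddSpec (empCov z) (fun s => 1 - filterAt g lam s * s) :=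
    bddSpec_residual hX hXC hτ (le_max_of_le_right zero_le_one)
      fun α h0 h1 s hs hC => h.residual_filterAt_le hlam h0 h1 hs hC
  have h1 : estVec (g lam) z = specOp (empCov z) (filterAt g lam) (empVec z) := by
    rw [hX.specOp_apply hG, estVec, specApply, specApply]
    refine tsum_congr fun s => ?_
    rcases eq_or_ne s 0 with rfl | hs
    · rw [eigenProj_zero_empVec, smul_zero, smul_zero]
    · rw [filterAt, if_neg hs]
  rw [h1]
  refine hX.ext fun s => ?_
  rw [eigenProj_sub, eigenProj_sub, hX.eigenProj_specOp hG, hX.eigenProj_specOp hG,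
    hX.eigenProj_specOp hK, eigenProj_sub, hX.eigenProj_apply, smul_sub, smul_smul, sub_smul,
    one_smul]
  abel

end Sample

section ErrorBound

/-- The constant of the bound for the bias of the estimator. -/
def biasConst (κ ζ F R : ℝ) : ℝ :=
  max F 1 * (2 * R) * (3 + 2 * 2 ^ ζ + 2 * ζ * (1 + (κ ^ 2 + 1) ^ (ζ - 3 / 2)))

theorem biasConst_nonneg {κ ζ F R : ℝ} (hζ : 0 ≤ ζ) (hR : 0 ≤ R) : 0 ≤ biasConst κ ζ F R := by
  have h1 : 0 ≤ max F 1 := le_max_of_le_right zero_le_one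
  unfold biasConst
  positivity

variable {H : Type*} [NormedAddCommGroup H] [InnerProductSpace ℝ H] [CompleteSpace H]
  [TopologicalSpace.SeparableSpace H] [MeasurableSpace H] [BorelSpace H]
  {μ : Measure H} [IsProbabilityMeasure μ] {κ ζ lam τ E F R a : ℝ} {Λ : Set ℝ} {g : ℝ → ℝ → ℝ}
  {g₀ : Lp ℝ 2 μ} {n : ℕ} {z : Fin n → H × ℝ}

theorem norm_sqrt_bias_le (hκ : 1 ≤ κ) (hb : ∀ᵐ x ∂μ, ‖x‖ ≤ κ) (hζ : 0 ≤ ζ) (hζτ : ζ ≤ τ)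
    (hτ : 1 ≤ τ) (hg₀ : ‖g₀‖ ≤ R) (hfam : IsFilterFamily κ τ E F Λ g) (hlam : lam ∈ Λ)
    (hlam1 : lam ≤ 1) (hz : ∀ i, ‖(z i).1‖ ≤ κ) {Δ : ℝ} (hΔ : 1 ≤ Δ)
    (hcmp : ∀ v, inner ℝ v (covOp μ v) + lam * ‖v‖ ^ 2
      ≤ Δ * ‖specOp (empCov z) (sqrtWeight lam) v‖ ^ 2) {d k : ℝ} (hk : 1 ≤ k) (hd0 : 0 ≤ d)
    (hd : ∀ A : Finset ℝ, ∑ s ∈ A,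
      ‖(empCov z - covOp μ) (unitEigenProj (covOp μ) (cutSource μ κ ζ lam g₀) s)‖ ^ 2 ≤ d ^ 2)
    (hdk : 1 < ζ → d ≤ k * lam ∧ d ≤ k * lam ^ (ζ - 1 / 2)) :
    ‖specOp (empCov z) (sqrtWeight lam)
      (specOp (empCov z) (fun s => 1 - filterAt g lam s * s) (cutTarget μ κ ζ lam g₀))‖
      ≤ √Δ * (biasConst κ ζ F R * lam ^ ζ * k) := by
  have hl := hfam.pos lam hlam
  have hX := isCompactPos_empCov z
  have hXC := inner_empCov_le hz
  have hT := isCompactPos_covOp hb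
  have hTC := inner_covOp_self_le hb
  have hF : 0 ≤ max F 1 := le_max_of_le_right zero_le_one
  have hK : ∀ α, 0 ≤ α → α ≤ τ → ∀ s, 0 ≤ s → s ≤ κ ^ 2 →
      |(fun s => 1 - filterAt g lam s * s) s| * s ^ α ≤ max F 1 * lam ^ α :=
    fun α h0 h1 s hs hC => hfam.residual_filterAt_le hlam h0 h1 hs hC
  have hR : 0 ≤ R := (norm_nonneg _).trans hg₀
  have hw : ‖cutSource μ κ ζ lam g₀‖ ≤ 2 * R :=
    (norm_cutSource_le hκ hb hζ hl g₀).trans (by linarith)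
  have hΔ1 : 1 ≤ √Δ := Real.one_le_sqrt.2 hΔ
  have hlz : 0 < lam ^ ζ := by positivity
  have h2 : (0 : ℝ) < 2 ^ ζ := by positivity
  have h3 : 0 ≤ 2 * ζ * (1 + (κ ^ 2 + 1) ^ (ζ - 3 / 2)) := by positivity
  have hkΔ : 1 ≤ √Δ * k := one_le_mul_of_one_le_of_one_le hΔ1 hk
  rw [cutTarget_eq hκ hb hl]
  set w := cutSource μ κ ζ lam g₀ with hwdef
  have key : ∀ A : ℝ, 0 ≤ A →
      A ≤ √Δ * k * (3 + 2 * 2 ^ ζ + 2 * ζ * (1 + (κ ^ 2 + 1) ^ (ζ - 3 / 2))) →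
      max F 1 * ‖w‖ * lam ^ ζ * A ≤ √Δ * (biasConst κ ζ F R * lam ^ ζ * k) := by
    intro A hA0 hA
    calc max F 1 * ‖w‖ * lam ^ ζ * A
        ≤ max F 1 * (2 * R) * lam ^ ζ
          * (√Δ * k * (3 + 2 * 2 ^ ζ + 2 * ζ * (1 + (κ ^ 2 + 1) ^ (ζ - 3 / 2)))) := by gcongr
      _ = _ := by unfold biasConst; ring
  rcases le_or_gt ζ (1 / 2) with hc | hc
  · have h := norm_sqrt_residual_pow_le_of_le_half hX hXC hT hTC hl hτ hF hK hc w
    refine h.trans (le_trans (le_of_eq ?_) (key 2 zero_le_two ?_))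
    · ring
    · nlinarith
  rcases le_or_gt ζ 1 with hc1 | hc1
  · have h := norm_sqrt_residual_pow_le_of_le_one hX hXC hT hTC hl hτ hF hK hΔ hcmp hc.le hc1 w
    refine h.trans (le_trans (le_of_eq ?_) (key (3 * √Δ) (by positivity) ?_))
    · ring
    · have h4 : √Δ ≤ √Δ * k := le_mul_of_one_le_right (by positivity) hk
      nlinarith
  · obtain ⟨hd1, hd2⟩ := hdk hc1
    have h := norm_sqrt_residual_pow_le_of_one_le hX hXC hT hTC (sq_nonneg κ) hl hlam1 hτ hF hK
      hc1.le hζτ hd0 hd hd1 hd2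
    refine h.trans (key _ (by positivity) ?_)
    have h4 : k ≤ √Δ * k := le_mul_of_one_le_left (by linarith) hΔ1
    nlinarith

/-- The error bound for a fixed sample. The hypotheses are the comparison of the covariance with
the empirical covariance, a bound for the noise, and (for `ζ > 1`) a Hilbert–Schmidt bound for the
deviation of the empirical covariance. -/
theorem norm_specApply_estVec_sub_le (hκ : 1 ≤ κ) (hb : ∀ᵐ x ∂μ, ‖x‖ ≤ κ) (hζ : 0 ≤ ζ)
    (hζτ : ζ ≤ τ) (hτ : 1 ≤ τ) (hE : 0 ≤ E) (ha0 : 0 ≤ a) (ha : a ≤ 1 / 2) (haζ : a ≤ ζ)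
    (hg₀ : ‖g₀‖ ≤ R) (hg : InSpecDomain (intOp μ) (holder κ ζ) g₀)
    (hfam : IsFilterFamily κ τ E F Λ g) (hlam : lam ∈ Λ)
    (hlam1 : lam ≤ 1) (hz : ∀ i, ‖(z i).1‖ ≤ κ) {Δ : ℝ} (hΔ : 1 ≤ Δ)
    (hcmp : ∀ v, inner ℝ v (covOp μ v) + lam * ‖v‖ ^ 2
      ≤ Δ * (inner ℝ v (empCov z v) + lam * ‖v‖ ^ 2)) {b : ℝ} (hb0 : 0 ≤ b)
    (hu : ∀ y, inner ℝ (empVec z - empCov z (cutTarget μ κ ζ lam g₀)) y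
      ≤ b * √(inner ℝ y (covOp μ y) + lam * ‖y‖ ^ 2)) {d k : ℝ} (hk : 1 ≤ k) (hd0 : 0 ≤ d)
    (hd : ∀ A : Finset ℝ, ∑ s ∈ A,
      ‖(empCov z - covOp μ) (unitEigenProj (covOp μ) (cutSource μ κ ζ lam g₀) s)‖ ^ 2 ≤ d ^ 2)
    (hdk : 1 < ζ → d ≤ k * lam ∧ d ≤ k * lam ^ (ζ - 1 / 2)) :
    InSpecDomain (intOp μ) (fun u => u ^ (-a))
        (incl μ (estVec (g lam) z) - specApply (intOp μ) (holder κ ζ) g₀) ∧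
      ‖specApply (intOp μ) (fun u => u ^ (-a))
        (incl μ (estVec (g lam) z) - specApply (intOp μ) (holder κ ζ) g₀)‖
        ≤ 2 * lam ^ (-a) * Δ ^ (1 - a) * (2 * E * b + biasConst κ ζ F R * lam ^ ζ * k)
          + lam ^ (ζ - a) * R := by
  have hl := hfam.pos lam hlam
  have hX := isCompactPos_empCov z
  have hXC := inner_empCov_le hz
  have hΔ0 : 0 < Δ := by linarith
  have hcmp' : ∀ v, inner ℝ v (covOp μ v) + lam * ‖v‖ ^ 2
      ≤ Δ * ‖specOp (empCov z) (sqrtWeight lam) v‖ ^ 2 := fun v => by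
    rw [hX.norm_sq_sqrt hXC hl]; exact hcmp v
  set w := cutTarget μ κ ζ lam g₀ with hw
  set v := estVec (g lam) z - w with hv
  set β := 2 * E * b + biasConst κ ζ F R * lam ^ ζ * k with hβ
  have hR : 0 ≤ R := (norm_nonneg _).trans hg₀
  have hβ0 : 0 ≤ β := by
    have := biasConst_nonneg (κ := κ) (F := F) hζ hR
    positivity
  have hQv : ‖specOp (empCov z) (sqrtWeight lam) v‖ ≤ √Δ * β := by
    rw [hv, estVec_sub_eq hfam hE hτ hlam hz w, map_sub]
    have h1 := norm_sqrt_filter_le hX hXC hl hΔ0.le hcmp' (bddSpec_filterAt hfam hE hlam hX hXC)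
      (E := 2 * E) (by positivity) (fun s h0 h1 => hfam.filterAt_le hE hlam h0 h1) hb0 hu
    have h2 := norm_sqrt_bias_le hκ hb hζ hζτ hτ hg₀ hfam hlam hlam1 hz hΔ hcmp' hk hd0 hd hdk
    calc _ ≤ _ := norm_sub_le _ _
      _ ≤ 2 * E * (√Δ * b) + √Δ * (biasConst κ ζ F R * lam ^ ζ * k) := add_le_add h1 h2
      _ = √Δ * β := by rw [hβ]; ring
  have hQv2 : ‖specOp (empCov z) (sqrtWeight lam) v‖ ^ 2 ≤ Δ * β ^ 2 := by
    calc _ ≤ (√Δ * β) ^ 2 := by gcongr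
      _ = Δ * β ^ 2 := by rw [mul_pow, Real.sq_sqrt hΔ0.le]
  obtain ⟨hdom1, hn1⟩ := inSpecDomain_incl hb ha0 ha (show 0 < lam * Δ by positivity) v
  obtain ⟨hdom2, hn2⟩ := inSpecDomain_cutTarget_sub hκ hb hl hg ha0 haζ
  have hsplit : incl μ (estVec (g lam) z) - specApply (intOp μ) (holder κ ζ) g₀
      = incl μ v + (incl μ w - specApply (intOp μ) (holder κ ζ) g₀) := by
    rw [hv, map_sub]; abel
  rw [hsplit]
  refine ⟨hdom1.add hdom2, ?_⟩
  rw [specApply_add hdom1 hdom2]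
  refine (norm_add_le _ _).trans (add_le_add ?_ (hn2.trans (by gcongr)))
  refine abs_le_of_sq_le_sq' (hn1.trans ?_) (by positivity) |>.2
  have h1 : inner ℝ v (covOp μ v) + lam * Δ * ‖v‖ ^ 2 ≤ 2 * (Δ * (Δ * β ^ 2)) := by
    have h2 := hcmp' v
    have h3 := hX.norm_sq_sqrt hXC hl v
    have h4 : Δ * (lam * ‖v‖ ^ 2) ≤ Δ * ‖specOp (empCov z) (sqrtWeight lam) v‖ ^ 2 := by
      rw [h3]
      gcongr
      exact le_add_of_nonneg_left (hX.nonneg v)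
    have h5 : Δ * ‖specOp (empCov z) (sqrtWeight lam) v‖ ^ 2 ≤ Δ * (Δ * β ^ 2) := by gcongr
    have h6 : 0 ≤ lam * ‖v‖ ^ 2 := by positivity
    linarith
  calc (lam * Δ) ^ (-(2 * a)) * (inner ℝ v (covOp μ v) + lam * Δ * ‖v‖ ^ 2)
      ≤ (lam * Δ) ^ (-(2 * a)) * (2 * (Δ * (Δ * β ^ 2))) := by gcongr
    _ = 2 * (lam ^ (-a) * Δ ^ (1 - a) * β) ^ 2 := by
        have e1 : (lam * Δ) ^ (-(2 * a)) = (lam ^ (-a)) ^ 2 * (Δ ^ (-a)) ^ 2 := by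
          rw [Real.mul_rpow hl.le hΔ0.le, ← Real.rpow_natCast, ← Real.rpow_natCast (Δ ^ (-a)),
            ← Real.rpow_mul hl.le, ← Real.rpow_mul hΔ0.le]
          congr 2 <;> (push_cast; ring)
        have e2 : Δ ^ (1 - a) = Δ * Δ ^ (-a) := by
          rw [sub_eq_add_neg, Real.rpow_add hΔ0, Real.rpow_one]
        rw [e1, e2]; ring
    _ ≤ (2 * lam ^ (-a) * Δ ^ (1 - a) * β) ^ 2 := by
        have : 0 ≤ (lam ^ (-a) * Δ ^ (1 - a) * β) ^ 2 := sq_nonneg _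
        nlinarith

end ErrorBound

/-! ### The noise and the deviation of the empirical covariance -/

section Moments

variable {E : Type*} [NormedAddCommGroup E] [InnerProductSpace ℝ E] {Ω : Type*} [MeasurableSpace Ω]
  {ν : Measure Ω} [IsProbabilityMeasure ν]

theorem one_le_half_mul_factorial {l : ℕ} (hl : 2 ≤ l) : (1 : ℝ) ≤ 1 / 2 * (l.factorial : ℝ) := by
  have h : (2 : ℕ).factorial ≤ l.factorial := Nat.factorial_le hl
  have h' : (2 : ℝ) ≤ l.factorial := by exact_mod_cast h
  linarith

theorem bernsteinMoments_of_bounded {ξ : Ω → E} {σ M : ℝ}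
    (hb : ∀ᵐ z ∂ν, ‖ξ z‖ ≤ M)
    (hσ : ∫⁻ z, ENNReal.ofReal (‖ξ z‖ ^ 2) ∂ν ≤ ENNReal.ofReal (σ ^ 2)) :
    BernsteinMoments ν ξ σ M := by
  have hM : 0 ≤ M := by
    obtain ⟨z, hz⟩ := hb.exists
    exact (norm_nonneg _).trans hz
  intro l hl
  calc ∫⁻ z, ENNReal.ofReal (‖ξ z‖ ^ l) ∂ν
      ≤ ∫⁻ z, ENNReal.ofReal (M ^ (l - 2)) * ENNReal.ofReal (‖ξ z‖ ^ 2) ∂ν := by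
        refine lintegral_mono_ae (hb.mono fun z hz => ?_)
        rw [← ENNReal.ofReal_mul (by positivity)]
        refine ENNReal.ofReal_le_ofReal ?_
        calc ‖ξ z‖ ^ l = ‖ξ z‖ ^ (l - 2) * ‖ξ z‖ ^ 2 := by rw [← pow_add]; congr 1; omega
          _ ≤ M ^ (l - 2) * ‖ξ z‖ ^ 2 := by gcongr
    _ ≤ ENNReal.ofReal (M ^ (l - 2)) * ENNReal.ofReal (σ ^ 2) := by
        rw [lintegral_const_mul' _ _ ENNReal.ofReal_ne_top]
        exact mul_le_mul' le_rfl hσ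
    _ ≤ _ := by
        rw [← ENNReal.ofReal_mul (by positivity)]
        refine ENNReal.ofReal_le_ofReal ?_
        have h1 := one_le_half_mul_factorial hl
        have h2 : 0 ≤ M ^ (l - 2) * σ ^ 2 := by positivity
        nlinarith

theorem bernsteinMoments_of_norm_le {ξ : Ω → E} {M : ℝ} (hb : ∀ᵐ z ∂ν, ‖ξ z‖ ≤ M) :
    BernsteinMoments ν ξ M M := by
  refine bernsteinMoments_of_bounded hb ?_
  calc ∫⁻ z, ENNReal.ofReal (‖ξ z‖ ^ 2) ∂ν ≤ ∫⁻ _, ENNReal.ofReal (M ^ 2) ∂ν := by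
        refine lintegral_mono_ae (hb.mono fun z hz => ?_)
        exact ENNReal.ofReal_le_ofReal (by gcongr)
    _ = _ := by simp

end Moments

section HilbertSchmidt

variable {H : Type*} [NormedAddCommGroup H] [InnerProductSpace ℝ H]

/-- The system `e` satisfies the Bessel inequality. -/
def IsBessel (e : ℝ → H) : Prop := ∀ x : H, ∀ A : Finset ℝ, ∑ s ∈ A, inner ℝ x (e s) ^ 2 ≤ ‖x‖ ^ 2

theorem IsCompactPos.isBessel [CompleteSpace H] {T : H →L[ℝ] H} (hT : IsCompactPos T) (w : H) :
    IsBessel (unitEigenProj T w) := by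
  intro x A
  refine (Finset.sum_le_sum fun s _ => ?_).trans
    (sum_le_hasSum A (fun s _ => sq_nonneg ‖eigenProj T s x‖) (hT.hasSum_norm_sq x))
  have h1 : eigenProj T s (unitEigenProj T w s) = unitEigenProj T w s := by
    rw [unitEigenProj, eigenProj_smul, eigenProj_eigenProj]
  have h2 : ‖unitEigenProj T w s‖ ≤ 1 := by
    rw [unitEigenProj, norm_smul, norm_inv, norm_norm]
    exact inv_mul_le_one
  rw [← h1, ← inner_eigenProj_left, ← sq_abs]
  gcongr
  calc _ ≤ ‖eigenProj T s x‖ * ‖unitEigenProj T w s‖ := abs_real_inner_le_norm _ _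
    _ ≤ ‖eigenProj T s x‖ * 1 := by gcongr
    _ = _ := mul_one _

theorem IsBessel.sum_norm_le {e : ℝ → H} (he : IsBessel e) (x y : H) (A : Finset ℝ) :
    ∑ s ∈ A, ‖inner ℝ x (e s) • y‖ ^ (2 : ℝ≥0∞).toReal ≤ (‖x‖ * ‖y‖) ^ (2 : ℝ≥0∞).toReal := by
  simp only [ENNReal.toReal_ofNat, Real.rpow_ofNat, norm_smul, mul_pow, Real.norm_eq_abs, sq_abs]
  rw [← Finset.sum_mul]
  gcongr
  exact he x A

/-- The sequence `(⟨x, e_s⟩ y)_s`: the coordinates of the Hilbert–Schmidt operator `x ⊗ y`. -/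
def IsBessel.tensor {e : ℝ → H} (he : IsBessel e) (x y : H) : lp (fun _ : ℝ => H) 2 :=
  ⟨fun s => inner ℝ x (e s) • y, memℓp_gen' (he.sum_norm_le x y)⟩

theorem IsBessel.norm_tensor_le {e : ℝ → H} (he : IsBessel e) (x y : H) :
    ‖he.tensor x y‖ ≤ ‖x‖ * ‖y‖ :=
  lp.norm_le_of_forall_sum_le (by norm_num) (by positivity) (he.sum_norm_le x y)

theorem IsBessel.continuous_tensor {e : ℝ → H} (he : IsBessel e) :
    Continuous fun x : H => he.tensor x x := by
  set f : H →ₗ[ℝ] H →ₗ[ℝ] lp (fun _ : ℝ => H) 2 := LinearMap.mk₂ ℝ he.tensor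
    (fun x y z => by
      apply lp.ext; funext s
      simp only [IsBessel.tensor, lp.coeFn_add, Pi.add_apply, inner_add_left, add_smul])
    (fun c x y => by
      apply lp.ext; funext s
      simp only [IsBessel.tensor, lp.coeFn_smul, Pi.smul_apply, real_inner_smul_left, mul_smul])
    (fun x y z => by
      apply lp.ext; funext s
      simp only [IsBessel.tensor, lp.coeFn_add, Pi.add_apply, smul_add])
    (fun c x y => by
      apply lp.ext; funext s
      simp only [IsBessel.tensor, lp.coeFn_smul, Pi.smul_apply]
      rw [smul_comm]) with hf
  have hc : ∀ x y, f.mkContinuous₂ 1 (fun x y => by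
      rw [one_mul]; exact he.norm_tensor_le x y) x y = he.tensor x y := fun x y => rfl
  have : Continuous fun x => f.mkContinuous₂ 1 (fun x y => by
      rw [one_mul]; exact he.norm_tensor_le x y) x x :=
    (ContinuousLinearMap.continuous _).clm_apply continuous_id
  simpa only [hc] using this

end HilbertSchmidt

section Events

variable {H : Type*} [NormedAddCommGroup H] [InnerProductSpace ℝ H] [CompleteSpace H]
  [TopologicalSpace.SeparableSpace H] [MeasurableSpace H] [BorelSpace H]
  {ρ : Measure (H × ℝ)} [IsProbabilityMeasure ρ] {κ M Q η : ℝ} {n : ℕ}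

theorem integral_rankOne_fst (hb : ∀ᵐ x ∂ρ.fst, ‖x‖ ≤ κ) (v : H) :
    ∫ z, inner ℝ z.1 v • z.1 ∂ρ = covOp ρ.fst v := by
  rw [covOp_eq_integral hb, ContinuousLinearMap.integral_apply (integrable_rankOne hb)]
  exact (integral_map (μ := ρ) measurable_fst.aemeasurable
    ((integrable_rankOne hb).apply_continuousLinearMap v).aestronglyMeasurable).symm

/-- The deviation of the empirical covariance in Hilbert–Schmidt norm. -/
theorem measure_hilbertSchmidt_deviation_le (hκ : 0 < κ) (hb : ∀ᵐ x ∂ρ.fst, ‖x‖ ≤ κ)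
    (hη : 0 < η) (hn : 1 ≤ n) (w : H) :
    (Measure.pi fun _ : Fin n => ρ) {z | ¬ ∀ A : Finset ℝ, ∑ s ∈ A,
      ‖(empCov z - covOp ρ.fst) (unitEigenProj (covOp ρ.fst) w s)‖ ^ 2
        ≤ ((4 * κ ^ 2 / n + 2 * κ ^ 2 / √n) * (Real.log (2 / η) + 1)) ^ 2}
      ≤ ENNReal.ofReal η := by
  have := UniformSpace.secondCountable_of_separable H
  have hT := isCompactPos_covOp hb
  set e := unitEigenProj (covOp ρ.fst) w with he_def
  have he : IsBessel e := hT.isBessel w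
  set ξ : H × ℝ → lp (fun _ : ℝ => H) 2 := fun z => he.tensor z.1 z.1 with hξ
  have hξm : StronglyMeasurable ξ :=
    he.continuous_tensor.stronglyMeasurable.comp_measurable measurable_fst
  have hξb : ∀ᵐ z ∂ρ, ‖ξ z‖ ≤ κ ^ 2 := (ae_norm_fst_le hb).mono fun z hz => by
    refine (he.norm_tensor_le _ _).trans ?_
    rw [sq]
    gcongr
  have hmom := bernsteinMoments_of_norm_le hξb
  have hint : Integrable ξ ρ := hmom.integrable hξm
  refine le_trans (measure_mono ?_) (hmom.measure_mean_le (by positivity) (by positivity) hη hξm hn)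
  intro z hz
  by_contra hcon
  rw [Set.mem_ofPred_eq, not_lt] at hcon
  refine hz fun A => ?_
  set D := (n : ℝ)⁻¹ • ∑ i, ξ (z i) - ∫ y, ξ y ∂ρ with hD
  -- the deviation is the sample mean of the tensors `x ⊗ x`, read in the system `e`
  have hcoord : ∀ s, (empCov z - covOp ρ.fst) (e s) = D s := by
    intro s
    have h1 : D s = lp.evalCLM ℝ (fun _ : ℝ => H) 2 s D := rfl
    rw [h1, hD, map_sub, map_smul, map_sum, ← ContinuousLinearMap.integral_comp_comm _ hint,
      sub_apply, empCov_eq, smul_apply, sampleOp_apply, ← integral_rankOne_fst hb]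
    rfl
  have h2 := lp.sum_rpow_le_norm_rpow (p := 2) (by norm_num) D A
  simp only [ENNReal.toReal_ofNat, Real.rpow_ofNat] at h2
  simp only [hcoord]
  refine h2.trans ?_
  gcongr

/-- The noise of the labels, in the norm dual to `(T + lam)^{1/2}`. -/
theorem measure_label_noise_le (hκ : 0 < κ) (hb : ∀ᵐ x ∂ρ.fst, ‖x‖ ≤ κ) (hM : 0 < M) (hQ : 0 ≤ Q)
    (hm : MomentCondition M Q ρ) {lam N : ℝ} (hlam : 0 < lam) (hN0 : 0 ≤ N)
    (hN : effDim (covOp ρ.fst) lam ≤ ENNReal.ofReal N) (hη : 0 < η) (hn : 1 ≤ n) :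
    (Measure.pi fun _ : Fin n => ρ) {z |
      (4 * (M * κ / √lam) / n + 2 * (Q * √N) / √n) * (Real.log (2 / η) + 1)
      < ‖specOp (covOp ρ.fst) (invSqrtWeight lam) (empVec z
        - ContinuousLinearMap.adjoint (incl ρ.fst) (target ρ))‖} ≤ ENNReal.ofReal η := by
  have := UniformSpace.secondCountable_of_separable H
  set A := specOp (covOp ρ.fst) (invSqrtWeight lam) with hA
  set ξ : H × ℝ → H := fun z => A (z.2 • z.1) with hξ
  have hξm : StronglyMeasurable ξ := by
    have : Measurable ξ := A.continuous.measurable.comp (measurable_snd.smul measurable_fst)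
    exact this.stronglyMeasurable
  have hs : 0 < √lam := Real.sqrt_pos.2 hlam
  have hmom : BernsteinMoments ρ ξ (Q * √N) (M * κ / √lam) := by
    intro l hl
    have hfm : Measurable fun x : H => ENNReal.ofReal ((κ / √lam) ^ (l - 2) * ‖A x‖ ^ 2) := by
      fun_prop
    calc ∫⁻ z, ENNReal.ofReal (‖ξ z‖ ^ l) ∂ρ
        ≤ ∫⁻ z, ENNReal.ofReal ((κ / √lam) ^ (l - 2) * ‖A z.1‖ ^ 2)
            * ENNReal.ofReal (|z.2| ^ l) ∂ρ := by
          refine lintegral_mono_ae ((ae_norm_fst_le hb).mono fun z hz => ?_)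
          rw [← ENNReal.ofReal_mul (by positivity)]
          refine ENNReal.ofReal_le_ofReal ?_
          have h1 : ‖A z.1‖ ≤ κ / √lam := by
            refine (norm_invSqrt_le hb hlam z.1).trans ?_
            rw [inv_mul_eq_div]
            gcongr
          rw [hξ]
          simp only [map_smul, norm_smul, mul_pow, Real.norm_eq_abs]
          rw [mul_comm]
          gcongr
          calc ‖A z.1‖ ^ l = ‖A z.1‖ ^ (l - 2) * ‖A z.1‖ ^ 2 := by
                rw [← pow_add]; congr 1; omega
            _ ≤ _ := by gcongr
      _ ≤ ENNReal.ofReal (1 / 2 * (l.factorial : ℝ) * M ^ (l - 2) * Q ^ 2)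
          * ∫⁻ x, ENNReal.ofReal ((κ / √lam) ^ (l - 2) * ‖A x‖ ^ 2) ∂ρ.fst :=
          lintegral_mul_pow_le hm hfm hl
      _ ≤ ENNReal.ofReal (1 / 2 * (l.factorial : ℝ) * M ^ (l - 2) * Q ^ 2)
          * (ENNReal.ofReal ((κ / √lam) ^ (l - 2)) * ENNReal.ofReal N) := by
          refine mul_le_mul' le_rfl ?_
          simp_rw [ENNReal.ofReal_mul (show 0 ≤ (κ / √lam) ^ (l - 2) by positivity)]
          rw [lintegral_const_mul' _ _ ENNReal.ofReal_ne_top]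
          exact mul_le_mul' le_rfl ((lintegral_norm_sq_le_effDim hb hlam).trans hN)
      _ = _ := by
          rw [← ENNReal.ofReal_mul (by positivity), ← ENNReal.ofReal_mul (by positivity)]
          congr 1
          rw [mul_pow Q, Real.sq_sqrt hN0, mul_div_assoc, mul_pow M]
          ring
  refine le_trans (measure_mono ?_) (hmom.measure_mean_le (by positivity) (by positivity) hη hξm hn)
  intro z hz
  have h1 : (n : ℝ)⁻¹ • ∑ i, ξ (z i) - ∫ y, ξ y ∂ρ
      = A (empVec z - ContinuousLinearMap.adjoint (incl ρ.fst) (target ρ)) := by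
    rw [hξ, ContinuousLinearMap.integral_comp_comm A (integrable_snd_smul_fst hb hm),
      integral_snd_smul_fst hb hQ hm, map_sub, empVec, map_smul, map_sum]
  rw [Set.mem_ofPred_eq, h1]
  exact hz

/-- The noise of the inputs, in the norm dual to `(T + lam)^{1/2}`. -/
theorem measure_input_noise_le {B N D W : ℝ} (hb : ∀ᵐ x ∂ρ.fst, ‖x‖ ≤ κ) (hκ : 0 < κ)
    (hQ : 0 ≤ Q) (hm : MomentCondition M Q ρ) (hB : ApproxCondition B ρ) {lam : ℝ} (hlam : 0 < lam)
    (hN0 : 0 ≤ N) (hN : effDim (covOp ρ.fst) lam ≤ ENNReal.ofReal N) {w : H}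
    (hD : ‖incl ρ.fst w - target ρ‖ ≤ D) (hW0 : 0 < W) (hW : ‖w‖ ≤ W) (hη : 0 < η) (hn : 1 ≤ n) :
    (Measure.pi fun _ : Fin n => ρ) {z |
      (4 * (κ ^ 2 * W / √lam) / n + 2 * √(3 * ((Q ^ 2 + B ^ 2) * N + κ ^ 2 / lam * D ^ 2)) / √n)
        * (Real.log (2 / η) + 1)
      < ‖specOp (covOp ρ.fst) (invSqrtWeight lam) (empCov z w - covOp ρ.fst w)‖}
      ≤ ENNReal.ofReal η := by
  have := UniformSpace.secondCountable_of_separable H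
  set A := specOp (covOp ρ.fst) (invSqrtWeight lam) with hA
  set S := 3 * ((Q ^ 2 + B ^ 2) * N + κ ^ 2 / lam * D ^ 2) with hS
  have hS0 : 0 ≤ S := by positivity
  set ξ : H × ℝ → H := fun z => A (inner ℝ z.1 w • z.1) with hξ
  have hs : 0 < √lam := Real.sqrt_pos.2 hlam
  have hc : Continuous fun x : H => inner ℝ x w • x :=
    (continuous_id.inner continuous_const).smul continuous_id
  have hξm : StronglyMeasurable ξ := by
    have : Measurable ξ := (A.continuous.comp hc).measurable.comp measurable_fst
    exact this.stronglyMeasurable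
  have hmom : BernsteinMoments ρ ξ (√S) (κ ^ 2 * W / √lam) := by
    refine bernsteinMoments_of_bounded ((ae_norm_fst_le hb).mono fun z hz => ?_) ?_
    · rw [hξ]
      simp only [map_smul, norm_smul]
      calc ‖inner ℝ z.1 w‖ * ‖A z.1‖ ≤ (‖z.1‖ * ‖w‖) * ((√lam)⁻¹ * ‖z.1‖) :=
            mul_le_mul (norm_inner_le_norm _ _) (norm_invSqrt_le hb hlam z.1) (norm_nonneg _)
              (by positivity)
        _ ≤ (κ * W) * ((√lam)⁻¹ * κ) := by gcongr
        _ = _ := by rw [div_eq_mul_inv]; ring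
    · have hfm : Measurable fun x : H => ENNReal.ofReal (inner ℝ w x ^ 2 * ‖A x‖ ^ 2) := by
        fun_prop
      rw [Real.sq_sqrt hS0]
      refine le_trans (le_of_eq ?_) (lintegral_inner_sq_mul_le hb hQ hm hB hlam hN0 hN w hD)
      rw [← lintegral_fst ρ hfm]
      refine lintegral_congr fun z => ?_
      rw [hξ]
      simp only [map_smul, norm_smul, mul_pow, Real.norm_eq_abs, sq_abs]
      rw [real_inner_comm]
  refine le_trans (measure_mono ?_) (hmom.measure_mean_le (by positivity) (by positivity) hη hξm hn)
  intro z hz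
  have hint : Integrable (fun z : H × ℝ => inner ℝ z.1 w • z.1) ρ := by
    refine Integrable.of_bound (C := κ * ‖w‖ * κ)
      (hc.measurable.comp measurable_fst).aestronglyMeasurable
      ((ae_norm_fst_le hb).mono fun z hz => ?_)
    rw [norm_smul]
    calc ‖inner ℝ z.1 w‖ * ‖z.1‖ ≤ ‖z.1‖ * ‖w‖ * ‖z.1‖ := by
          gcongr; exact norm_inner_le_norm _ _
      _ ≤ _ := by gcongr
  have h1 : (n : ℝ)⁻¹ • ∑ i, ξ (z i) - ∫ y, ξ y ∂ρ = A (empCov z w - covOp ρ.fst w) := by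
    rw [hξ, ContinuousLinearMap.integral_comp_comm A hint, integral_rankOne_fst hb, map_sub,
      empCov_eq, smul_apply, sampleOp_apply, map_smul, map_sum]
  rw [Set.mem_ofPred_eq, h1]
  exact hz

theorem ae_forall_norm_fst_le (hb : ∀ᵐ x ∂ρ.fst, ‖x‖ ≤ κ) (n : ℕ) :
    ∀ᵐ z ∂(Measure.pi fun _ : Fin n => ρ), ∀ i, ‖(z i).1‖ ≤ κ :=
  ae_all_iff.2 fun i => (Measure.quasiMeasurePreserving_eval (μ := fun _ : Fin n => ρ) i).ae
    (ae_norm_fst_le hb)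

/-- The noise in the dual norm, from its parts. -/
theorem inner_noise_le {μ : Measure H} [IsProbabilityMeasure μ] (hb : ∀ᵐ x ∂μ, ‖x‖ ≤ κ) {lam : ℝ}
    (hlam : 0 < lam) (f : Lp ℝ 2 μ) (w b Xw : H) {n₁ n₂ D : ℝ}
    (h1 : ‖specOp (covOp μ) (invSqrtWeight lam)
      (b - ContinuousLinearMap.adjoint (incl μ) f)‖ ≤ n₁)
    (h2 : ‖specOp (covOp μ) (invSqrtWeight lam) (Xw - covOp μ w)‖ ≤ n₂)
    (hD : ‖incl μ w - f‖ ≤ D) (y : H) :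
    inner ℝ (b - Xw) y ≤ (n₁ + n₂ + D) * √(inner ℝ y (covOp μ y) + lam * ‖y‖ ^ 2) := by
  have hT := isCompactPos_covOp hb
  have hTC := inner_covOp_self_le hb
  have hI := hT.bddSpec_invSqrt hlam
  have hQ : BddSpec (covOp μ) (sqrtWeight lam) := hT.bddSpec_sqrt hTC
  set q := √(inner ℝ y (covOp μ y) + lam * ‖y‖ ^ 2) with hq
  have hQy : ‖specOp (covOp μ) (sqrtWeight lam) y‖ = q := by
    rw [hq, ← hT.norm_sq_sqrt hTC hlam, Real.sqrt_sq (norm_nonneg _)]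
  have hIQ : specOp (covOp μ) (invSqrtWeight lam) (specOp (covOp μ) (sqrtWeight lam) y) = y := by
    refine hT.ext fun s => ?_
    rw [hT.eigenProj_specOp hI, hT.eigenProj_specOp hQ, smul_smul]
    by_cases hs : eigenProj (covOp μ) s y = 0
    · simp [hs]
    · have hs0 := hT.nonneg_of_ne hs
      have : 0 < √(s + lam) := Real.sqrt_pos.2 (by positivity)
      rw [sqrtWeight, invSqrtWeight, inv_mul_cancel₀ this.ne', one_smul]
  have hdual : ∀ v, |inner ℝ v y| ≤ ‖specOp (covOp μ) (invSqrtWeight lam) v‖ * q := by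
    intro v
    conv_lhs => rw [← hIQ]
    rw [← hT.specOp_symm hI, ← hQy]
    exact abs_real_inner_le_norm _ _
  have hy : ‖incl μ y‖ ≤ q := by
    rw [hq]
    refine Real.le_sqrt_of_sq_le ?_
    rw [norm_incl_sq]
    exact le_add_of_nonneg_right (by positivity)
  have hsplit : b - Xw = (b - ContinuousLinearMap.adjoint (incl μ) f) - (Xw - covOp μ w)
      - ContinuousLinearMap.adjoint (incl μ) (incl μ w - f) := by
    rw [map_sub]
    have : covOp μ w = ContinuousLinearMap.adjoint (incl μ) (incl μ w) := rfl
    rw [this]; abel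
  rw [hsplit, inner_sub_left, inner_sub_left, ContinuousLinearMap.adjoint_inner_left]
  have e1 := (le_abs_self _).trans (hdual (b - ContinuousLinearMap.adjoint (incl μ) f))
  have e2 := (neg_le_abs _).trans (hdual (Xw - covOp μ w))
  have e3 := (neg_le_abs _).trans (abs_real_inner_le_norm (incl μ w - f) (incl μ y))
  have hq0 : 0 ≤ q := Real.sqrt_nonneg _
  have f1 := mul_le_mul_of_nonneg_right h1 hq0
  have f2 := mul_le_mul_of_nonneg_right h2 hq0
  have f3 : ‖incl μ w - f‖ * ‖incl μ y‖ ≤ D * q :=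
    mul_le_mul hD hy (norm_nonneg _) ((norm_nonneg _).trans hD)
  linarith

end Events

/-! ### The error bound with high probability -/

section HighProbability

variable {H : Type*} [NormedAddCommGroup H] [InnerProductSpace ℝ H] [CompleteSpace H]
  [TopologicalSpace.SeparableSpace H] [MeasurableSpace H] [BorelSpace H]
  {ρ : Measure (H × ℝ)} [IsProbabilityMeasure ρ] {κ ζ τ c γ B M Q E F R a lam δ : ℝ} {Λ : Set ℝ}
  {g : ℝ → ℝ → ℝ} {g₀ : Lp ℝ 2 ρ.fst} {n r : ℕ}

/-- The form comparison `T + λ ≤ Δ (T_x + λ)` fails with small probability as soon as the level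
`λ Δ` is of the order `r κ² / n`, where `r` is logarithmic in the effective dimension. -/
theorem measure_not_form_le (hκ : 0 < κ) (hb : ∀ᵐ x ∂ρ.fst, ‖x‖ ≤ κ) (hc : 0 < c) (hγ : 0 ≤ γ)
    (hcap : CapacityCondition c γ ρ.fst) (hlam : 0 < lam) (hr : 1 ≤ r)
    (hrδ : 10 * (c * lam ^ (-γ)) ≤ δ * 2 ^ r) {Δ : ℝ} (hΔ : 130 ≤ Δ)
    (hΔr : 130 * (32 * r * κ ^ 2) ≤ Δ * (n * lam)) :
    (Measure.pi fun _ : Fin n => ρ) {z | (∀ i, ‖(z i).1‖ ≤ κ) ∧ ¬ ∀ v : H,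
      inner ℝ v (covOp ρ.fst v) + lam * ‖v‖ ^ 2
        ≤ Δ * (inner ℝ v (empCov z v) + lam * ‖v‖ ^ 2)} ≤ ENNReal.ofReal (δ / 4) := by
  set N := c * lam ^ (-γ) with hNdef
  have hN0 : 0 ≤ N := by positivity
  have hlam' : 0 < lam * (Δ / 130) := by positivity
  have hle : lam ≤ lam * (Δ / 130) := le_mul_of_one_le_right hlam.le (by linarith)
  have hN : effDim (covOp ρ.fst) (lam * (Δ / 130)) ≤ ENNReal.ofReal N := by
    refine (hcap _ hlam').trans (ENNReal.ofReal_le_ofReal ?_)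
    exact mul_le_mul_of_nonneg_left (Real.rpow_le_rpow_of_nonpos hlam hle (by linarith)) hc.le
  have key := measure_not_inner_covOp_le (n := n) hκ hb hlam' hN0 hN hr (by nlinarith)
  refine (measure_mono ?_).trans (key.trans ?_)
  · rintro z ⟨hz, hv⟩
    refine ⟨hz, fun h => hv fun v => (add_le_add_left (h v) _).trans ?_⟩
    have h1 := (isCompactPos_empCov z).nonneg v
    have h2 : 0 ≤ lam * ‖v‖ ^ 2 := by positivity
    nlinarith
  · rw [← ENNReal.ofReal_add (by positivity) (by positivity)]
    refine ENNReal.ofReal_le_ofReal ?_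
    have h4 : ((1 : ℝ) / 4) ^ r ≤ (1 / 2) ^ r :=
      pow_le_pow_left₀ (by norm_num) (by norm_num) r
    have h2 : 10 * N * (1 / 2) ^ r ≤ δ := by
      calc 10 * N * (1 / 2) ^ r ≤ δ * 2 ^ r * (1 / 2) ^ r := by gcongr
        _ = δ := by rw [mul_assoc, ← mul_pow]; norm_num
    nlinarith

/-- The error bound of the estimator holds with probability at least `1 - δ`: of the four events
involved (comparison of the forms, noise of the labels, noise of the inputs, Hilbert-Schmidt
deviation of the covariance), each fails with probability at most `δ / 4`. -/
theorem measure_not_error_le (hκ : 1 ≤ κ) (hb : ∀ᵐ x ∂ρ.fst, ‖x‖ ≤ κ) (hζ : 0 ≤ ζ) (hζτ : ζ ≤ τ)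
    (hτ : 1 ≤ τ) (hE : 0 ≤ E) (ha0 : 0 ≤ a) (ha : a ≤ 1 / 2) (haζ : a ≤ ζ) (hM : 0 < M)
    (hQ : 0 ≤ Q) (hc : 0 < c) (hγ : 0 ≤ γ) (hm : MomentCondition M Q ρ)
    (hB : ApproxCondition B ρ) (hcap : CapacityCondition c γ ρ.fst)
    (hfam : IsFilterFamily κ τ E F Λ g) (hlam : lam ∈ Λ) (hlam1 : lam ≤ 1)
    (hg₀ : ‖g₀‖ ≤ R) (hg : InSpecDomain (intOp ρ.fst) (holder κ ζ) g₀)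
    (htgt : target ρ = specApply (intOp ρ.fst) (holder κ ζ) g₀) (hn : 1 ≤ n) (hδ : 0 < δ)
    (hr : 1 ≤ r) (hrδ : 10 * (c * lam ^ (-γ)) ≤ δ * 2 ^ r) {Δ : ℝ} (hΔ : 130 ≤ Δ)
    (hΔr : 130 * (32 * r * κ ^ 2) ≤ Δ * (n * lam)) {W : ℝ} (hW0 : 0 < W)
    (hW : (lam ^ (ζ - 1 / 2) + (κ ^ 2 + 1) ^ (ζ - 1 / 2)) * (2 * R) ≤ W) {θ : ℝ}
    (hθ0 : 0 ≤ Real.log (2 / (δ / 4)) + 1)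
    (hθ : Real.log (2 / (δ / 4)) + 1 ≤ θ) {b : ℝ} (hb0 : 0 ≤ b)
    (hbθ : (4 * (M * κ / √lam) / n + 2 * (Q * √(c * lam ^ (-γ))) / √n) * θ
      + (4 * (κ ^ 2 * W / √lam) / n + 2 * √(3 * ((Q ^ 2 + B ^ 2) * (c * lam ^ (-γ))
        + κ ^ 2 / lam * (lam ^ ζ * R) ^ 2)) / √n) * θ + lam ^ ζ * R ≤ b)
    {k : ℝ} (hk : 1 ≤ k) (hdk : 1 < ζ → (4 * κ ^ 2 / n + 2 * κ ^ 2 / √n) * θ ≤ k * lam ∧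
      (4 * κ ^ 2 / n + 2 * κ ^ 2 / √n) * θ ≤ k * lam ^ (ζ - 1 / 2)) :
    (Measure.pi fun _ : Fin n => ρ) {z |
      ¬ (InSpecDomain (intOp ρ.fst) (fun u => u ^ (-a)) (estFun ρ (g lam) z - target ρ) ∧
        ‖specApply (intOp ρ.fst) (fun u => u ^ (-a)) (estFun ρ (g lam) z - target ρ)‖
          ≤ 2 * lam ^ (-a) * Δ ^ (1 - a) * (2 * E * b + biasConst κ ζ F R * lam ^ ζ * k)
            + lam ^ (ζ - a) * R)} ≤ ENNReal.ofReal δ := by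
  have hθ1 : 0 ≤ θ := hθ0.trans hθ
  have hκ0 : 0 < κ := by linarith
  have hl := hfam.pos lam hlam
  have hη : 0 < δ / 4 := by positivity
  set N := c * lam ^ (-γ) with hNdef
  have hN0 : 0 ≤ N := by positivity
  have hN : effDim (covOp ρ.fst) lam ≤ ENNReal.ofReal N := hcap lam hl
  set w := cutTarget ρ.fst κ ζ lam g₀ with hw
  have hR : 0 ≤ R := (norm_nonneg _).trans hg₀
  have hD : ‖incl ρ.fst w - target ρ‖ ≤ lam ^ ζ * R := by
    rw [htgt]
    exact (norm_cutTarget_sub_le hκ hb hζ hl hg).trans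
      (mul_le_mul_of_nonneg_left hg₀ (by positivity))
  have hwW : ‖w‖ ≤ W := by
    refine ((norm_cutTarget_le hκ hb hζ hl hlam1 g₀).trans ?_).trans hW
    gcongr
  have e1 := measure_not_form_le (n := n) hκ0 hb hc hγ hcap hl hr hrδ hΔ hΔr
  have e2 := measure_label_noise_le hκ0 hb hM hQ hm hl hN0 hN hη hn
  have e3 := measure_input_noise_le hb hκ0 hQ hm hB hl hN0 hN hD hW0 hwW hη hn
  have e4 := measure_hilbertSchmidt_deviation_le hκ0 hb hη hn (cutSource ρ.fst κ ζ lam g₀)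
  set S₁ := {z : Fin n → H × ℝ | (∀ i, ‖(z i).1‖ ≤ κ) ∧ ¬ ∀ v : H,
      inner ℝ v (covOp ρ.fst v) + lam * ‖v‖ ^ 2
        ≤ Δ * (inner ℝ v (empCov z v) + lam * ‖v‖ ^ 2)} with hS₁
  set S₂ := {z : Fin n → H × ℝ |
      (4 * (M * κ / √lam) / n + 2 * (Q * √N) / √n) * (Real.log (2 / (δ / 4)) + 1)
      < ‖specOp (covOp ρ.fst) (invSqrtWeight lam) (empVec z
        - ContinuousLinearMap.adjoint (incl ρ.fst) (target ρ))‖} with hS₂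
  set S₃ := {z : Fin n → H × ℝ | (4 * (κ ^ 2 * W / √lam) / n
        + 2 * √(3 * ((Q ^ 2 + B ^ 2) * N + κ ^ 2 / lam * (lam ^ ζ * R) ^ 2)) / √n)
        * (Real.log (2 / (δ / 4)) + 1)
      < ‖specOp (covOp ρ.fst) (invSqrtWeight lam) (empCov z w - covOp ρ.fst w)‖} with hS₃
  set S₄ := {z : Fin n → H × ℝ | ¬ ∀ A : Finset ℝ, ∑ s ∈ A,
      ‖(empCov z - covOp ρ.fst) (unitEigenProj (covOp ρ.fst) (cutSource ρ.fst κ ζ lam g₀) s)‖ ^ 2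
        ≤ ((4 * κ ^ 2 / n + 2 * κ ^ 2 / √n) * (Real.log (2 / (δ / 4)) + 1)) ^ 2} with hS₄
  set P := Measure.pi fun _ : Fin n => ρ with hP
  refine (measure_mono_ae (t := S₁ ∪ S₂ ∪ S₃ ∪ S₄) ?_).trans ?_
  · filter_upwards [ae_forall_norm_fst_le hb n] with z hz hzbad
    by_contra hgood
    refine hzbad ?_
    have hgood' : ((z ∉ S₁ ∧ z ∉ S₂) ∧ z ∉ S₃) ∧ z ∉ S₄ := by
      refine ⟨⟨⟨?_, ?_⟩, ?_⟩, ?_⟩ <;> intro h <;> apply hgood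
      · exact Or.inl (Or.inl (Or.inl h))
      · exact Or.inl (Or.inl (Or.inr h))
      · exact Or.inl (Or.inr h)
      · exact Or.inr h
    obtain ⟨⟨⟨g1, g2⟩, g3⟩, g4⟩ := hgood'
    simp only [hS₁, Set.mem_ofPred_eq, not_and, not_not] at g1
    simp only [hS₂, Set.mem_ofPred_eq, not_lt] at g2
    simp only [hS₃, Set.mem_ofPred_eq, not_lt] at g3
    simp only [hS₄, Set.mem_ofPred_eq, not_not] at g4
    have hu : ∀ y, inner ℝ (empVec z - empCov z w) y
        ≤ b * √(inner ℝ y (covOp ρ.fst y) + lam * ‖y‖ ^ 2) := fun y => by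
      refine (inner_noise_le hb hl (target ρ) w (empVec z) (empCov z w) (g2.trans
        (mul_le_mul_of_nonneg_left hθ ?_)) (g3.trans (mul_le_mul_of_nonneg_left hθ ?_)) hD
        y).trans (mul_le_mul_of_nonneg_right hbθ (Real.sqrt_nonneg _))
      · positivity
      · positivity
    have hd : ∀ A : Finset ℝ, ∑ s ∈ A, ‖(empCov z - covOp ρ.fst) (unitEigenProj (covOp ρ.fst)
        (cutSource ρ.fst κ ζ lam g₀) s)‖ ^ 2 ≤ ((4 * κ ^ 2 / n + 2 * κ ^ 2 / √n) * θ) ^ 2 :=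
      fun A => by
        refine (g4 A).trans ?_
        rw [mul_pow, mul_pow]
        exact mul_le_mul_of_nonneg_left (pow_le_pow_left₀ hθ0 hθ 2) (sq_nonneg _)
    have := norm_specApply_estVec_sub_le hκ hb hζ hζτ hτ hE ha0 ha haζ hg₀ hg hfam hlam hlam1 hz
      (by linarith) (g1 hz) hb0 hu hk (by positivity) hd hdk
    rw [htgt]
    exact this
  · calc P (S₁ ∪ S₂ ∪ S₃ ∪ S₄) ≤ P S₁ + P S₂ + P S₃ + P S₄ :=
        (measure_union_le _ _).trans (add_le_add_left ((measure_union_le _ _).trans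
          (add_le_add_left (measure_union_le _ _) _)) _)
      _ ≤ ENNReal.ofReal (δ / 4) + ENNReal.ofReal (δ / 4) + ENNReal.ofReal (δ / 4)
          + ENNReal.ofReal (δ / 4) := by gcongr
      _ = ENNReal.ofReal δ := by
        rw [← ENNReal.ofReal_add hη.le hη.le, ← ENNReal.ofReal_add (by positivity) hη.le,
          ← ENNReal.ofReal_add (by positivity) hη.le]
        congr 1
        ring

end HighProbability

/-! ### Rates -/

section Rates

variable {κ ζ γ c B M Q E F R a δ : ℝ} {n r : ℕ}

theorem one_le_log_six_div (hδ : 0 < δ) (hδ1 : δ < 1) : 1 ≤ Real.log (6 / δ) := by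
  rw [Real.le_log_iff_exp_le (by positivity)]
  have h1 := Real.exp_one_lt_d9
  have h2 : 6 ≤ 6 / δ := by
    rw [le_div_iff₀ hδ]; linarith
  linarith

theorem log_two_div_add_one_le (hδ : 0 < δ) (hδ1 : δ < 1) :
    Real.log (2 / (δ / 4)) + 1 ≤ 3 * Real.log (6 / δ) := by
  have h1 : (2 : ℝ) / (δ / 4) = 6 / δ * (4 / 3) := by field_simp; norm_num
  have h2 : Real.log (4 / 3) ≤ 4 / 3 - 1 := Real.log_le_sub_one_of_pos (by norm_num)
  have h3 := one_le_log_six_div hδ hδ1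
  rw [h1, Real.log_mul (by positivity) (by norm_num)]
  linarith

theorem regParam_pos (ζ γ : ℝ) (hn : 1 ≤ n) : 0 < regParam ζ γ n :=
  Real.rpow_pos_of_pos (by exact_mod_cast hn) _

theorem regParam_le_one (ζ γ : ℝ) (hn : 1 ≤ n) : regParam ζ γ n ≤ 1 :=
  Real.rpow_le_one_of_one_le_of_nonpos (by exact_mod_cast hn)
    (neg_nonpos.2 (one_div_nonneg.2 (le_max_of_le_left zero_le_one)))

theorem regParam_rpow (ζ γ s : ℝ) (n : ℕ) :
    regParam ζ γ n ^ s = (n : ℝ) ^ (-(s / max 1 (2 * ζ + γ))) := by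
  rw [regParam, ← Real.rpow_mul (Nat.cast_nonneg n)]
  congr 1
  ring

/-- The choice of `λ` balances the sample size: `n λ ^ s ≥ 1` for the exponents
`s ≤ max 1 (2 ζ + γ)`. All noise terms are compared with `λ ^ ζ` in this way. -/
theorem one_le_mul_regParam_rpow {s : ℝ} (hn : 1 ≤ n) (hs : s ≤ max 1 (2 * ζ + γ)) :
    1 ≤ n * regParam ζ γ n ^ s := by
  have hn1 : (1 : ℝ) ≤ n := by exact_mod_cast hn
  have hp : 0 < max 1 (2 * ζ + γ) := lt_max_of_lt_left one_pos
  rw [regParam_rpow]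
  nth_rewrite 1 [← Real.rpow_one (n : ℝ)]
  rw [← Real.rpow_add (by linarith)]
  refine Real.one_le_rpow hn1 ?_
  have : s / max 1 (2 * ζ + γ) ≤ 1 := (div_le_one hp).2 hs
  linarith

theorem mul_rpow_le {x lam s t : ℝ} (hlam : 0 < lam) (h : 1 ≤ x * lam ^ s) :
    lam ^ t ≤ x * lam ^ (s + t) := by
  rw [Real.rpow_add hlam, ← mul_assoc]
  exact le_mul_of_one_le_left (by positivity) h

/-- The number `r` of factors in the moment argument for the comparison of `T` and `T_x` is
logarithmic in `1 / δ` and in the effective dimension, which is at most `c n ^ γ`. -/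
theorem exists_pow_ge (hc : 0 < c) (hγ : 0 ≤ γ) (hn : 1 ≤ n) (hδ : 0 < δ) (hδ1 : δ < 1) :
    ∃ r : ℕ, 1 ≤ r ∧ 10 * (c * regParam ζ γ n ^ (-γ)) ≤ δ * 2 ^ r ∧
      (r : ℝ) ≤ (6 + 2 * Real.log (max c 1)) * (Real.log (6 / δ) + Real.log ((n : ℝ) ^ γ)) := by
  have hn1 : (1 : ℝ) ≤ n := by exact_mod_cast hn
  have hnγ : 1 ≤ (n : ℝ) ^ γ := Real.one_le_rpow hn1 hγ
  have hm : 1 ≤ max c 1 := le_max_right _ _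
  have hm0 : 0 ≤ Real.log (max c 1) := Real.log_nonneg hm
  have hL : 0 ≤ Real.log ((n : ℝ) ^ γ) := Real.log_nonneg hnγ
  have hℓ := one_le_log_six_div hδ hδ1
  set X := 6 / δ * (5 / 3) * max c 1 * (n : ℝ) ^ γ with hX
  have hX0 : 0 < X := by positivity
  have hlogX : Real.log X
      = Real.log (6 / δ) + Real.log (5 / 3) + Real.log (max c 1) + Real.log ((n : ℝ) ^ γ) := by
    rw [hX, Real.log_mul (by positivity) (by positivity),
      Real.log_mul (by positivity) (by positivity), Real.log_mul (by positivity) (by positivity)]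
  have h53 : Real.log (5 / 3) ≤ 5 / 3 - 1 := Real.log_le_sub_one_of_pos (by norm_num)
  have h53' : 0 ≤ Real.log (5 / 3) := Real.log_nonneg (by norm_num)
  refine ⟨⌈2 * Real.log X⌉₊, ?_, ?_, ?_⟩
  · exact Nat.one_le_ceil_iff.2 (by linarith)
  · have h2 : Real.exp (1 / 2) ≤ 2 := by
      have h := Real.exp_one_lt_d9
      have h' : Real.exp (1 / 2) ^ 2 = Real.exp 1 := by rw [← Real.exp_nat_mul]; norm_num
      nlinarith [Real.exp_pos (1 / 2 : ℝ)]
    have h3 : X ≤ 2 ^ ⌈2 * Real.log X⌉₊ := by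
      calc X = Real.exp (Real.log X) := (Real.exp_log hX0).symm
        _ ≤ Real.exp (⌈2 * Real.log X⌉₊ * (1 / 2)) := by
          refine Real.exp_le_exp.2 ?_
          have := Nat.le_ceil (2 * Real.log X)
          linarith
        _ = Real.exp (1 / 2) ^ ⌈2 * Real.log X⌉₊ := Real.exp_nat_mul _ _
        _ ≤ _ := pow_le_pow_left₀ (Real.exp_pos _).le h2 _
    have h4 : regParam ζ γ n ^ (-γ) ≤ (n : ℝ) ^ γ := by
      rw [regParam_rpow]
      refine Real.rpow_le_rpow_of_exponent_le hn1 ?_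
      rw [neg_div, neg_neg]
      exact div_le_self hγ (le_max_left _ _)
    calc 10 * (c * regParam ζ γ n ^ (-γ)) ≤ 10 * (max c 1 * (n : ℝ) ^ γ) := by
          gcongr
          · exact Real.rpow_nonneg (regParam_pos ζ γ hn).le _
          · exact le_max_left _ _
      _ = δ * X := by rw [hX]; field_simp; norm_num
      _ ≤ _ := mul_le_mul_of_nonneg_left h3 hδ.le
  · have := (Nat.ceil_lt_add_one (a := 2 * Real.log X) (by linarith)).le
    nlinarith [mul_nonneg hm0 (by linarith : 0 ≤ Real.log (6 / δ) - 1), mul_nonneg hm0 hL]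

/-- The constant in the comparison of `T + λ` with `T_x + λ`. For `2 ζ + γ ≤ 1` the last factor is
`1`, because `0⁻¹ = 0`. -/
def formConst (κ c ζ γ : ℝ) : ℝ :=
  130 * (32 * κ ^ 2) * (6 + 2 * Real.log (max c 1)) * (1 + (1 - 1 / max 1 (2 * ζ + γ))⁻¹)

theorem le_formConst (hκ : 1 ≤ κ) : 130 ≤ formConst κ c ζ γ := by
  have hm0 : 0 ≤ Real.log (max c 1) := Real.log_nonneg (le_max_right _ _)
  have hη : 0 ≤ (1 - 1 / max 1 (2 * ζ + γ))⁻¹ :=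
    inv_nonneg.2 (sub_nonneg.2 ((div_le_one (lt_max_of_lt_left one_pos)).2 (le_max_left _ _)))
  have hκ2 : 1 ≤ κ ^ 2 := one_le_pow₀ hκ
  have h1 : 130 ≤ 130 * (32 * κ ^ 2) * (6 + 2 * Real.log (max c 1)) := by nlinarith
  exact h1.trans (le_mul_of_one_le_right (by linarith) (by linarith))

/-- The logarithmic factor that enters the rate with the exponent `1 - a`. -/
def logFactor (ζ γ : ℝ) (n : ℕ) (δ : ℝ) : ℝ :=
  if 1 < 2 * ζ + γ then Real.log (6 / δ) else Real.log (6 / δ) + Real.log ((n : ℝ) ^ γ)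

theorem one_le_logFactor (hγ : 0 ≤ γ) (hn : 1 ≤ n) (hδ : 0 < δ) (hδ1 : δ < 1) :
    1 ≤ logFactor ζ γ n δ := by
  have hℓ := one_le_log_six_div hδ hδ1
  have hL : 0 ≤ Real.log ((n : ℝ) ^ γ) :=
    Real.log_nonneg (Real.one_le_rpow (by exact_mod_cast hn) hγ)
  unfold logFactor
  split_ifs <;> linarith

/-- If `2 ζ + γ > 1`, then `n λ` is a positive power of `n`, which absorbs `log n`. -/
theorem log_le_logFactor_mul (hγ : γ ∈ Set.Icc (0 : ℝ) 1) (hn : 1 ≤ n) (hδ : 0 < δ) (hδ1 : δ < 1) :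
    Real.log (6 / δ) + Real.log ((n : ℝ) ^ γ)
      ≤ (1 + (1 - 1 / max 1 (2 * ζ + γ))⁻¹) * logFactor ζ γ n δ * (n * regParam ζ γ n) := by
  have hn1 : (1 : ℝ) ≤ n := by exact_mod_cast hn
  have hℓ := one_le_log_six_div hδ hδ1
  have hnl : (n : ℝ) * regParam ζ γ n = (n : ℝ) ^ (1 - 1 / max 1 (2 * ζ + γ)) := by
    rw [regParam, sub_eq_add_neg, Real.rpow_add (by linarith), Real.rpow_one]
  rw [hnl]
  unfold logFactor
  split_ifs with h
  · rw [max_eq_right h.le]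
    set η := 1 - 1 / (2 * ζ + γ) with hη
    have hη0 : 0 < η := by
      rw [hη, sub_pos, div_lt_one (by linarith)]
      exact h
    have h1 : Real.log n ≤ (n : ℝ) ^ η / η := Real.log_le_rpow_div (by linarith) hη0
    have h2 : 1 ≤ (n : ℝ) ^ η := Real.one_le_rpow hn1 hη0.le
    have h3 : Real.log ((n : ℝ) ^ γ) ≤ η⁻¹ * (n : ℝ) ^ η := by
      rw [Real.log_rpow (by linarith)]
      have : γ * Real.log n ≤ Real.log n := mul_le_of_le_one_left (Real.log_nonneg hn1) hγ.2
      refine (this.trans h1).trans_eq ?_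
      rw [div_eq_inv_mul]
    have h4 : η⁻¹ * (n : ℝ) ^ η ≤ Real.log (6 / δ) * (η⁻¹ * (n : ℝ) ^ η) :=
      le_mul_of_one_le_left (by positivity) hℓ
    have h5 : Real.log (6 / δ) ≤ Real.log (6 / δ) * (n : ℝ) ^ η :=
      le_mul_of_one_le_right (by linarith) h2
    linarith
  · rw [max_eq_left (not_lt.1 h)]
    simp

/-- `λ ^ (ζ - a)` and the logarithmic factors combine to the rate. -/
theorem regParam_rpow_mul_eq_rate (hδ : 0 < δ) (hδ1 : δ < 1) :
    regParam ζ γ n ^ (ζ - a) * (Real.log (6 / δ) * logFactor ζ γ n δ ^ (1 - a))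
      = rate ζ γ a n δ := by
  have hℓ := one_le_log_six_div hδ hδ1
  unfold logFactor rate
  rw [regParam_rpow]
  split_ifs with h
  · rw [max_eq_right h.le, show 2 - a = 1 + (1 - a) by ring,
      Real.rpow_add (by linarith) 1 (1 - a), Real.rpow_one]
  · rw [max_eq_left (not_lt.1 h), div_one, mul_assoc]

/-- The constant in the bound for the noise. -/
def noiseConst (κ c ζ M Q B R : ℝ) : ℝ :=
  3 * (4 * (M * κ) + 2 * (Q * √c) + 4 * κ ^ 2 * (2 * R * (1 + (κ ^ 2 + 1) ^ (ζ - 1 / 2)) + 1)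
    + 2 * √(3 * ((Q ^ 2 + B ^ 2) * c + κ ^ 2 * R ^ 2))) + R

theorem noiseConst_nonneg (hκ : 0 ≤ κ) (hM : 0 ≤ M) (hQ : 0 ≤ Q) (hR : 0 ≤ R) :
    0 ≤ noiseConst κ c ζ M Q B R := by
  unfold noiseConst
  positivity

theorem sqrt_div_sqrt_le_mul_rpow {x y A lam : ℝ} (hx : 0 < x) (hlam : 0 < lam)
    (h : y ≤ A * (x * lam ^ (2 * ζ))) : √y / √x ≤ √A * lam ^ ζ := by
  have hx' : 0 < √x := Real.sqrt_pos.2 hx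
  rw [div_le_iff₀ hx']
  refine (Real.sqrt_le_sqrt h).trans_eq ?_
  rw [mul_comm 2 ζ, Real.rpow_mul hlam.le, Real.rpow_ofNat, Real.sqrt_mul' A (by positivity),
    Real.sqrt_mul hx.le, Real.sqrt_sq (by positivity)]
  ring

/-- Every part of the noise is of the order `λ ^ ζ`, up to the factor `log (6 / δ)`. -/
theorem noise_le (hκ : 0 ≤ κ) (hγ : 0 ≤ γ) (hc : 0 < c) (hM : 0 ≤ M) (hQ : 0 ≤ Q)
    (hR : 0 ≤ R) (hn : 1 ≤ n) {lam ℓ : ℝ} (hlam : lam = regParam ζ γ n) (hℓ : 1 ≤ ℓ) :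
    (4 * (M * κ / √lam) / n + 2 * (Q * √(c * lam ^ (-γ))) / √n) * (3 * ℓ)
      + (4 * (κ ^ 2 * ((lam ^ (ζ - 1 / 2) + (κ ^ 2 + 1) ^ (ζ - 1 / 2)) * (2 * R) + 1) / √lam) / n
        + 2 * √(3 * ((Q ^ 2 + B ^ 2) * (c * lam ^ (-γ))
        + κ ^ 2 / lam * (lam ^ ζ * R) ^ 2)) / √n) * (3 * ℓ) + lam ^ ζ * R
      ≤ noiseConst κ c ζ M Q B R * lam ^ ζ * ℓ := by
  have hn0 : (0 : ℝ) < n := by exact_mod_cast hn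
  have hl : 0 < lam := hlam ▸ regParam_pos ζ γ hn
  have hl1 : lam ≤ 1 := hlam ▸ regParam_le_one ζ γ hn
  have base : ∀ s t : ℝ, s ≤ max 1 (2 * ζ + γ) → lam ^ t ≤ n * lam ^ (s + t) := fun s t hs =>
    mul_rpow_le hl (hlam ▸ one_le_mul_regParam_rpow hn hs)
  have hsq : √lam = lam ^ (1 / 2 : ℝ) := Real.sqrt_eq_rpow lam
  -- `1 / (n √λ) ≤ λ ^ ζ`, since `ζ + 1/2 ≤ max 1 (2 ζ)`.
  have h1 : 1 / √lam / n ≤ lam ^ ζ := by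
    have h := base (ζ + 1 / 2) (-(1 / 2)) (by
      rcases le_total ζ (1 / 2) with h | h
      · exact le_max_of_le_left (by linarith)
      · exact le_max_of_le_right (by linarith))
    rw [div_le_iff₀ hn0, hsq, one_div, ← Real.rpow_neg hl.le, mul_comm (lam ^ ζ)]
    refine h.trans_eq ?_
    congr 2
    ring
  have h2 : lam ^ (ζ - 1 / 2) / √lam / n ≤ lam ^ ζ := by
    have h := base 1 (ζ - 1) (le_max_left _ _)
    rw [div_le_iff₀ hn0, hsq, ← Real.rpow_sub hl, mul_comm (lam ^ ζ),
      show ζ - 1 / 2 - 1 / 2 = ζ - 1 by ring]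
    rwa [add_sub_cancel] at h
  have hNn : lam ^ (-γ) ≤ n * lam ^ (2 * ζ) := by
    have h := base (2 * ζ + γ) (-γ) (le_max_right _ _)
    rwa [add_neg_cancel_right] at h
  have hDn : lam ^ (2 * ζ) / lam ≤ n * lam ^ (2 * ζ) := by
    have h := base 1 (2 * ζ - 1) (le_max_left _ _)
    rwa [add_sub_cancel, Real.rpow_sub hl, Real.rpow_one] at h
  have h3 : √(c * lam ^ (-γ)) / √n ≤ √c * lam ^ ζ :=
    sqrt_div_sqrt_le_mul_rpow hn0 hl (mul_le_mul_of_nonneg_left hNn hc.le)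
  have h4 : √(3 * ((Q ^ 2 + B ^ 2) * (c * lam ^ (-γ)) + κ ^ 2 / lam * (lam ^ ζ * R) ^ 2)) / √n
      ≤ √(3 * ((Q ^ 2 + B ^ 2) * c + κ ^ 2 * R ^ 2)) * lam ^ ζ := by
    refine sqrt_div_sqrt_le_mul_rpow hn0 hl ?_
    have e1 : κ ^ 2 / lam * (lam ^ ζ * R) ^ 2 = κ ^ 2 * R ^ 2 * (lam ^ (2 * ζ) / lam) := by
      rw [mul_comm 2 ζ, Real.rpow_mul hl.le, Real.rpow_ofNat]
      field_simp
    rw [e1]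
    have h5 : κ ^ 2 * R ^ 2 * (lam ^ (2 * ζ) / lam) ≤ κ ^ 2 * R ^ 2 * (n * lam ^ (2 * ζ)) :=
      mul_le_mul_of_nonneg_left hDn (by positivity)
    have h6 : (Q ^ 2 + B ^ 2) * (c * lam ^ (-γ)) ≤ (Q ^ 2 + B ^ 2) * (c * (n * lam ^ (2 * ζ))) := by
      gcongr
    linarith
  have hlz : 0 < lam ^ ζ := by positivity
  set A := (κ ^ 2 + 1) ^ (ζ - 1 / 2) with hA
  have hA0 : 0 ≤ A := by positivity
  set V := √(3 * ((Q ^ 2 + B ^ 2) * (c * lam ^ (-γ)) + κ ^ 2 / lam * (lam ^ ζ * R) ^ 2)) with hV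
  set V' := √(3 * ((Q ^ 2 + B ^ 2) * c + κ ^ 2 * R ^ 2)) with hV'
  have k1 : 4 * (M * κ / √lam) / n ≤ 4 * (M * κ) * lam ^ ζ := by
    have := mul_le_mul_of_nonneg_left h1 (by positivity : 0 ≤ 4 * (M * κ))
    refine (le_of_eq ?_).trans this
    ring
  have k2 : 2 * (Q * √(c * lam ^ (-γ))) / √n ≤ 2 * (Q * √c) * lam ^ ζ := by
    have := mul_le_mul_of_nonneg_left h3 (by positivity : 0 ≤ 2 * Q)
    refine (le_of_eq ?_).trans (this.trans_eq ?_) <;> ring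
  have k3 : 4 * (κ ^ 2 * ((lam ^ (ζ - 1 / 2) + A) * (2 * R) + 1) / √lam) / n
      ≤ 4 * κ ^ 2 * (2 * R * (1 + A) + 1) * lam ^ ζ := by
    have q1 := mul_le_mul_of_nonneg_left h1 (by positivity : 0 ≤ 4 * κ ^ 2 * (2 * R * A + 1))
    have q2 := mul_le_mul_of_nonneg_left h2 (by positivity : 0 ≤ 4 * κ ^ 2 * (2 * R))
    calc _ = 4 * κ ^ 2 * (2 * R * A + 1) * (1 / √lam / n)
          + 4 * κ ^ 2 * (2 * R) * (lam ^ (ζ - 1 / 2) / √lam / n) := by ring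
      _ ≤ _ := add_le_add q1 q2
      _ = _ := by ring
  have k4 : 2 * V / √n ≤ 2 * V' * lam ^ ζ := by
    have := mul_le_mul_of_nonneg_left h4 (by positivity : (0 : ℝ) ≤ 2)
    refine (le_of_eq ?_).trans (this.trans_eq ?_) <;> ring
  have k5 : lam ^ ζ * R ≤ R * lam ^ ζ * ℓ := by
    rw [mul_comm]
    exact le_mul_of_one_le_right (by positivity) hℓ
  have hℓ3 : 0 ≤ 3 * ℓ := by linarith
  calc _ ≤ (4 * (M * κ) * lam ^ ζ + 2 * (Q * √c) * lam ^ ζ) * (3 * ℓ)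
        + (4 * κ ^ 2 * (2 * R * (1 + A) + 1) * lam ^ ζ + 2 * V' * lam ^ ζ) * (3 * ℓ)
        + R * lam ^ ζ * ℓ := by
        gcongr
    _ = _ := by
      unfold noiseConst
      ring

/-- For `ζ > 1` the Hilbert-Schmidt deviation, of order `n ^ (-1/2)`, is dominated by `λ` and by
`λ ^ (ζ - 1/2)`. -/
theorem deviation_le (hγ : 0 ≤ γ) (hζ : 1 < ζ) (hn : 1 ≤ n) {lam θ : ℝ}
    (hlam : lam = regParam ζ γ n) (hθ : 0 ≤ θ) :
    (4 * κ ^ 2 / n + 2 * κ ^ 2 / √n) * θ ≤ 6 * κ ^ 2 * θ * lam ∧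
      (4 * κ ^ 2 / n + 2 * κ ^ 2 / √n) * θ ≤ 6 * κ ^ 2 * θ * lam ^ (ζ - 1 / 2) := by
  have hn1 : (1 : ℝ) ≤ n := by exact_mod_cast hn
  have hn0 : (0 : ℝ) < n := by linarith
  have hl : 0 < lam := hlam ▸ regParam_pos ζ γ hn
  have hs : 0 < √(n : ℝ) := Real.sqrt_pos.2 hn0
  have h0 : 1 / (n : ℝ) ≤ 1 / √n := by
    refine one_div_le_one_div_of_le hs ?_
    rw [Real.sqrt_le_left hn0.le]
    nlinarith
  have h1 : (4 * κ ^ 2 / n + 2 * κ ^ 2 / √n) * θ ≤ 6 * κ ^ 2 * θ * (1 / √n) := by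
    have := mul_le_mul_of_nonneg_left h0 (by positivity : 0 ≤ 4 * κ ^ 2 * θ)
    calc _ = 4 * κ ^ 2 * θ * (1 / n) + 2 * κ ^ 2 * θ * (1 / √n) := by ring
      _ ≤ 4 * κ ^ 2 * θ * (1 / √n) + 2 * κ ^ 2 * θ * (1 / √n) := by linarith
      _ = _ := by ring
  have h2 : ∀ t : ℝ, 2 * t ≤ max 1 (2 * ζ + γ) → 1 / √(n : ℝ) ≤ lam ^ t := fun t ht => by
    have h := one_le_mul_regParam_rpow hn ht
    rw [← hlam, mul_comm 2 t, Real.rpow_mul hl.le, Real.rpow_ofNat] at h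
    rw [div_le_iff₀ hs]
    have h' : √1 ≤ √((lam ^ t) ^ 2 * n) := Real.sqrt_le_sqrt (by linarith)
    rwa [Real.sqrt_one, Real.sqrt_mul (sq_nonneg _), Real.sqrt_sq (by positivity)] at h'
  have hc : 0 ≤ 6 * κ ^ 2 * θ := by positivity
  refine ⟨h1.trans (mul_le_mul_of_nonneg_left ?_ hc), h1.trans (mul_le_mul_of_nonneg_left ?_ hc)⟩
  · simpa using h2 1 (le_max_of_le_right (by linarith))
  · exact h2 _ (le_max_of_le_right (by linarith))

/-- The constant of the theorem. The summand `1` only serves to make it positive. -/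
def rateConst (κ c γ ζ B M Q R E F a : ℝ) : ℝ :=
  (2 * (2 * E * noiseConst κ c ζ M Q B R + 18 * κ ^ 2 * biasConst κ ζ F R) + R)
    * formConst κ c ζ γ ^ (1 - a) + 1

theorem rateConst_pos (hκ : 1 ≤ κ) (hζ : 0 ≤ ζ) (hM : 0 ≤ M) (hQ : 0 ≤ Q) (hR : 0 ≤ R)
    (hE : 0 ≤ E) : 0 < rateConst κ c γ ζ B M Q R E F a := by
  have h1 := noiseConst_nonneg (c := c) (ζ := ζ) (B := B) (by linarith : 0 ≤ κ) hM hQ hR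
  have h2 := biasConst_nonneg (κ := κ) (F := F) hζ hR
  have h3 : 0 ≤ formConst κ c ζ γ := by linarith [le_formConst (c := c) (ζ := ζ) (γ := γ) hκ]
  unfold rateConst
  positivity

theorem error_le_rateConst_mul_rate (hκ : 1 ≤ κ) (hγ : 0 ≤ γ) (hR : 0 ≤ R) (ha : a ≤ 1 / 2)
    (hn : 1 ≤ n) (hδ : 0 < δ) (hδ1 : δ < 1) {lam ℓ : ℝ} (hlam : lam = regParam ζ γ n) (hℓ : ℓ = Real.log (6 / δ)) :
    2 * lam ^ (-a) * (formConst κ c ζ γ * logFactor ζ γ n δ) ^ (1 - a)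
        * (2 * E * (noiseConst κ c ζ M Q B R * lam ^ ζ * ℓ)
          + biasConst κ ζ F R * lam ^ ζ * (6 * κ ^ 2 * (3 * ℓ))) + lam ^ (ζ - a) * R
      ≤ rateConst κ c γ ζ B M Q R E F a * rate ζ γ a n δ := by
  have hl : 0 < lam := hlam ▸ regParam_pos ζ γ hn
  have hℓ1 : 1 ≤ ℓ := hℓ ▸ one_le_log_six_div hδ hδ1
  have hy := one_le_logFactor (ζ := ζ) hγ hn hδ hδ1
  have hD := le_formConst (c := c) (ζ := ζ) (γ := γ) hκ
  rw [← regParam_rpow_mul_eq_rate (a := a) hδ hδ1, ← hlam, ← hℓ]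
  set y := logFactor ζ γ n δ with hydef
  set D := formConst κ c ζ γ with hDdef
  have hD1 : 1 ≤ D ^ (1 - a) := Real.one_le_rpow (by linarith) (by linarith)
  have hy1 : 1 ≤ y ^ (1 - a) := Real.one_le_rpow hy (by linarith)
  rw [Real.mul_rpow (by linarith) (by linarith)]
  have hexp : lam ^ (ζ - a) = lam ^ (-a) * lam ^ ζ := by
    rw [← Real.rpow_add hl]
    congr 1
    ring
  have hp : 0 < lam ^ (ζ - a) := by positivity
  set S := lam ^ (ζ - a) * (ℓ * y ^ (1 - a)) with hS
  have hSp : 0 ≤ S := by positivity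
  have h1 : lam ^ (ζ - a) * R ≤ R * D ^ (1 - a) * S := by
    have : 1 ≤ D ^ (1 - a) * (ℓ * y ^ (1 - a)) :=
      one_le_mul_of_one_le_of_one_le hD1 (one_le_mul_of_one_le_of_one_le hℓ1 hy1)
    have := le_mul_of_one_le_right (by positivity : 0 ≤ lam ^ (ζ - a) * R) this
    refine this.trans_eq ?_
    rw [hS]
    ring
  calc _ = 2 * (2 * E * noiseConst κ c ζ M Q B R + 18 * κ ^ 2 * biasConst κ ζ F R)
          * D ^ (1 - a) * S + lam ^ (ζ - a) * R := by
        rw [hS, hexp]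
        ring
    _ ≤ 2 * (2 * E * noiseConst κ c ζ M Q B R + 18 * κ ^ 2 * biasConst κ ζ F R)
          * D ^ (1 - a) * S + R * D ^ (1 - a) * S + S := by linarith
    _ = _ := by
        rw [rateConst, ← hDdef]
        ring

end Rates

end SpectralAlg

end

theorem corollary4p2 (κ c γ ζ τ B M Q R E F a t : ℝ)
    (hκ : 1 ≤ κ) (hc : 0 < c) (hγ : γ ∈ Set.Icc (0 : ℝ) 1) (hτ : 1 ≤ τ)
    (hζ : ζ ∈ Set.Icc (0 : ℝ) τ) (hB : 0 ≤ B) (hM : 0 < M) (hQ : 0 < Q) (hR : 0 ≤ R)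
    (hE : 0 < E) (hF : 0 < F) (ha : a ∈ Set.Icc (0 : ℝ) (min (1 / 2) ζ)) :
    ∃ C : ℝ, 0 < C ∧
      ∀ (H : Type*) [NormedAddCommGroup H] [InnerProductSpace ℝ H] [CompleteSpace H]
        [TopologicalSpace.SeparableSpace H] [MeasurableSpace H] [BorelSpace H]
        (ρ : MeasureTheory.Measure (H × ℝ)) [MeasureTheory.IsProbabilityMeasure ρ]
        (Λ : Set ℝ) (g : ℝ → ℝ → ℝ),
        SpectralAlg.BoundedInput κ ρ.fst →
        ‖SpectralAlg.covOp ρ.fst‖ = t →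
        SpectralAlg.MomentCondition M Q ρ →
        SpectralAlg.ApproxCondition B ρ →
        SpectralAlg.SourceCondition (SpectralAlg.holder κ ζ) R ρ →
        SpectralAlg.CapacityCondition c γ ρ.fst →
        SpectralAlg.IsFilterFamily κ τ E F Λ g →
        ∀ n : ℕ, 1 ≤ n → SpectralAlg.regParam ζ γ n ∈ Λ →
        ∀ δ : ℝ, 0 < δ → δ < 1 →
          (MeasureTheory.Measure.pi fun _ : Fin n => ρ)
            {z | ¬ (SpectralAlg.InSpecDomain (SpectralAlg.intOp ρ.fst) (fun u => u ^ (-a))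
                  (SpectralAlg.estFun ρ (g (SpectralAlg.regParam ζ γ n)) z - SpectralAlg.target ρ) ∧
                ‖SpectralAlg.specApply (SpectralAlg.intOp ρ.fst) (fun u => u ^ (-a))
                  (SpectralAlg.estFun ρ (g (SpectralAlg.regParam ζ γ n)) z - SpectralAlg.target ρ)‖
                  ≤ C * SpectralAlg.rate ζ γ a n δ)}
            ≤ ENNReal.ofReal δ := by
  refine ⟨SpectralAlg.rateConst κ c γ ζ B M Q R E F a,
    SpectralAlg.rateConst_pos hκ hζ.1 hM.le hQ.le hR hE.le, ?_⟩
  intro H _ _ _ _ _ _ ρ _ Λ g hbd _ hm hB' hsrc hcap hfam n hn hlam δ hδ hδ1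
  obtain ⟨g₀, hg₀, hg, htgt⟩ := hsrc
  have hκ0 : 0 ≤ κ := by linarith
  have hb := hbd.norm_le hκ0
  have ha2 : a ≤ 1 / 2 := ha.2.trans (min_le_left _ _)
  have haζ : a ≤ ζ := ha.2.trans (min_le_right _ _)
  have hl := SpectralAlg.regParam_pos ζ γ hn
  have hℓ := SpectralAlg.one_le_log_six_div hδ hδ1
  have hy := SpectralAlg.one_le_logFactor (ζ := ζ) hγ.1 hn hδ hδ1
  have hD := SpectralAlg.le_formConst (c := c) (ζ := ζ) (γ := γ) hκ
  have hlog := SpectralAlg.log_le_logFactor_mul (ζ := ζ) hγ hn hδ hδ1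
  obtain ⟨r, hr, hrδ, hrle⟩ := SpectralAlg.exists_pow_ge (ζ := ζ) hc hγ.1 hn hδ hδ1
  have hκ2 : 1 ≤ κ ^ 2 := one_le_pow₀ hκ
  have hΔr : 130 * (32 * r * κ ^ 2)
      ≤ SpectralAlg.formConst κ c ζ γ * SpectralAlg.logFactor ζ γ n δ
        * (n * SpectralAlg.regParam ζ γ n) := by
    have hm0 : 0 ≤ Real.log (max c 1) := Real.log_nonneg (le_max_right _ _)
    have h1 := hrle.trans (mul_le_mul_of_nonneg_left hlog (by positivity))
    have h2 := mul_le_mul_of_nonneg_left h1 (by positivity : 0 ≤ 130 * (32 * κ ^ 2))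
    unfold SpectralAlg.formConst
    linarith
  have hW0 : 0 ≤ (SpectralAlg.regParam ζ γ n ^ (ζ - 1 / 2) + (κ ^ 2 + 1) ^ (ζ - 1 / 2))
      * (2 * R) := by positivity
  have hθ0 : 0 ≤ Real.log (2 / (δ / 4)) + 1 := by
    have : 1 ≤ 2 / (δ / 4) := by rw [le_div_iff₀ (by positivity)]; linarith
    linarith [Real.log_nonneg this]
  refine (MeasureTheory.measure_mono fun z hz => ?_).trans
    (SpectralAlg.measure_not_error_le (a := a) hκ hb hζ.1 hζ.2 hτ hE.le ha.1 ha2 haζ hM hQ.le hc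
      hγ.1 hm hB' hcap hfam hlam (SpectralAlg.regParam_le_one ζ γ hn) hg₀ hg htgt hn hδ hr hrδ
      (Δ := SpectralAlg.formConst κ c ζ γ * SpectralAlg.logFactor ζ γ n δ)
      (hD.trans (le_mul_of_one_le_right (by linarith) hy)) hΔr
      (by linarith : (0 : ℝ) < _ + 1) (by linarith) hθ0
      (SpectralAlg.log_two_div_add_one_le hδ hδ1)
      (mul_nonneg (mul_nonneg (SpectralAlg.noiseConst_nonneg hκ0 hM.le hQ.le hR) (by positivity))
        (by linarith))
      (SpectralAlg.noise_le hκ0 hγ.1 hc hM.le hQ.le hR hn rfl hℓ)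
      (k := 6 * κ ^ 2 * (3 * Real.log (6 / δ))) (by nlinarith)
      (fun h => SpectralAlg.deviation_le hγ.1 h hn rfl (by linarith)))
  intro h
  exact hz ⟨h.1, h.2.trans (SpectralAlg.error_le_rateConst_mul_rate hκ hγ.1 hR ha2 hn
    hδ hδ1 rfl rfl)⟩
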